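/- Let $\sigma>0$ and define weights $\beta_n>0$ by $\beta_0=1$, $\beta_{m+1}^2=\beta_m^2\,\frac{m+1}{m+\sigma}$ for $m\ge 0$. Let $\mathcal H_\beta$ be the weighted Hardy space of power series $f=\sum_{n\ge 0}a_nz^n$ with $\sum_n|a_n|^2\beta_n^2<\infty$. Let $N\ge 2$ and let $L=\sum_{k=0}^N p_k(z)D^k$, $D=d/dz$, be $\mathbb D$-regular, i.e. the coefficients $p_k$ are analytic on the closed unit disk and $p_N(z)\neq 0$ for $|z|=1$. Suppose that $p_N$ is an $R$-symmetric polynomial: it has degree at most $2N$, and for some $0\le M\le N$ its roots, listed with multiplicity, are nonzero numbers $z_1,\dots,z_M$ in the open unit disk, the point $0$ with multiplicity $N-M$, and $1/\overline{z_1},\dots,1/\overline{z_M}$. Let $\mathcal L$ be the maximal operator of $L$ in $\mathcal H_\beta$, that is $\mathcal Lf=Lf$ on the domain $\{f\in\mathcal H_\beta : Lf\in\mathcal H_\beta\}$. Then there are constants $C_1\in\mathbb C\setminus\{0\}$, $\tau>0$ and $C_2\in\mathbb C$ such that for every $\epsilon$ with $0<\epsilon<1$ there is a sequence $\{\mu_n\}_{n\in\mathbb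 Z}$ of complex numbers with $$\mu_n/C_1=(n/\tau+C_2)^N+O(|n|^{N-2+\epsilon})\qquad (|n|\to\infty)$$ such that each eigenvalue of $\mathcal L$ is an element of $\{\mu_n\}$. Moreover, there is an $R$ such that every eigenvalue $\lambda$ of $\mathcal L$ with $|\lambda|>R$ has algebraic multiplicity at most $2$, where the algebraic multiplicity of $\lambda$ is the dimension of $\bigcup_{j\ge 1}\ker(\mathcal L-\lambda I)^j$. -/

import Mathlib

open Polynomial

/-- The squares `β_n ^ 2` of the weights with parameter `σ`:
`β_0 ^ 2 = 1` and `β_{m+1} ^ 2 = β_m ^ 2 (m + 1) / (m + σ)`; in particular `β_1 ^ 2 = 1 / σ`. -/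
noncomputable def betaSq (σ : ℝ) : ℕ → ℝ
  | 0 => 1
  | m + 1 => betaSq σ m * ((m + 1) / (m + σ))

/-- The weighted Hardy space `H_β`: the power series `∑ a_n z ^ n` with
`∑ |a_n| ^ 2 β_n ^ 2 < ∞`. (For `σ > 0` the numbers `β_n ^ 2` are positive and the absolute value
around them has no effect.) -/
noncomputable def weightedHardy (σ : ℝ) : Submodule ℂ (PowerSeries ℂ) where
  carrier := {f | Summable fun n => ‖PowerSeries.coeff n f‖ ^ 2 * |betaSq σ n|}
  zero_mem' := by simp [summable_zero]
  add_mem' := by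
    intro f g hf hg
    refine Summable.of_nonneg_of_le (fun n => by positivity) (fun n => ?_)
      ((hf.mul_left 2).add (hg.mul_left 2))
    have h := norm_add_le (PowerSeries.coeff n f) (PowerSeries.coeff n g)
    have h2 : ‖PowerSeries.coeff n (f + g)‖ ^ 2 ≤
        2 * ‖PowerSeries.coeff n f‖ ^ 2 + 2 * ‖PowerSeries.coeff n g‖ ^ 2 := by
      rw [map_add]
      have h3 := norm_nonneg (PowerSeries.coeff n f + PowerSeries.coeff n g)
      nlinarith [sq_nonneg (‖PowerSeries.coeff n f‖ - ‖PowerSeries.coeff n g‖)]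
    calc _ ≤ (2 * ‖PowerSeries.coeff n f‖ ^ 2 + 2 * ‖PowerSeries.coeff n g‖ ^ 2) *
          |betaSq σ n| := mul_le_mul_of_nonneg_right h2 (abs_nonneg _)
      _ = _ := by ring
  smul_mem' := by
    intro c f hf
    have h := Summable.mul_left (‖c‖ ^ 2) hf
    refine h.congr (fun n => ?_)
    simp only [map_smul, smul_eq_mul, norm_mul]
    ring

/-- The Taylor series at `0` of a function. -/
noncomputable def taylorSeries (f : ℂ → ℂ) : PowerSeries ℂ :=
  PowerSeries.mk fun n => iteratedDeriv n f 0 / (n.factorial : ℂ)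

/-- The differential expression `L = ∑_{k=0}^N p_k(z) D ^ k`, `D = d/dz`, acting on power series
(products are Cauchy products, differentiation is termwise). -/
noncomputable def diffExpr (N : ℕ) (p : ℕ → ℂ → ℂ) : PowerSeries ℂ →ₗ[ℂ] PowerSeries ℂ :=
  ∑ k ∈ Finset.range (N + 1),
    LinearMap.mulLeft ℂ (taylorSeries (p k)) ∘ₗ
      ((PowerSeries.derivative ℂ).toLinearMap ^ k : Module.End ℂ (PowerSeries ℂ))

/-- The maximal operator of `L` in `H_β`: it acts by `L` on `{f ∈ H_β | L f ∈ H_β}`. -/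
noncomputable def maximalOperator (σ : ℝ) (N : ℕ) (p : ℕ → ℂ → ℂ) :
    weightedHardy σ →ₗ.[ℂ] weightedHardy σ where
  domain := (weightedHardy σ).comap (diffExpr N p ∘ₗ (weightedHardy σ).subtype)
  toFun := LinearMap.codRestrict (weightedHardy σ)
    ((diffExpr N p ∘ₗ (weightedHardy σ).subtype) ∘ₗ Submodule.subtype _) (fun f => f.2)

/-- `λ` is an eigenvalue of the (unbounded) operator `T`. -/
def IsEigenvalue {E : Type*} [AddCommGroup E] [Module ℂ E] (T : E →ₗ.[ℂ] E) (lam : ℂ) : Prop :=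
  ∃ f : T.domain, (f : E) ≠ 0 ∧ T f = lam • (f : E)

/-- The null space of `(T - λ) ^ j` with its natural domain, for an unbounded operator `T`. -/
def nullPow {E : Type*} [AddCommGroup E] [Module ℂ E] (T : E →ₗ.[ℂ] E) (lam : ℂ) :
    ℕ → Submodule ℂ E
  | 0 => ⊥
  | j + 1 => ((nullPow T lam j).comap (T.toFun - lam • T.domain.subtype)).map T.domain.subtype

/-- The algebraic multiplicity of `λ`: the dimension of the union over `j` of the null spaces
of `(T - λ) ^ j`. -/
noncomputable def algMultiplicity {E : Type*} [AddCommGroup E] [Module ℂ E]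
    (T : E →ₗ.[ℂ] E) (lam : ℂ) : Cardinal :=
  Module.rank ℂ (⨆ j : ℕ, nullPow T lam j : Submodule ℂ E)

/-- `L = ∑_{k=0}^N p_k(z) D ^ k` is `𝔻`-regular: the coefficients are analytic on the closed unit
disk, and the leading one has no zeros on the unit circle. -/
def IsDRegular (N : ℕ) (p : ℕ → ℂ → ℂ) : Prop :=
  (∀ k ≤ N, AnalyticOnNhd ℂ (p k) (Metric.closedBall 0 1)) ∧ ∀ z : ℂ, ‖z‖ = 1 → p N z ≠ 0

/-- `P` is `R`-symmetric (with respect to `N`): it has degree at most `2N`, and its roots, with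
multiplicity, are nonzero `z_1, …, z_M` in the open unit disk (`M ≤ N`), the point `0` with
multiplicity `N - M`, and the reflected points `1 / conj z_1, …, 1 / conj z_M`. -/
def IsRSymmetric (N : ℕ) (P : ℂ[X]) : Prop :=
  P ≠ 0 ∧ P.natDegree ≤ 2 * N ∧
    ∃ s : Multiset ℂ, s.card ≤ N ∧ (∀ z ∈ s, z ≠ 0 ∧ ‖z‖ < 1) ∧
      P.roots = s + Multiset.replicate (N - s.card) 0 +
        s.map (fun z => 1 / (starRingEnd ℂ) z)

/-!
A solution of `(L - λ) f = g` with polynomially growing coefficients and `g` smooth up to the unit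
circle is itself smooth there, because `p_N` does not vanish on the circle. So eigenfunctions and
root vectors can be studied through their boundary values, whatever `σ` is. `R`-symmetry says that
`p_N(z) = C z^N w(z)` with `w > 0` on the circle: then `w ^ (-1 / N)` is, up to a constant, the
density of a new angular variable, and in this variable, after multiplication by a nonvanishing
gauge function, `L` becomes `C₁ ((-i d/dx + α) ^ N + terms of order at most N - 2)` on smooth
`2π`-periodic functions. In Fourier coordinates this is the diagonal matrix `(n + α) ^ N` plus a
perturbation of size `O(|n| ^ (N - 2))`. The diagonal entries `(n + α) ^ N` accumulate in groups of
at most two, the groups being separated by gaps of order `|n| ^ (N - 1)`; a cone argument applied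
to root vectors then leaves room for at most as many of them as the group has members.
-/

open Filter Topology MeasureTheory
open scoped ENNReal

section Cone

variable {𝕜 V : Type*} [NormedField 𝕜] [AddCommGroup V] [Module 𝕜 V] {T : Module.End 𝕜 V}

theorem aeval_prod_X_sub_C_cons (T : Module.End 𝕜 V) (z : 𝕜) (S : Multiset 𝕜) (u : V) :
    aeval T (((z ::ₘ S).map fun y => X - C y).prod) u =
      aeval T ((S.map fun y => X - C y).prod) (T u - z • u) := by
  rw [Multiset.map_cons, Multiset.prod_cons, mul_comm, map_mul, Module.End.mul_apply]
  simp [Module.algebraMap_end_apply]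

theorem aeval_sub_algebraMap_prod_X_sub_C (T : Module.End 𝕜 V) (l : 𝕜) (S : Multiset 𝕜) :
    aeval (T - algebraMap 𝕜 (Module.End 𝕜 V) l) (((S.map (· - l)).map fun z => X - C z).prod) =
      aeval T ((S.map fun z => X - C z).prod) := by
  induction S using Multiset.induction with
  | empty => simp
  | cons z S ih =>
    simp only [Multiset.map_cons, Multiset.prod_cons, map_mul, ih]
    congr 1
    simp

theorem exists_seminorm_pow_apply_le (f : Seminorm 𝕜 V) {r s : ℝ} (hr : 0 ≤ r) (hrs : r < s)
    {S : Multiset 𝕜} (hS : ∀ z ∈ S, ‖z‖ ≤ r) {u : V}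
    (hu : aeval T ((S.map fun z => X - C z).prod) u = 0) :
    ∃ B : ℝ, ∀ j : ℕ, f ((T ^ j) u) ≤ B * s ^ j := by
  have hs : 0 < s := hr.trans_lt hrs
  induction S using Multiset.induction generalizing u with
  | empty => exact ⟨0, fun j => by simp [show u = 0 by simpa using hu]⟩
  | cons z S ih =>
    rw [aeval_prod_X_sub_C_cons] at hu
    obtain ⟨B, hB⟩ := ih (fun y hy => hS y (Multiset.mem_cons_of_mem hy)) hu
    refine ⟨max (f u) (B / (s - r)), fun j => ?_⟩
    set B' := max (f u) (B / (s - r)) with hB'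
    induction j with
    | zero => simp [hB']
    | succ j ihj =>
      have hBB' : B ≤ (s - r) * B' := (div_le_iff₀' (sub_pos.2 hrs)).1 (le_max_right _ _)
      calc f ((T ^ (j + 1)) u) = f (z • (T ^ j) u + (T ^ j) (T u - z • u)) := by
            rw [map_sub, map_smul, add_sub_cancel, pow_succ, Module.End.mul_apply]
        _ ≤ ‖z‖ * f ((T ^ j) u) + f ((T ^ j) (T u - z • u)) := by
            simpa only [map_smul_eq_mul] using map_add_le_add f (z • (T ^ j) u) _
        _ ≤ r * (B' * s ^ j) + (s - r) * B' * s ^ j := by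
            gcongr
            · exact hS z (Multiset.mem_cons_self z S)
            · exact (hB j).trans (mul_le_mul_of_nonneg_right hBB' (by positivity))
        _ = B' * s ^ (j + 1) := by ring

/- In the cone `f ≤ g` the powers of `T` grow at least like `s ^ j`, whereas on the root space they
grow at most like any number larger than `r`. -/
theorem eq_zero_of_expanding_cone {f g : Seminorm 𝕜 V} {r s : ℝ} (hr : 0 ≤ r) (hrs : r < s)
    (hcone : ∀ u, f u ≤ g u → f (T u) ≤ g (T u) ∧ s * g u ≤ g (T u))
    {S : Multiset 𝕜} (hS : ∀ z ∈ S, ‖z‖ ≤ r) {u : V}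
    (hu : aeval T ((S.map fun z => X - C z).prod) u = 0) (hfg : f u ≤ g u) : g u = 0 := by
  obtain ⟨t, hrt, hts⟩ := exists_between hrs
  obtain ⟨B, hB⟩ := exists_seminorm_pow_apply_le g hr hrt hS hu
  have ht : 0 < t := hr.trans_lt hrt
  have hs : 0 < s := ht.trans hts
  have grow (j : ℕ) : f ((T ^ j) u) ≤ g ((T ^ j) u) ∧ s ^ j * g u ≤ g ((T ^ j) u) := by
    induction j with
    | zero => simpa using hfg
    | succ j ih =>
      have hstep := hcone _ ih.1
      rw [pow_succ' T, Module.End.mul_apply, pow_succ', mul_assoc]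
      exact ⟨hstep.1, (mul_le_mul_of_nonneg_left ih.2 hs.le).trans hstep.2⟩
  have hle (j : ℕ) : g u ≤ B * (t / s) ^ j := by
    rw [div_pow, mul_div_assoc', le_div_iff₀' (by positivity)]
    exact (grow j).2.trans (hB j)
  have hlim : Tendsto (fun j : ℕ => B * (t / s) ^ j) atTop (𝓝 (B * 0)) :=
    (tendsto_pow_atTop_nhds_zero_of_lt_one (by positivity) ((div_lt_one hs).2 hts)).const_mul B
  rw [mul_zero] at hlim
  exact le_antisymm (ge_of_tendsto' hlim hle) (apply_nonneg g u)

end Cone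

section Lp

variable {α E F : Type*} {m : MeasurableSpace α} {μ : Measure α} {p : ℝ≥0∞}
  [NormedAddCommGroup E] [NormedAddCommGroup F]

theorem lpNorm_le_mul_lpNorm_of_ae_le_mul {f : α → E} {g : α → F} {c : ℝ} (hc : 0 ≤ c)
    (hg : MemLp g p μ) (h : ∀ᵐ x ∂μ, ‖f x‖ ≤ c * ‖g x‖) : lpNorm f p μ ≤ c * lpNorm g p μ := by
  by_cases hf : AEStronglyMeasurable f μ
  · rw [← toReal_eLpNorm hf, ← toReal_eLpNorm hg.1, ← ENNReal.toReal_ofReal_mul c _ hc]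
    exact ENNReal.toReal_mono (ENNReal.mul_ne_top ENNReal.ofReal_ne_top hg.eLpNorm_ne_top)
      (eLpNorm_le_mul_eLpNorm_of_ae_le_mul h p)
  · rw [lpNorm_of_not_aestronglyMeasurable hf]
    exact mul_nonneg hc lpNorm_nonneg

theorem lpNorm_restrict_le {f : α → E} (hf : MemLp f p μ) (s : Set α) :
    lpNorm f p (μ.restrict s) ≤ lpNorm f p μ := by
  rw [← toReal_eLpNorm hf.1, ← toReal_eLpNorm hf.1.restrict]
  exact ENNReal.toReal_mono hf.eLpNorm_ne_top (eLpNorm_restrict_le f p μ s)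

theorem lpNorm_le_restrict_add_restrict_compl {f : α → E} (hf : MemLp f p μ) (hp : 1 ≤ p)
    {s : Set α} (hs : MeasurableSet s) :
    lpNorm f p μ ≤ lpNorm f p (μ.restrict s) + lpNorm f p (μ.restrict sᶜ) := by
  have indicator_eq {t : Set α} (ht : MeasurableSet t) :
      lpNorm (t.indicator f) p μ = lpNorm f p (μ.restrict t) := by
    rw [← toReal_eLpNorm (hf.1.indicator ht), ← toReal_eLpNorm hf.1.restrict,
      eLpNorm_indicator_eq_eLpNorm_restrict ht]
  calc lpNorm f p μ = lpNorm (s.indicator f + sᶜ.indicator f) p μ := by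
        rw [Set.indicator_self_add_compl]
    _ ≤ _ := by
        rw [← indicator_eq hs, ← indicator_eq hs.compl]
        exact lpNorm_add_le (hf.indicator hs) hp

variable {𝕜 V : Type*} [NormedField 𝕜] [AddCommGroup V] [Module 𝕜 V]

/-- The seminorm `u ↦ ‖c u‖_p` on a space `V` with coordinates `c : V → L^p(μ)`. -/
noncomputable def lpSeminorm (c : V →ₗ[𝕜] α → 𝕜) (hp : 1 ≤ p) (hc : ∀ u, MemLp (c u) p μ) :
    Seminorm 𝕜 V :=
  Seminorm.of (fun u => lpNorm (c u) p μ)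
    (fun u v => by simpa using lpNorm_add_le (hc u) hp)
    (fun a u => by simpa using lpNorm_const_smul a (c u) μ)

/-- In the coordinates `c : V → L^p(μ)`, the operator `T` is multiplication by `w` up to an error
which is dominated by multiplication by `q`. -/
structure IsMulPerturbation (T : Module.End 𝕜 V) (c : V →ₗ[𝕜] α → 𝕜) (w q : α → 𝕜) (p : ℝ≥0∞)
    (μ : Measure α) : Prop where
  memLp : ∀ u, MemLp (c u) p μ
  memLp_mul : ∀ u, MemLp (w * c u) p μ
  memLp_bound : ∀ u, MemLp (q * c u) p μ
  lpNorm_le : ∀ u, lpNorm (c (T u) - w * c u) p μ ≤ lpNorm (q * c u) p μ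

namespace IsMulPerturbation

variable {T : Module.End 𝕜 V} {c : V →ₗ[𝕜] α → 𝕜} {w q : α → 𝕜}

theorem sub_algebraMap (h : IsMulPerturbation T c w q p μ) (l : 𝕜) :
    IsMulPerturbation (T - algebraMap 𝕜 (Module.End 𝕜 V) l) c (fun x => w x - l) q p μ where
  memLp := h.memLp
  memLp_mul u := by
    convert (h.memLp_mul u).sub ((h.memLp u).const_smul l) using 1
    ext x
    simp [sub_mul]
  memLp_bound := h.memLp_bound
  lpNorm_le u := by
    convert h.lpNorm_le u using 2
    ext x
    simp [Module.algebraMap_end_apply, sub_mul]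

/- The perturbation is small compared with `w` off `I`, so a vector whose coordinates are
concentrated off `I` keeps this property under `T`. -/
theorem expanding_cone (h : IsMulPerturbation T c w q p μ) (hp : 1 ≤ p) {I : Set α}
    (hI : MeasurableSet I) {r s η ε : ℝ} (hr : 0 ≤ r) (hs : 0 ≤ s) (hη : 0 ≤ η) (hε : 0 ≤ ε)
    (hin : ∀ x ∈ I, ‖w x‖ ≤ r ∧ ‖q x‖ ≤ η) (hout : ∀ x ∉ I, s ≤ ‖w x‖ ∧ ‖q x‖ ≤ ε * ‖w x‖)
    (hgap : r < (1 - 2 * ε) * s - 2 * η) {u : V}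
    (hu : lpNorm (c u) p (μ.restrict I) ≤ lpNorm (c u) p (μ.restrict Iᶜ)) :
    lpNorm (c (T u)) p (μ.restrict I) ≤ lpNorm (c (T u)) p (μ.restrict Iᶜ) ∧
      ((1 - ε) * s - η) * lpNorm (c u) p (μ.restrict Iᶜ) ≤
        lpNorm (c (T u)) p (μ.restrict Iᶜ) := by
  have hε2 : 0 < 1 - 2 * ε := pos_of_mul_pos_left (by linarith : 0 < (1 - 2 * ε) * s) hs
  set e := c (T u) - w * c u
  have he : MemLp e p μ := (h.memLp _).sub (h.memLp_mul u)
  set a := lpNorm (c u) p (μ.restrict I)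
  set b := lpNorm (c u) p (μ.restrict Iᶜ)
  set g := lpNorm (w * c u) p (μ.restrict Iᶜ)
  set D := lpNorm e p μ
  have mul_le {x : α} {f : α → 𝕜} {M : ℝ} (hM : ‖f x‖ ≤ M) : ‖(f * c u) x‖ ≤ M * ‖c u x‖ := by
    rw [Pi.mul_apply, norm_mul]
    exact mul_le_mul_of_nonneg_right hM (norm_nonneg _)
  have hgb : s * b ≤ g := by
    rcases hs.eq_or_lt with rfl | hs
    · rw [zero_mul]
      exact lpNorm_nonneg
    rw [← le_inv_mul_iff₀ hs]
    refine lpNorm_le_mul_lpNorm_of_ae_le_mul (inv_nonneg.2 hs.le) ((h.memLp_mul u).restrict _)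
      (ae_restrict_of_forall_mem hI.compl fun x hx => ?_)
    rw [le_inv_mul_iff₀ hs, Pi.mul_apply, norm_mul]
    exact mul_le_mul_of_nonneg_right (hout x hx).1 (norm_nonneg _)
  have hD : D ≤ η * a + ε * g := by
    refine (h.lpNorm_le u).trans
      ((lpNorm_le_restrict_add_restrict_compl (h.memLp_bound u) hp hI).trans (add_le_add ?_ ?_))
    · exact lpNorm_le_mul_lpNorm_of_ae_le_mul hη ((h.memLp u).restrict _)
        (ae_restrict_of_forall_mem hI fun x hx => mul_le (hin x hx).2)
    · refine lpNorm_le_mul_lpNorm_of_ae_le_mul hε ((h.memLp_mul u).restrict _)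
        (ae_restrict_of_forall_mem hI.compl fun x hx => (mul_le (hout x hx).2).trans_eq ?_)
      rw [Pi.mul_apply, norm_mul, mul_assoc]
  have hinner : lpNorm (c (T u)) p (μ.restrict I) ≤ r * a + D := by
    have := lpNorm_le_lpNorm_add_lpNorm_sub' (f := c (T u)) ((h.memLp_mul u).restrict I) hp
    refine this.trans (add_le_add ?_ (lpNorm_restrict_le he I))
    exact lpNorm_le_mul_lpNorm_of_ae_le_mul hr ((h.memLp u).restrict _)
      (ae_restrict_of_forall_mem hI fun x hx => mul_le (hin x hx).1)
  have houter : g ≤ lpNorm (c (T u)) p (μ.restrict Iᶜ) + D :=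
    (lpNorm_le_lpNorm_add_lpNorm_sub ((h.memLp (T u)).restrict Iᶜ) hp).trans
      (add_le_add_right (lpNorm_restrict_le he Iᶜ) _)
  have hra : r * a ≤ r * b := mul_le_mul_of_nonneg_left hu hr
  have hηa : η * a ≤ η * b := mul_le_mul_of_nonneg_left hu hη
  have hb : 0 ≤ b := lpNorm_nonneg
  constructor <;> nlinarith

theorem eq_zero_of_aeval_eq_zero (h : IsMulPerturbation T c w q p μ) (hp : 1 ≤ p)
    (hinj : ∀ u, c u =ᵐ[μ] 0 → u = 0) (l : 𝕜) {I : Set α} (hI : MeasurableSet I) {r s η ε : ℝ}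
    (hr : 0 ≤ r) (hs : 0 ≤ s) (hη : 0 ≤ η) (hε : 0 ≤ ε)
    (hin : ∀ x ∈ I, ‖w x - l‖ ≤ r ∧ ‖q x‖ ≤ η)
    (hout : ∀ x ∉ I, s ≤ ‖w x - l‖ ∧ ‖q x‖ ≤ ε * ‖w x - l‖)
    (hgap : r < (1 - 2 * ε) * s - 2 * η) {S : Multiset 𝕜} (hS : ∀ z ∈ S, ‖z - l‖ ≤ r) {u : V}
    (hu : aeval T ((S.map fun z => X - C z).prod) u = 0) (huI : ∀ x ∈ I, c u x = 0) : u = 0 := by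
  have hsub := h.sub_algebraMap l
  have huI' : lpNorm (c u) p (μ.restrict I) = 0 := by
    refine le_antisymm ?_ lpNorm_nonneg
    simpa using lpNorm_le_mul_lpNorm_of_ae_le_mul le_rfl ((h.memLp u).restrict I)
      (ae_restrict_of_forall_mem hI fun x hx => by simp [huI x hx])
  have hcompl : lpNorm (c u) p (μ.restrict Iᶜ) = 0 :=
    eq_zero_of_expanding_cone (f := lpSeminorm c hp fun v => (h.memLp v).restrict I)
      (g := lpSeminorm c hp fun v => (h.memLp v).restrict Iᶜ) hr (s := (1 - ε) * s - η)
      (by nlinarith) (fun v hv => hsub.expanding_cone hp hI hr hs hη hε hin hout hgap hv)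
      (S := S.map (· - l)) (by simpa using hS) (by rwa [aeval_sub_algebraMap_prod_X_sub_C])
      (huI'.trans_le lpNorm_nonneg)
  refine hinj u ((lpNorm_eq_zero (h.memLp u) (zero_lt_one.trans_le hp).ne').1 ?_)
  refine le_antisymm ?_ lpNorm_nonneg
  simpa [huI', hcompl] using lpNorm_le_restrict_add_restrict_compl (h.memLp u) hp hI

end IsMulPerturbation

end Lp

section Separation

theorem mul_norm_le_norm_sub_add {ζ a b : ℂ} (hζ : ‖ζ‖ = 1) :
    |ζ.im| * ‖b‖ ≤ ‖a - ζ * b‖ + |a.im| + 2 * |b.im| := by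
  have hre : |ζ.re| ≤ 1 := hζ ▸ Complex.abs_re_le_norm ζ
  have him : |ζ.im| ≤ 1 := hζ ▸ Complex.abs_im_le_norm ζ
  have hsplit : ζ.im * b.re = a.im - (a - ζ * b).im - ζ.re * b.im := by
    simp only [Complex.sub_im, Complex.mul_im]
    ring
  calc |ζ.im| * ‖b‖ ≤ |ζ.im| * (|b.re| + |b.im|) := by
        gcongr
        exact Complex.norm_le_abs_re_add_abs_im b
    _ = |a.im - (a - ζ * b).im - ζ.re * b.im| + |ζ.im| * |b.im| := by
        rw [← hsplit, abs_mul, mul_add]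
    _ ≤ |a.im| + |(a - ζ * b).im| + |ζ.re| * |b.im| + |ζ.im| * |b.im| := by
        rw [← abs_mul ζ.re]
        gcongr
        exact (abs_sub _ _).trans (add_le_add_left (abs_sub _ _) _)
    _ ≤ ‖a - ζ * b‖ + |a.im| + 2 * |b.im| := by
        have h₁ := Complex.abs_im_le_norm (a - ζ * b)
        have h₂ := mul_le_mul_of_nonneg_right hre (abs_nonneg b.im)
        have h₃ := mul_le_mul_of_nonneg_right him (abs_nonneg b.im)
        linarith

theorem mul_max_norm_le_norm_sub_add {ζ a b : ℂ} {h : ℝ} (hζ : ‖ζ‖ = 1) (ha : |a.im| ≤ h)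
    (hb : |b.im| ≤ h) : |ζ.im| * max ‖a‖ ‖b‖ ≤ ‖a - ζ * b‖ + 3 * h := by
  rw [mul_max_of_nonneg _ _ (abs_nonneg _), max_le_iff]
  refine ⟨?_, (mul_norm_le_norm_sub_add hζ).trans (by linarith)⟩
  have hinv : ζ * (starRingEnd ℂ) ζ = 1 := by simp [Complex.mul_conj', hζ]
  have hswap : ‖b - (starRingEnd ℂ) ζ * a‖ = ‖a - ζ * b‖ := by
    rw [← one_mul ‖b - _‖, ← hζ, ← norm_mul, norm_sub_rev]
    congr 1
    linear_combination -a * hinv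
  have := mul_norm_le_norm_sub_add (ζ := (starRingEnd ℂ) ζ) (a := b) (b := a) (by simpa using hζ)
  rw [hswap, Complex.conj_im, abs_neg] at this
  linarith

theorem exists_le_abs_im_of_pow_eq_one {N : ℕ} (hN : 0 < N) :
    ∃ c : ℝ, 0 < c ∧ c ≤ 1 ∧ ∀ ζ : ℂ, ζ ^ N = 1 → ζ = 1 ∨ ζ = -1 ∨ c ≤ |ζ.im| := by
  have hroots : ∀ᶠ c in 𝓝[>] (0 : ℝ), ∀ ζ ∈ nthRootsFinset N (1 : ℂ), ζ.im ≠ 0 → c ≤ |ζ.im| :=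
    (Filter.eventually_all_finset _).2 fun ζ _ => by
      by_cases hζ : ζ.im = 0
      · simp [hζ]
      · filter_upwards [Ioc_mem_nhdsGT (abs_pos.2 hζ)] with c hc _ using hc.2
  obtain ⟨c, hc, hc01⟩ := (hroots.and (Ioc_mem_nhdsGT zero_lt_one)).exists
  refine ⟨c, hc01.1, hc01.2, fun ζ hζ => ?_⟩
  by_cases him : ζ.im = 0
  · have hre : |ζ.re| = 1 := by
      rw [Complex.abs_re_eq_norm.2 him, Complex.norm_eq_one_of_pow_eq_one hζ hN.ne']
    rcases eq_or_eq_neg_of_abs_eq hre with h | h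
    · exact Or.inl (Complex.ext h him)
    · exact Or.inr (Or.inl (Complex.ext h (by simpa using him)))
  · exact Or.inr (Or.inr (hc ζ ((mem_nthRootsFinset hN _).2 hζ) him))

theorem norm_pow_sub_pow_ge {N : ℕ} (hN : 0 < N) {a b ζ₀ : ℂ} {d : ℝ} (hd : 0 ≤ d)
    (h : ∀ ζ : ℂ, ζ ^ N = 1 → ζ ≠ ζ₀ → d ≤ ‖a - ζ * b‖) :
    ζ₀ ^ N = 1 ∧ ‖a - ζ₀ * b‖ * d ^ (N - 1) ≤ ‖a ^ N - b ^ N‖ ∨ d ^ N ≤ ‖a ^ N - b ^ N‖ := by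
  have hprim := Complex.isPrimitiveRoot_exp N hN.ne'
  rw [hprim.pow_sub_pow_eq_prod_sub_mul a b hN, norm_prod]
  have hmem {ζ : ℂ} : ζ ∈ nthRootsFinset N (1 : ℂ) ↔ ζ ^ N = 1 := mem_nthRootsFinset hN _
  by_cases h₀ : ζ₀ ^ N = 1
  · refine Or.inl ⟨h₀, ?_⟩
    have hcard : ((nthRootsFinset N (1 : ℂ)).erase ζ₀).card = N - 1 := by
      rw [Finset.card_erase_of_mem (hmem.2 h₀), hprim.card_nthRootsFinset]
    rw [← Finset.mul_prod_erase _ _ (hmem.2 h₀), ← hcard, ← Finset.prod_const]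
    refine mul_le_mul_of_nonneg_left (Finset.prod_le_prod (fun _ _ => hd) fun ζ hζ => ?_)
      (norm_nonneg _)
    obtain ⟨hne, hζ⟩ := Finset.mem_erase.1 hζ
    exact h ζ (hmem.1 hζ) hne
  · refine Or.inr ?_
    have hconst : d ^ N = ∏ _ζ ∈ nthRootsFinset N (1 : ℂ), d := by
      rw [Finset.prod_const, hprim.card_nthRootsFinset]
    rw [hconst]
    refine Finset.prod_le_prod (fun _ _ => hd) fun ζ hζ => h ζ (hmem.1 hζ) ?_
    rintro rfl
    exact h₀ (hmem.1 hζ)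

theorem tendsto_norm_intCast_add_cofinite (x : ℂ) :
    Tendsto (fun m : ℤ => ‖(m : ℂ) + x‖) cofinite atTop := by
  have hint : Tendsto (fun m : ℤ => ‖(m : ℝ)‖) cofinite atTop :=
    tendsto_norm_comp_cofinite_atTop_of_isClosedEmbedding Int.isClosedEmbedding_coe_real
  refine tendsto_atTop_mono (fun m => ?_) (tendsto_atTop_add_const_right _ (-‖x‖) hint)
  have := norm_sub_norm_le (m : ℂ) (-x)
  rwa [sub_neg_eq_add, norm_neg, Complex.norm_intCast] at this

theorem finite_norm_intCast_add_le (x : ℂ) (t : ℝ) : {m : ℤ | ‖(m : ℂ) + x‖ ≤ t}.Finite := by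
  have := (tendsto_norm_intCast_add_cofinite x).eventually_gt_atTop t
  simpa only [Filter.eventually_cofinite, not_lt] using this

theorem exists_pos_le_norm_intCast_add (x : ℂ) :
    ∃ γ : ℝ, 0 < γ ∧ γ ≤ 1 ∧ ∀ k : ℤ, (k : ℂ) + x = 0 ∨ γ ≤ ‖(k : ℂ) + x‖ := by
  have hfin : ∀ᶠ γ in 𝓝[>] (0 : ℝ), ∀ k ∈ (finite_norm_intCast_add_le x 1).toFinset,
      (k : ℂ) + x = 0 ∨ γ ≤ ‖(k : ℂ) + x‖ :=
    (Filter.eventually_all_finset _).2 fun k _ => by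
      by_cases hk : (k : ℂ) + x = 0
      · simp [hk]
      · filter_upwards [Ioc_mem_nhdsGT (norm_pos_iff.2 hk)] with γ hγ using Or.inr hγ.2
  obtain ⟨γ, hγ, hγ01⟩ := (hfin.and (Ioc_mem_nhdsGT zero_lt_one)).exists
  refine ⟨γ, hγ01.1, hγ01.2, fun k => ?_⟩
  by_cases hk : ‖(k : ℂ) + x‖ ≤ 1
  · exact hγ k (by simpa using hk)
  · exact Or.inr (hγ01.2.trans (not_le.1 hk).le)

/- The only factors of `a ^ N - b ^ N = ∏ (a - ζ b)` which can be small are `a - b` and `a + b`,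
and only one of them at a time. -/
theorem exists_norm_pow_sub_pow_ge {N : ℕ} (hN : 0 < N) :
    ∃ c : ℝ, 0 < c ∧ c ≤ 1 ∧ ∀ (a b : ℂ) (h : ℝ), |a.im| ≤ h → |b.im| ≤ h →
      3 * h ≤ c * max ‖a‖ ‖b‖ → ∃ ζ : ℂ, (ζ = 1 ∨ ζ = -1) ∧
        (ζ ^ N = 1 ∧ ‖a - ζ * b‖ * (c * max ‖a‖ ‖b‖) ^ (N - 1) ≤ ‖a ^ N - b ^ N‖ ∨
          (c * max ‖a‖ ‖b‖) ^ N ≤ ‖a ^ N - b ^ N‖) := by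
  obtain ⟨c, hc, hc1, hroots⟩ := exists_le_abs_im_of_pow_eq_one hN
  refine ⟨c / 2, by positivity, by linarith, fun a b h ha hb hh => ?_⟩
  set M := max ‖a‖ ‖b‖
  have hM : 0 ≤ M := (norm_nonneg a).trans (le_max_left _ _)
  have hcM : c / 2 * M ≤ M := mul_le_of_le_one_left hM (by linarith)
  have hnonreal {ζ : ℂ} (hζ : ζ ^ N = 1) (hζc : c ≤ |ζ.im|) : c / 2 * M ≤ ‖a - ζ * b‖ := by
    have := mul_max_norm_le_norm_sub_add (Complex.norm_eq_one_of_pow_eq_one hζ hN.ne') ha hb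
    have := mul_le_mul_of_nonneg_right hζc hM
    linarith
  have hM2 : 2 * M ≤ ‖a + b‖ + ‖a - b‖ := by
    rw [mul_max_of_nonneg _ _ zero_le_two, max_le_iff, ← Complex.norm_two, ← norm_mul, ← norm_mul,
      show 2 * a = (a + b) + (a - b) by ring, show 2 * b = (a + b) - (a - b) by ring]
    exact ⟨norm_add_le _ _, norm_sub_le _ _⟩
  obtain ⟨ζ₀, hζ₀, hM₀⟩ : ∃ ζ₀ : ℂ, (ζ₀ = 1 ∨ ζ₀ = -1) ∧ M ≤ ‖a + ζ₀ * b‖ := by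
    rcases le_or_gt M ‖a + b‖ with hle | hlt
    · exact ⟨1, Or.inl rfl, by simpa using hle⟩
    · exact ⟨-1, Or.inr rfl, by rw [neg_one_mul, ← sub_eq_add_neg]; linarith⟩
  refine ⟨ζ₀, hζ₀, norm_pow_sub_pow_ge hN (by positivity) fun ζ hζ hne => ?_⟩
  by_cases hneg : ζ = -ζ₀
  · rw [hneg, neg_mul, sub_neg_eq_add]
    exact hcM.trans hM₀
  · refine hnonreal hζ ?_
    have := hroots ζ hζ
    grind

theorem exists_intCast_add_pow_separated (α : ℂ) {N : ℕ} (hN : 0 < N) :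
    ∃ γ r : ℝ, 0 < γ ∧ 1 ≤ r ∧ ∀ m n : ℤ, r ≤ ‖(n : ℂ) + α‖ →
      (((m : ℂ) + α) ^ N = ((n : ℂ) + α) ^ N ∧ (m = n ∨ (m : ℂ) + n + 2 * α = 0)) ∨
      γ * max ‖(m : ℂ) + α‖ ‖(n : ℂ) + α‖ ^ (N - 1) ≤
        ‖((m : ℂ) + α) ^ N - ((n : ℂ) + α) ^ N‖ := by
  obtain ⟨c, hc, hc1, hpow⟩ := exists_norm_pow_sub_pow_ge hN
  obtain ⟨γ, hγ, hγ1, hint⟩ := exists_pos_le_norm_intCast_add (2 * α)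
  refine ⟨γ * c ^ N, max 1 (3 * ‖α‖ / c), by positivity, le_max_left _ _, fun m n hn => ?_⟩
  set a : ℂ := (m : ℂ) + α with ha
  set b : ℂ := (n : ℂ) + α with hb
  set M := max ‖a‖ ‖b‖
  have hrM := hn.trans (le_max_right ‖a‖ ‖b‖)
  have hM : 1 ≤ M := (le_max_left _ _).trans hrM
  have hαM : 3 * ‖α‖ ≤ c * M := (div_le_iff₀' hc).1 ((le_max_right _ _).trans hrM)
  have him (k : ℤ) : |((k : ℂ) + α).im| ≤ ‖α‖ := by simpa using Complex.abs_im_le_norm α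
  obtain ⟨ζ, hζ, hcase⟩ := hpow a b ‖α‖ (him m) (him n) hαM
  have hcoincide : a - ζ * b = 0 ∧ (m = n ∨ (m : ℂ) + n + 2 * α = 0) ∨ γ ≤ ‖a - ζ * b‖ := by
    rcases hζ with rfl | rfl
    · have hab : a - 1 * b = ((m - n : ℤ) : ℂ) := by simp [ha, hb]
      rw [hab, Int.cast_eq_zero, sub_eq_zero, Complex.norm_intCast, or_iff_not_imp_left]
      intro hmn
      have : m ≠ n := by tauto
      exact hγ1.trans (mod_cast Int.one_le_abs (sub_ne_zero.2 this))
    · have hab : a - -1 * b = ((m + n : ℤ) : ℂ) + 2 * α := by rw [ha, hb]; push_cast; ring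
      rw [hab]
      exact (hint (m + n)).imp_left fun h => ⟨h, Or.inr (by simpa using h)⟩
  rcases hcase with ⟨hζN, hge⟩ | hge
  · rcases hcoincide with ⟨h₀, hmn⟩ | hγ₀
    · exact Or.inl ⟨by rw [sub_eq_zero.1 h₀, mul_pow, hζN, one_mul], hmn⟩
    · refine Or.inr (le_trans ?_ hge)
      have : c ^ N ≤ c ^ (N - 1) := pow_le_pow_of_le_one hc.le hc1 (Nat.sub_le N 1)
      rw [mul_pow, ← mul_assoc]
      gcongr
  · refine Or.inr (le_trans ?_ hge)
    rw [mul_pow]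
    have : M ^ (N - 1) ≤ M ^ N := pow_le_pow_right₀ hM (Nat.sub_le N 1)
    gcongr
    exact mul_le_of_le_one_left (by positivity) hγ1

theorem exists_shift_far {ι : Type*} [Fintype ι] (x : ι → ℝ) :
    ∃ s : ℝ, 0 ≤ s ∧ ∀ i, ∀ k : ℤ, 1 / (2 * (Fintype.card ι + 1)) ≤ |k + x i - s| := by
  set d : ℝ := Fintype.card ι + 1
  have hd : 0 < d := by positivity
  by_contra! hcon
  choose i k hik using fun j : Fin (Fintype.card ι + 1) => hcon (j / d) (by positivity)
  obtain ⟨j₁, j₂, hne, heq⟩ := Fintype.exists_ne_map_eq_of_card_lt i (by simp)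
  wlog hlt : j₁ < j₂ generalizing j₁ j₂
  · exact this j₂ j₁ hne.symm heq.symm (hne.lt_or_gt.resolve_left hlt)
  have h₁ := abs_lt.1 (hik j₁)
  have h₂ := abs_lt.1 (hik j₂)
  rw [← heq] at h₂
  have hstep : (j₁ : ℝ) / d + 1 / d ≤ j₂ / d := by
    rw [← add_div]
    gcongr
    exact_mod_cast hlt
  have hwidth : (j₂ : ℝ) / d ≤ j₁ / d + (1 - 1 / d) := by
    rw [one_sub_div hd.ne', ← add_div]
    gcongr
    have : (j₂ : ℝ) ≤ Fintype.card ι := by exact_mod_cast Nat.le_of_lt_succ j₂.2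
    simp only [d, add_sub_cancel_right]
    linarith [(j₁ : ℕ).cast_nonneg (α := ℝ)]
  have hhalf : 1 / (2 * d) = 1 / d / 2 := by field_simp
  have hpos : (0 : ℝ) < ((k j₂ - k j₁ : ℤ) : ℝ) := by push_cast; linarith
  have hlt1 : ((k j₂ - k j₁ : ℤ) : ℝ) < ((1 : ℤ) : ℝ) := by push_cast; linarith
  have hpos' : 0 < k j₂ - k j₁ := by exact_mod_cast hpos
  have hlt1' : k j₂ - k j₁ < 1 := by exact_mod_cast hlt1
  omega

theorem norm_le_abs_re_add {z : ℂ} {h : ℝ} (hh : 0 ≤ h) (hz : z.im ^ 2 ≤ h * ‖z‖) :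
    ‖z‖ ≤ |z.re| + h := by
  have hsq : ‖z‖ ^ 2 = |z.re| ^ 2 + z.im ^ 2 := by
    rw [Complex.sq_norm, Complex.normSq_apply, sq_abs]; ring
  have hre := abs_nonneg z.re
  by_contra! hlt
  nlinarith [mul_nonneg hre (sub_nonneg.2 (Complex.abs_re_le_norm z))]

theorem exists_radius_gap (α : ℂ) (t₀ : ℝ) :
    ∃ t : ℝ, t₀ ≤ t ∧ ∀ m : ℤ, 1 / 12 ≤ |‖(m : ℂ) + α‖ - t| := by
  obtain ⟨s, hs0, hs⟩ := exists_shift_far fun b : Bool => cond b α.re (-α.re)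
  obtain ⟨n, hn⟩ := exists_nat_ge (max t₀ (24 * α.im ^ 2 + 1))
  obtain ⟨hn₀, hn₁⟩ := max_le_iff.1 hn
  refine ⟨s + n, by linarith, fun m => ?_⟩
  set z : ℂ := (m : ℂ) + α with hz
  have hx : 1 / 6 ≤ |(|z.re| - (s + n))| := by
    have hpos := hs true (m - n)
    have hneg := hs false (-m - n)
    norm_num at hpos hneg
    rcases abs_cases z.re with ⟨h, _⟩ | ⟨h, _⟩
    · rw [h]
      convert hpos using 2
      simp [hz]; ring
    · rw [h]
      convert hneg using 2
      simp [hz]; ring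
  have hle : |z.re| ≤ ‖z‖ := Complex.abs_re_le_norm z
  rcases le_or_gt ‖z‖ ((s + n) / 2) with hsmall | hlarge
  · rw [abs_sub_comm]
    refine le_trans ?_ (le_abs_self _)
    linarith [sq_nonneg α.im]
  · have hdiff : ‖z‖ ≤ |z.re| + 1 / 12 := by
      refine norm_le_abs_re_add (by norm_num) ?_
      have : z.im = α.im := by simp [hz]
      rw [this]
      linarith
    have := abs_sub_abs_le_abs_sub (|z.re| - (s + n)) (‖z‖ - (s + n))
    have : |(|z.re| - (s + n) - (‖z‖ - (s + n)))| ≤ 1 / 12 := by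
      rw [abs_le]; constructor <;> linarith
    linarith

theorem exists_norm_pow_gap (α : ℂ) (N : ℕ) (t₀ : ℝ) :
    ∃ t : ℝ, t₀ ≤ t ∧
      (∀ m : ℤ, ‖(m : ℂ) + α‖ < t →
        ‖((m : ℂ) + α) ^ (N + 1)‖ + t ^ N / 12 ≤ t ^ (N + 1)) ∧
      ∀ m : ℤ, t ≤ ‖(m : ℂ) + α‖ → t ^ (N + 1) + t ^ N / 12 ≤ ‖((m : ℂ) + α) ^ (N + 1)‖ := by
  obtain ⟨t, ht, hgap⟩ := exists_radius_gap α (max t₀ 1)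
  obtain ⟨ht₀, ht1⟩ := max_le_iff.1 ht
  refine ⟨t, ht₀, fun m hm => ?_, fun m hm => ?_⟩
  · have hgap_m : ‖(m : ℂ) + α‖ ≤ t - 1 / 12 := by
      linarith [hgap m, abs_of_neg (sub_neg.2 hm)]
    calc ‖((m : ℂ) + α) ^ (N + 1)‖ + t ^ N / 12
        ≤ (t - 1 / 12) * t ^ N + t ^ N / 12 := by
          rw [norm_pow, pow_succ']
          gcongr
          linarith
      _ = t ^ (N + 1) := by ring
  · have hgap_m : t + 1 / 12 ≤ ‖(m : ℂ) + α‖ := by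
      linarith [hgap m, abs_of_nonneg (sub_nonneg.2 hm)]
    calc t ^ (N + 1) + t ^ N / 12 = (t + 1 / 12) * t ^ N := by ring
      _ ≤ ‖(m : ℂ) + α‖ * ‖(m : ℂ) + α‖ ^ N := by gcongr
      _ = ‖((m : ℂ) + α) ^ (N + 1)‖ := by rw [norm_pow, ← pow_succ']

end Separation

section Counting

theorem exists_injective_of_card_fiber_le {E ι Y : Type*} (f : E → Y) (g : ι → Y)
    (hg : ∀ y, (g ⁻¹' {y}).Finite)
    (hfg : ∀ (y : Y) (s : Finset E), (∀ x ∈ s, f x = y) → s.card ≤ (g ⁻¹' {y}).ncard) :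
    ∃ e : E → ι, Function.Injective e ∧ ∀ x, g (e x) = f x := by
  classical
  have hall (s : Finset E) : s.card ≤ (s.biUnion fun x => (hg (f x)).toFinset).card := by
    have hdisj : ((s.image f : Finset Y) : Set Y).PairwiseDisjoint fun y => (hg y).toFinset :=
      fun y _ y' _ hyy' => Finset.disjoint_left.2 fun i hi hi' => hyy' <| by
        simp only [Set.Finite.mem_toFinset, Set.mem_preimage, Set.mem_singleton_iff] at hi hi'
        exact hi.symm.trans hi'
    rw [← Finset.image_biUnion (t := fun y => (hg y).toFinset), Finset.card_biUnion hdisj,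
      Finset.card_eq_sum_card_image f s]
    refine Finset.sum_le_sum fun y _ => ?_
    rw [← Set.ncard_eq_toFinset_card _ (hg y)]
    exact hfg y _ fun x hx => (Finset.mem_filter.1 hx).2
  obtain ⟨e, he, hmem⟩ := (Finset.all_card_le_biUnion_card_iff_exists_injective _).1 hall
  exact ⟨e, he, fun x => by simpa using hmem x⟩

section Eigenvalues

variable {𝕜 V W : Type*} [Field 𝕜] [AddCommGroup V] [Module 𝕜 V] [AddCommGroup W] [Module 𝕜 W]
  {A : Module.End 𝕜 V}

theorem aeval_prod_X_sub_C_eq_zero_of_mem {l : 𝕜} {s : Multiset 𝕜} (hl : l ∈ s) {u : V}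
    (hu : A u = l • u) : aeval A ((s.map fun z => X - C z).prod) u = 0 := by
  obtain ⟨t, rfl⟩ := Multiset.exists_cons_of_mem hl
  rw [Multiset.map_cons, Multiset.prod_cons, mul_comm, map_mul, Module.End.mul_apply]
  simp [hu, Module.algebraMap_end_apply]

theorem card_le_finrank_of_hasEigenvalue [FiniteDimensional 𝕜 W] (F : V →ₗ[𝕜] W) {s : Finset 𝕜}
    (hs : ∀ l ∈ s, A.HasEigenvalue l)
    (hF : ∀ u, aeval A ((s.val.map fun z => X - C z).prod) u = 0 → F u = 0 → u = 0) :
    s.card ≤ Module.finrank 𝕜 W := by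
  choose v hv using fun l : s => (hs l l.2).exists_hasEigenvector
  have hli : LinearIndependent 𝕜 v :=
    Module.End.eigenvectors_linearIndependent' A _ Subtype.val_injective v hv
  have hinj : Function.Injective (F ∘ₗ Fintype.linearCombination 𝕜 v) := by
    refine (injective_iff_map_eq_zero _).2 fun a ha => ?_
    have h0 : Fintype.linearCombination 𝕜 v a = 0 := by
      refine hF _ ?_ ha
      rw [Fintype.linearCombination_apply, map_sum]
      refine Finset.sum_eq_zero fun l _ => ?_
      rw [map_smul, aeval_prod_X_sub_C_eq_zero_of_mem l.2 (hv l).apply_eq_smul, smul_zero]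
    exact funext (Fintype.linearIndependent_iff.1 hli a h0)
  simpa using LinearMap.finrank_le_finrank_of_injective hinj

end Eigenvalues

theorem mul_one_add_pow_le {K b t : ℝ} (hK : 0 ≤ K) (hb : 0 ≤ b) (hbt : b ≤ t) (ht : 1 ≤ t)
    (k : ℕ) : K * (1 + b) ^ k ≤ K * 2 ^ k * t ^ k := by
  rw [mul_assoc, ← mul_pow]
  exact mul_le_mul_of_nonneg_left (pow_le_pow_left₀ (by positivity) (by linarith) k) hK

theorem norm_eq_norm_of_pow_eq_pow {R : Type*} [NormedDivisionRing R] {a b : R} {N : ℕ}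
    (hN : N ≠ 0) (h : a ^ N = b ^ N) : ‖a‖ = ‖b‖ :=
  (pow_left_inj₀ (norm_nonneg a) (norm_nonneg b) hN).1 (by rw [← norm_pow, h, norm_pow])

theorem finite_intCast_add_pow_eq (α v : ℂ) {N : ℕ} (hN : N ≠ 0) :
    {m : ℤ | ((m : ℂ) + α) ^ N = v}.Finite := by
  rcases Set.eq_empty_or_nonempty {m : ℤ | ((m : ℂ) + α) ^ N = v} with h | ⟨n, hn⟩
  · simp [h]
  · exact (finite_norm_intCast_add_le α ‖(n : ℂ) + α‖).subset fun m hm =>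
      (norm_eq_norm_of_pow_eq_pow hN (hm.out.trans hn.out.symm)).le

theorem exists_ncard_intCast_add_pow_eq_le_two (α : ℂ) {N : ℕ} (hN : 0 < N) :
    ∃ R : ℝ, ∀ n : ℤ, R ≤ ‖(n : ℂ) + α‖ →
      {m : ℤ | ((m : ℂ) + α) ^ N = ((n : ℂ) + α) ^ N}.ncard ≤ 2 := by
  obtain ⟨γ, r, hγ, hr, hsep⟩ := exists_intCast_add_pow_separated α hN
  refine ⟨r, fun n hn => ?_⟩
  have hcase {m : ℤ} (hm : ((m : ℂ) + α) ^ N = ((n : ℂ) + α) ^ N) :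
      m = n ∨ (m : ℂ) + n + 2 * α = 0 := by
    refine (hsep m n hn).elim And.right fun hle => absurd hle (not_le.2 ?_)
    have : 0 < max ‖(m : ℂ) + α‖ ‖(n : ℂ) + α‖ := lt_max_of_lt_right (by linarith)
    rw [hm, sub_self, norm_zero]
    positivity
  by_cases hex : ∃ m₀ : ℤ, (m₀ : ℂ) + n + 2 * α = 0
  · obtain ⟨m₀, hm₀⟩ := hex
    refine (Set.ncard_le_ncard (t := {n, m₀}) fun m hm => ?_).trans
      ((Set.ncard_insert_le n {m₀}).trans (by simp))
    refine (hcase hm).imp_right fun hm => ?_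
    have : (m : ℂ) = m₀ := by linear_combination hm - hm₀
    exact_mod_cast this
  · refine (Set.ncard_le_ncard (t := {n}) fun m hm => ?_).trans (by simp)
    exact (hcase hm).resolve_right fun hm => hex ⟨m, hm⟩

/-- In the coordinates `c : V → ℓ^p(ℤ)`, the operator `A` is a perturbation of the diagonal
operator with entries `(n + α) ^ (k + 2)`, the error being of order `k` in `n`, that is, two orders
lower. -/
structure IsPowerPerturbation {V : Type*} [AddCommGroup V] [Module ℂ V] (A : Module.End ℂ V)
    (c : V →ₗ[ℂ] ℤ → ℂ) (α : ℂ) (k : ℕ) (K : ℝ) (p : ℝ≥0∞) : Prop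
    extends IsMulPerturbation A c (fun n => ((n : ℂ) + α) ^ (k + 2))
      (fun n => ((K * (1 + ‖(n : ℂ) + α‖) ^ k : ℝ) : ℂ)) p Measure.count where
  one_le : 1 ≤ p
  pos : 0 < K
  injective : Function.Injective c

/-- The label of the block of `n`: the coordinates with `‖n + α‖ < t` form one block, and the
others are grouped by the value of `(n + α) ^ N`. -/
noncomputable def blockLabel (α : ℂ) (N : ℕ) (t : ℝ) (n : ℤ) : Option ℂ :=
  if ‖(n : ℂ) + α‖ < t then none else some (((n : ℂ) + α) ^ N)

/-- The coordinates in the same block as `n`. -/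
def block (α : ℂ) (N : ℕ) (t : ℝ) (n : ℤ) : Set ℤ :=
  {m | blockLabel α N t m = blockLabel α N t n}

/-- The disc containing the eigenvalues which belong to the block of `n`. -/
noncomputable def spectralDisc (α : ℂ) (k : ℕ) (K t : ℝ) (n : ℤ) : Set ℂ :=
  if ‖(n : ℂ) + α‖ < t then Metric.closedBall 0 (t ^ (k + 2))
  else Metric.closedBall (((n : ℂ) + α) ^ (k + 2)) (4 * (K * (1 + ‖(n : ℂ) + α‖) ^ k))

section Blocks

variable {α : ℂ} {N k : ℕ} {K t : ℝ} {m n : ℤ}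

theorem mem_block_of_norm_lt (hn : ‖(n : ℂ) + α‖ < t) :
    m ∈ block α N t n ↔ ‖(m : ℂ) + α‖ < t := by
  simp [block, blockLabel, hn]

theorem mem_block_of_le_norm (hN : N ≠ 0) (hn : t ≤ ‖(n : ℂ) + α‖) :
    m ∈ block α N t n ↔ ((m : ℂ) + α) ^ N = ((n : ℂ) + α) ^ N := by
  simpa [block, blockLabel, hn.not_gt] using
    fun h => hn.trans_eq (norm_eq_norm_of_pow_eq_pow hN h).symm

theorem finite_blockLabel_preimage (hN : N ≠ 0) (y : Option ℂ) :
    (blockLabel α N t ⁻¹' {y}).Finite := by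
  rcases Set.eq_empty_or_nonempty (blockLabel α N t ⁻¹' {y}) with h | ⟨n, rfl⟩
  · simp [h]
  · change (block α N t n).Finite
    rcases lt_or_ge ‖(n : ℂ) + α‖ t with hn | hn
    · exact (finite_norm_intCast_add_le α t).subset fun m hm => ((mem_block_of_norm_lt hn).1 hm).le
    · exact (finite_intCast_add_pow_eq α _ hN).subset fun m hm => (mem_block_of_le_norm hN hn).1 hm

theorem finite_block (hN : N ≠ 0) : (block α N t n).Finite :=
  finite_blockLabel_preimage hN _

theorem spectralDisc_eq_of_mem_block (h : m ∈ block α (k + 2) t n) :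
    spectralDisc α k K t m = spectralDisc α k K t n := by
  unfold spectralDisc
  rcases lt_or_ge ‖(n : ℂ) + α‖ t with hn | hn
  · rw [if_pos hn, if_pos ((mem_block_of_norm_lt hn).1 h)]
  · have hpow := (mem_block_of_le_norm (by lia) hn).1 h
    have hnorm := norm_eq_norm_of_pow_eq_pow (by lia) hpow
    rw [hnorm, hpow]

end Blocks

namespace IsPowerPerturbation

variable {V : Type*} [AddCommGroup V] [Module ℂ V] {A : Module.End ℂ V} {c : V →ₗ[ℂ] ℤ → ℂ}
  {α : ℂ} {k : ℕ} {K : ℝ} {p : ℝ≥0∞}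

theorem eq_zero (h : IsPowerPerturbation A c α k K p) (l : ℂ) {I : Set ℤ} {r s η ε : ℝ}
    (hr : 0 ≤ r) (hs : 0 ≤ s) (hη : 0 ≤ η) (hε : 0 ≤ ε)
    (hin : ∀ n ∈ I, ‖((n : ℂ) + α) ^ (k + 2) - l‖ ≤ r ∧ K * (1 + ‖(n : ℂ) + α‖) ^ k ≤ η)
    (hout : ∀ n ∉ I, s ≤ ‖((n : ℂ) + α) ^ (k + 2) - l‖ ∧
      K * (1 + ‖(n : ℂ) + α‖) ^ k ≤ ε * ‖((n : ℂ) + α) ^ (k + 2) - l‖)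
    (hgap : r < (1 - 2 * ε) * s - 2 * η) {S : Multiset ℂ} (hS : ∀ z ∈ S, ‖z - l‖ ≤ r) {u : V}
    (hu : aeval A ((S.map fun z => X - C z).prod) u = 0) (huI : ∀ n ∈ I, c u n = 0) : u = 0 := by
  have hq (n : ℤ) :
      ‖((K * (1 + ‖(n : ℂ) + α‖) ^ k : ℝ) : ℂ)‖ = K * (1 + ‖(n : ℂ) + α‖) ^ k := by
    have := h.pos
    rw [Complex.norm_real, Real.norm_of_nonneg (by positivity)]
  have hinj (u : V) (hu : ∀ᵐ n ∂Measure.count, c u n = 0) : u = 0 :=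
    h.injective (by ext n; simpa using Measure.ae_count_iff.1 hu n)
  refine h.eq_zero_of_aeval_eq_zero h.one_le hinj l .of_discrete hr hs hη hε (fun n hn => ?_)
    (fun n hn => ?_) hgap hS hu huI <;> rw [hq]
  exacts [hin n hn, hout n hn]

theorem exists_norm_sub_le_of_hasEigenvalue (h : IsPowerPerturbation A c α k K p) {l : ℂ}
    (hl : A.HasEigenvalue l) :
    ∃ n : ℤ, ‖l - ((n : ℂ) + α) ^ (k + 2)‖ ≤ 4 * (K * (1 + ‖(n : ℂ) + α‖) ^ k) := by
  by_contra! hcon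
  have hK := h.pos
  obtain ⟨u, hu⟩ := hl.exists_hasEigenvector
  refine hu.2 (h.eq_zero l (I := ∅) (r := 0) (s := 4 * K) (η := 0) (ε := 1 / 4) le_rfl
    (by linarith) le_rfl (by norm_num) (by simp) (fun n _ => ?_) (by linarith) (S := {l}) (by simp)
    (aeval_prod_X_sub_C_eq_zero_of_mem (Multiset.mem_singleton_self l) hu.apply_eq_smul) (by simp))
  have hn := hcon n
  rw [norm_sub_rev] at hn
  have hle : K ≤ K * (1 + ‖(n : ℂ) + α‖) ^ k :=
    le_mul_of_one_le_right hK.le (one_le_pow₀ (by linarith [norm_nonneg ((n : ℂ) + α)]))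
  constructor <;> linarith

theorem exists_eq_zero_near_entry (h : IsPowerPerturbation A c α k K p) :
    ∃ R : ℝ, ∀ n : ℤ, R ≤ ‖(n : ℂ) + α‖ → ∀ S : Multiset ℂ,
      (∀ z ∈ S, ‖z - ((n : ℂ) + α) ^ (k + 2)‖ ≤ 4 * (K * (1 + ‖(n : ℂ) + α‖) ^ k)) →
        ∀ u, aeval A ((S.map fun z => X - C z).prod) u = 0 →
          (∀ m : ℤ, ((m : ℂ) + α) ^ (k + 2) = ((n : ℂ) + α) ^ (k + 2) → c u m = 0) → u = 0 := by
  obtain ⟨γ, r, hγ, hr1, hsep⟩ := exists_intCast_add_pow_separated α (N := k + 2) (by lia)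
  have hK := h.pos
  set L := K * 2 ^ k
  refine ⟨max r (12 * L / γ + 1), fun n hn => ?_⟩
  set b := ‖(n : ℂ) + α‖ with hb
  have hrb : r ≤ b := (le_max_left _ _).trans hn
  have hLb : 12 * L < γ * b := by
    rw [← div_lt_iff₀' hγ]
    linarith [(le_max_right _ _).trans hn]
  have error_lt {x y : ℝ} (hx : 0 ≤ x) (hxy : x ≤ y) (hy : b ≤ y) :
      12 * (K * (1 + x) ^ k) < γ * y ^ (k + 1) :=
    calc 12 * (K * (1 + x) ^ k) ≤ 12 * L * y ^ k := by
          linarith [mul_one_add_pow_le hK.le hx hxy (by linarith : 1 ≤ y) k]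
      _ < γ * y * y ^ k := by
          have hy0 : 0 < y := by linarith
          exact mul_lt_mul_of_pos_right (hLb.trans_le (by gcongr)) (by positivity)
      _ = γ * y ^ (k + 1) := by ring
  have hgap := error_lt (norm_nonneg _) hb.ge le_rfl
  refine fun S hS u hu huI => h.eq_zero (((n : ℂ) + α) ^ (k + 2))
    (I := {m : ℤ | ((m : ℂ) + α) ^ (k + 2) = ((n : ℂ) + α) ^ (k + 2)})
    (r := 4 * (K * (1 + b) ^ k)) (s := γ * b ^ (k + 1)) (η := K * (1 + b) ^ k) (ε := 1 / 4)
    (by positivity) (by positivity) (by positivity) (by norm_num) (fun m hm => ?_) (fun m hm => ?_)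
    (by linarith) hS hu huI
  · rw [hm.out, sub_self, norm_zero, norm_eq_norm_of_pow_eq_pow (by lia) hm.out]
    exact ⟨by positivity, le_rfl⟩
  · set M := max ‖(m : ℂ) + α‖ b with hM_def
    have hM : γ * M ^ (k + 1) ≤ ‖((m : ℂ) + α) ^ (k + 2) - ((n : ℂ) + α) ^ (k + 2)‖ :=
      (hsep m n hrb).resolve_left fun h => hm h.1
    have hbM : γ * b ^ (k + 1) ≤ γ * M ^ (k + 1) := by gcongr; exact le_max_right _ _
    have hmM := error_lt (norm_nonneg _) (le_max_left ‖(m : ℂ) + α‖ b) (le_max_right _ _)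
    rw [← hM_def] at hmM
    have herror : 0 ≤ K * (1 + ‖(m : ℂ) + α‖) ^ k := by positivity
    exact ⟨hbM.trans hM, by linarith⟩

theorem exists_eq_zero_low (h : IsPowerPerturbation A c α k K p) (t₀ : ℝ) :
    ∃ t : ℝ, t₀ ≤ t ∧
      (∀ m : ℤ, ‖(m : ℂ) + α‖ < t →
        ‖((m : ℂ) + α) ^ (k + 2)‖ + 4 * (K * (1 + ‖(m : ℂ) + α‖) ^ k) ≤ t ^ (k + 2)) ∧
      ∀ S : Multiset ℂ, (∀ z ∈ S, ‖z‖ ≤ t ^ (k + 2)) →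
        ∀ u, aeval A ((S.map fun z => X - C z).prod) u = 0 →
          (∀ m : ℤ, ‖(m : ℂ) + α‖ < t → c u m = 0) → u = 0 := by
  have hK := h.pos
  set L := K * 2 ^ k
  have hL0 : 0 < L := by positivity
  obtain ⟨t, ht, below, above⟩ := exists_norm_pow_gap α (k + 1) (max t₀ (60 * L + 1))
  obtain ⟨ht₀, htL⟩ := max_le_iff.1 ht
  have ht1 : 1 ≤ t := by linarith
  have htk : 60 * L * t ^ k < t ^ (k + 1) := by
    rw [pow_succ']
    gcongr
    linarith
  have hLtk : 0 ≤ L * t ^ k := by positivity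
  have error_le {b s : ℝ} := mul_one_add_pow_le (b := b) (t := s) hK.le (k := k)
  refine ⟨t, ht₀, fun m hm => ?_, fun S hS u hu huI => ?_⟩
  · linarith [below m hm, error_le (norm_nonneg _) hm.le ht1]
  refine h.eq_zero 0 (I := {m : ℤ | ‖(m : ℂ) + α‖ < t}) (r := t ^ (k + 2))
    (s := t ^ (k + 2) + t ^ (k + 1) / 12) (η := L * t ^ k) (ε := L / t ^ 2) (by positivity)
    (by positivity) hLtk (by positivity) (fun m hm => ?_) (fun m hm => ?_) ?_
    (by simpa using hS) hu huI
  · rw [sub_zero]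
    exact ⟨by linarith [below m hm, hLtk], error_le (norm_nonneg _) hm.out.le ht1⟩
  · have hm : t ≤ ‖(m : ℂ) + α‖ := not_lt.1 hm
    rw [sub_zero]
    refine ⟨above m hm, (error_le (norm_nonneg _) le_rfl (ht1.trans hm)).trans ?_⟩
    rw [norm_pow, div_mul_eq_mul_div, le_div_iff₀ (by positivity), mul_assoc, pow_add]
    gcongr
  · have hεs : L / t ^ 2 * (t ^ (k + 2) + t ^ (k + 1) / 12) = L * t ^ k * (1 + 1 / (12 * t)) := by
      field_simp
      ring
    have : 1 / (12 * t) ≤ 1 / 12 := by gcongr; linarith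
    nlinarith

theorem exists_blocks (h : IsPowerPerturbation A c α k K p) :
    ∃ t : ℝ, (∀ l, A.HasEigenvalue l → ∃ n : ℤ, l ∈ spectralDisc α k K t n) ∧
      (∀ n : ℤ, t ≤ ‖(n : ℂ) + α‖ → (block α (k + 2) t n).ncard ≤ 2) ∧
      ∀ (n : ℤ) (S : Multiset ℂ), (∀ z ∈ S, z ∈ spectralDisc α k K t n) →
        ∀ u, aeval A ((S.map fun z => X - C z).prod) u = 0 →
          (∀ m ∈ block α (k + 2) t n, c u m = 0) → u = 0 := by
  obtain ⟨R₁, hcard⟩ := exists_ncard_intCast_add_pow_eq_le_two α (N := k + 2) (by lia)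
  obtain ⟨R₂, hnear⟩ := h.exists_eq_zero_near_entry
  obtain ⟨t, ht, hlow, hzero⟩ := h.exists_eq_zero_low (max R₁ R₂)
  obtain ⟨ht₁, ht₂⟩ := max_le_iff.1 ht
  have mem_block {m n : ℤ} (hn : t ≤ ‖(n : ℂ) + α‖) :=
    mem_block_of_le_norm (N := k + 2) (m := m) (by lia) hn
  refine ⟨t, fun l hl => ?_, fun n hn => ?_, fun n S hS u hu huI => ?_⟩
  · obtain ⟨n, hn⟩ := h.exists_norm_sub_le_of_hasEigenvalue hl
    refine ⟨n, ?_⟩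
    unfold spectralDisc
    split_ifs with hnt
    · rw [mem_closedBall_zero_iff]
      linarith [hlow n hnt, norm_le_norm_sub_add l (((n : ℂ) + α) ^ (k + 2))]
    · rwa [mem_closedBall_iff_norm]
  · convert hcard n (ht₁.trans hn) using 2
    exact Set.ext fun m => mem_block hn
  · unfold spectralDisc at hS
    split_ifs at hS with hnt
    · exact hzero S (by simpa using hS) u hu fun m hm => huI m ((mem_block_of_norm_lt hnt).2 hm)
    · rw [not_lt] at hnt
      exact hnear n (ht₂.trans hnt) S (fun z hz => mem_closedBall_iff_norm.1 (hS z hz)) u hu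
        fun m hm => huI m ((mem_block hnt).2 hm)

theorem exists_enumeration (h : IsPowerPerturbation A c α k K p) :
    ∃ μ : ℤ → ℂ, (∀ l, A.HasEigenvalue l → ∃ n, l = μ n) ∧
      ∀ᶠ n in cofinite, ‖μ n - ((n : ℂ) + α) ^ (k + 2)‖ ≤ 4 * (K * (1 + ‖(n : ℂ) + α‖) ^ k) := by
  obtain ⟨t, hdisc, -, hblock⟩ := h.exists_blocks
  choose ν hν using fun l : {l // A.HasEigenvalue l} => hdisc l l.2
  have hfiber (y : Option ℂ) (s : Finset {l // A.HasEigenvalue l})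
      (hs : ∀ l ∈ s, blockLabel α (k + 2) t (ν l) = y) :
      s.card ≤ (blockLabel α (k + 2) t ⁻¹' {y}).ncard := by
    rcases s.eq_empty_or_nonempty with rfl | ⟨l₀, hl₀⟩
    · simp
    obtain rfl := hs l₀ hl₀
    change s.card ≤ (block α (k + 2) t (ν l₀)).ncard
    have := (finite_block (α := α) (t := t) (n := ν l₀) (N := k + 2) (by lia)).fintype
    rw [← Finset.card_map (Function.Embedding.subtype _), ← Nat.card_coe_set_eq,
      Nat.card_eq_fintype_card, ← Module.finrank_fintype_fun_eq_card ℂ]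
    refine card_le_finrank_of_hasEigenvalue (A := A)
      (LinearMap.funLeft ℂ ℂ (Subtype.val : block α (k + 2) t (ν l₀) → ℤ) ∘ₗ c) (fun l hl => ?_)
      fun u hu hcu => hblock (ν l₀) _ (fun z hz => ?_) u hu fun m hm => congrFun hcu ⟨m, hm⟩
    · exact Finset.property_of_mem_map_subtype s hl
    · obtain ⟨l, hl, rfl⟩ := Finset.mem_map.1 hz
      exact spectralDisc_eq_of_mem_block (hs l hl) ▸ hν l
  obtain ⟨e, he, hlabel⟩ := exists_injective_of_card_fiber_le _ _
    (finite_blockLabel_preimage (by lia)) hfiber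
  have he_disc (l : {l // A.HasEigenvalue l}) : (l : ℂ) ∈ spectralDisc α k K t (e l) :=
    (spectralDisc_eq_of_mem_block (hlabel l)).symm ▸ hν l
  refine ⟨Function.extend e Subtype.val fun n => ((n : ℂ) + α) ^ (k + 2),
    fun l hl => ⟨e ⟨l, hl⟩, by rw [he.extend_apply]⟩, ?_⟩
  filter_upwards [(tendsto_norm_intCast_add_cofinite α).eventually_ge_atTop t] with n hn
  by_cases hex : ∃ l, e l = n
  · obtain ⟨l, rfl⟩ := hex
    rw [he.extend_apply]
    simpa [spectralDisc, hn.not_gt, dist_eq_norm] using he_disc l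
  · have := h.pos
    rw [Function.extend_apply' _ _ _ hex, sub_self, norm_zero]
    positivity

theorem exists_rank_maxGenEigenspace_le_two (h : IsPowerPerturbation A c α k K p) :
    ∃ R : ℝ, ∀ l, A.HasEigenvalue l → R < ‖l‖ → Module.rank ℂ (A.maxGenEigenspace l) ≤ 2 := by
  obtain ⟨t, hdisc, hcard, hblock⟩ := h.exists_blocks
  refine ⟨t ^ (k + 2), fun l hl hlt => ?_⟩
  obtain ⟨n, hn⟩ := hdisc l hl
  have hnt : t ≤ ‖(n : ℂ) + α‖ := by
    by_contra! hnt
    simp [spectralDisc, hnt, hlt.not_ge] at hn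
  have := (finite_block (α := α) (t := t) (n := n) (N := k + 2) (by lia)).fintype
  let F := LinearMap.funLeft ℂ ℂ (Subtype.val : block α (k + 2) t n → ℤ) ∘ₗ c ∘ₗ
    (A.maxGenEigenspace l).subtype
  have hF : Function.Injective F := by
    refine (injective_iff_map_eq_zero F).2 fun ⟨u, hu⟩ hcu => Subtype.ext ?_
    obtain ⟨j, hj⟩ := Module.End.mem_maxGenEigenspace A l u |>.1 hu
    refine hblock n (Multiset.replicate j l) (fun z hz => ?_) u ?_
      fun m hm => congrFun hcu ⟨m, hm⟩
    · rwa [Multiset.eq_of_mem_replicate hz]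
    · rw [Multiset.map_replicate, Multiset.prod_replicate, map_pow]
      simpa [Module.End.one_eq_id, Algebra.algebraMap_eq_smul_one] using hj
  have hrank := LinearMap.lift_rank_le_of_injective F hF
  rw [rank_fun', ← Nat.card_eq_fintype_card, Nat.card_coe_set_eq, Cardinal.lift_natCast,
    Cardinal.lift_le_nat_iff] at hrank
  exact hrank.trans (by exact_mod_cast hcard n hnt)

end IsPowerPerturbation

end Counting

section Order

variable {𝕜 R : Type*} [CommRing 𝕜] [CommRing R] [Algebra 𝕜 R]

/-- `T` is a differential operator of order less than `n` in the derivation `δ`. -/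
def IsOrderLT (δ : Derivation 𝕜 R R) (n : ℕ) (T : R → R) : Prop :=
  ∃ b : ℕ → R, ∀ u, T u = ∑ j ∈ Finset.range n, b j * δ^[j] u

namespace IsOrderLT

variable {δ : Derivation 𝕜 R R} {n m : ℕ} {T T' : R → R}

theorem add (h : IsOrderLT δ n T) (h' : IsOrderLT δ n T') :
    IsOrderLT δ n fun u => T u + T' u := by
  obtain ⟨b, hb⟩ := h
  obtain ⟨b', hb'⟩ := h'
  exact ⟨fun j => b j + b' j, fun u => by simp [hb, hb', add_mul, Finset.sum_add_distrib]⟩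

theorem mul_left (h : IsOrderLT δ n T) (g : R) : IsOrderLT δ n fun u => g * T u := by
  obtain ⟨b, hb⟩ := h
  exact ⟨fun j => g * b j, fun u => by simp [hb, Finset.mul_sum, mul_assoc]⟩

theorem single (δ : Derivation 𝕜 R R) (g : R) (hmn : m < n) :
    IsOrderLT δ n fun u => g * δ^[m] u :=
  ⟨fun j => if j = m then g else 0, fun u => by
    simp [ite_mul, Finset.sum_ite_eq', hmn]⟩

theorem mono (h : IsOrderLT δ n T) (hnm : n ≤ m) : IsOrderLT δ m T := by
  obtain ⟨b, hb⟩ := h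
  refine ⟨fun j => if j < n then b j else 0, fun u => ?_⟩
  rw [hb, ← Finset.sum_subset (Finset.range_mono hnm)]
  · exact Finset.sum_congr rfl fun j hj => by simp [Finset.mem_range.1 hj]
  · intro j _ hj
    have hj' : ¬ j < n := fun h => hj (Finset.mem_range.2 h)
    simp [hj']

theorem sum {ι : Type*} {s : Finset ι} {F : ι → R → R} (h : ∀ i ∈ s, IsOrderLT δ n (F i)) :
    IsOrderLT δ n fun u => ∑ i ∈ s, F i u := by
  classical
  induction s using Finset.induction_on with
  | empty => exact ⟨0, fun u => by simp⟩
  | insert i s hi ih =>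
    have := (h i (Finset.mem_insert_self i s)).add
      (ih fun j hj => h j (Finset.mem_insert_of_mem hj))
    simpa [Finset.sum_insert hi] using this

theorem deriv (h : IsOrderLT δ n T) : IsOrderLT δ (n + 1) fun u => δ (T u) := by
  obtain ⟨b, hb⟩ := h
  have e : (fun u => δ (T u)) = fun u => ∑ j ∈ Finset.range n,
      (δ (b j) * δ^[j] u + b j * δ^[j + 1] u) := by
    funext u
    rw [hb, map_sum]
    refine Finset.sum_congr rfl fun j _ => ?_
    rw [Derivation.leibniz, Function.iterate_succ_apply', smul_eq_mul, smul_eq_mul]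
    ring
  rw [e]
  refine sum fun j hj => ?_
  have hj' := Finset.mem_range.1 hj
  exact (single δ _ (by omega)).add (single δ _ (by omega))

end IsOrderLT

theorem exists_iterate_mul_deriv (δ : Derivation 𝕜 R R) (g : R) (n : ℕ) :
    ∃ T, IsOrderLT δ n T ∧ ∀ u, (fun v => g * δ v)^[n] u = g ^ n * δ^[n] u + T u := by
  induction n with
  | zero => exact ⟨fun _ => 0, ⟨0, fun u => by simp⟩, fun u => by simp⟩
  | succ n ih =>
    obtain ⟨T, hT, h⟩ := ih
    refine ⟨fun u => g * δ (g ^ n) * δ^[n] u + g * δ (T u),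
      (IsOrderLT.single δ _ (by omega)).add (hT.deriv.mul_left g), fun u => ?_⟩
    rw [Function.iterate_succ_apply', h, Function.iterate_succ_apply' δ, map_add,
      Derivation.leibniz, smul_eq_mul, smul_eq_mul]
    ring

theorem exists_iterate_add (δ : Derivation 𝕜 R R) (h : R) (n : ℕ) :
    ∃ T, IsOrderLT δ n T ∧ ∀ u, (fun v => δ v + h * v)^[n] u = δ^[n] u + T u := by
  induction n with
  | zero => exact ⟨fun _ => 0, ⟨0, fun u => by simp⟩, fun u => by simp⟩
  | succ n ih =>
    obtain ⟨T, hT, e⟩ := ih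
    refine ⟨fun u => h * δ^[n] u + (δ (T u) + h * T u), (IsOrderLT.single δ _ (by omega)).add
      (hT.deriv.add ((hT.mul_left h).mono (by omega))), fun u => ?_⟩
    rw [Function.iterate_succ_apply', e, Function.iterate_succ_apply' δ, map_add]
    ring

theorem exists_iterate_add_succ (δ : Derivation 𝕜 R R) (h : R) (n : ℕ) :
    ∃ T, IsOrderLT δ n T ∧ ∀ u, (fun v => δ v + h * v)^[n + 1] u =
      δ^[n + 1] u + (n + 1 : ℕ) * h * δ^[n] u + T u := by
  induction n with
  | zero => exact ⟨fun _ => 0, ⟨0, fun u => by simp⟩, fun u => by simp⟩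
  | succ n ih =>
    obtain ⟨T, hT, e⟩ := ih
    refine ⟨fun u => (δ ((n + 1 : ℕ) * h) + (n + 1 : ℕ) * h * h) * δ^[n] u + (δ (T u) + h * T u),
      (IsOrderLT.single δ _ (by omega)).add
      (hT.deriv.add ((hT.mul_left h).mono (by omega))), fun u => ?_⟩
    rw [Function.iterate_succ_apply', e, Function.iterate_succ_apply' δ (n + 1), map_add, map_add,
      Derivation.leibniz (a := ((n + 1 : ℕ) : R) * h), smul_eq_mul, smul_eq_mul,
      Function.iterate_succ_apply' δ n]
    push_cast
    ring

theorem iterate_mul_unit {δ : Derivation 𝕜 R R} {E h : R} (hE : δ E = E * h) (n : ℕ) (u : R) :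
    δ^[n] (E * u) = E * (fun v => δ v + h * v)^[n] u := by
  induction n generalizing u with
  | zero => rfl
  | succ n ih =>
    rw [Function.iterate_succ_apply, Function.iterate_succ_apply, ← ih]
    congr 1
    rw [Derivation.leibniz, hE, smul_eq_mul, smul_eq_mul]
    ring

theorem IsOrderLT.conj {δ : Derivation 𝕜 R R} {E E' h : R} (hEE : E' * E = 1) (hE : δ E = E * h)
    {n : ℕ} {T : R → R} (hT : IsOrderLT δ n T) : IsOrderLT δ n fun u => E' * T (E * u) := by
  obtain ⟨b, hb⟩ := hT
  have e : (fun u => E' * T (E * u)) =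
      fun u => ∑ j ∈ Finset.range n, b j * (fun v => δ v + h * v)^[j] u := by
    funext u
    rw [hb, Finset.mul_sum]
    refine Finset.sum_congr rfl fun j _ => ?_
    rw [iterate_mul_unit hE]
    linear_combination (b j * (fun v => δ v + h * v)^[j] u) * hEE
  rw [e]
  refine IsOrderLT.sum fun j hj => ?_
  have hj' := Finset.mem_range.1 hj
  obtain ⟨S, hS, hS'⟩ := exists_iterate_add δ h j
  have := ((IsOrderLT.single δ 1 hj').add (hS.mono hj'.le)).mul_left (b j)
  simpa [hS'] using this

theorem exists_sum_iterate_mul_deriv {𝕜 : Type*} [Field 𝕜] [Algebra 𝕜 R] (δ : Derivation 𝕜 R R)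
    (P : ℕ → R) (g : R) (n : ℕ) {C : 𝕜} (hC : C ≠ 0) (hlead : P n * g ^ n = algebraMap 𝕜 R C) :
    ∃ T, IsOrderLT δ n T ∧ ∀ u,
      ∑ j ∈ Finset.range (n + 1), P j * (fun v => g * δ v)^[j] u = C • (δ^[n] u + T u) := by
  have hlow : IsOrderLT δ n fun u => ∑ j ∈ Finset.range n, P j * (fun v => g * δ v)^[j] u := by
    refine IsOrderLT.sum fun j hj => ?_
    have hj' := Finset.mem_range.1 hj
    obtain ⟨S, hS, hS'⟩ := exists_iterate_mul_deriv δ g j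
    simpa only [hS'] using
      ((IsOrderLT.single δ (g ^ j) hj').add (hS.mono hj'.le)).mul_left (P j)
  obtain ⟨T, hT, e⟩ := exists_iterate_mul_deriv δ g n
  refine ⟨_, (hlow.add (hT.mul_left (P n))).mul_left (algebraMap 𝕜 R C⁻¹), fun u => ?_⟩
  rw [Finset.sum_range_succ, e, ← Algebra.smul_def, smul_add, smul_inv_smul₀ hC, Algebra.smul_def,
    ← hlead]
  ring

/- Conjugation with `E` replaces `δ` by `δ + h`, which changes the coefficient of `δ ^ n` by
`(n + 1) h`. -/
theorem exists_conj_iterate_add_sum {δ : Derivation 𝕜 R R} {E E' h a : R} (hEE : E' * E = 1)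
    (hE : δ E = E * h) {n : ℕ} {b : ℕ → R} (hb : (n + 1 : ℕ) * h + b n = (n + 1 : ℕ) * a) :
    ∃ T, IsOrderLT δ n T ∧ ∀ u,
      E' * (δ^[n + 1] (E * u) + ∑ j ∈ Finset.range (n + 1), b j * δ^[j] (E * u)) =
        (fun v => δ v + a * v)^[n + 1] u + T u := by
  obtain ⟨T₁, hT₁, e₁⟩ := exists_iterate_add_succ δ h n
  obtain ⟨T₂, hT₂, e₂⟩ := exists_iterate_add_succ δ a n
  obtain ⟨T₃, hT₃, e₃⟩ := exists_iterate_add δ h n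
  have hlow : IsOrderLT δ n fun u => ∑ j ∈ Finset.range n, b j * δ^[j] u := ⟨b, fun _ => rfl⟩
  refine ⟨_, ((hT₁.add (hT₂.mul_left (-1))).add (hT₃.mul_left (b n))).add (hlow.conj hEE hE),
    fun u => ?_⟩
  rw [Finset.sum_range_succ, iterate_mul_unit hE, iterate_mul_unit hE n, e₁, e₂, e₃]
  linear_combination (δ^[n + 1] u + (n + 1 : ℕ) * h * δ^[n] u + T₁ u + b n * (δ^[n] u + T₃ u)) *
    hEE + δ^[n] u * hb

theorem exists_normal_form {𝕜 : Type*} [Field 𝕜] [CharZero 𝕜] [Algebra 𝕜 R] (δ : Derivation 𝕜 R R)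
    (P : ℕ → R) (g : R) (n : ℕ) {C : 𝕜} (hC : C ≠ 0)
    (hlead : P (n + 1) * g ^ (n + 1) = algebraMap 𝕜 R C)
    (hgauge : ∀ a : R, ∃ (α : 𝕜) (E E' : R), E' * E = 1 ∧ δ E = E * (algebraMap 𝕜 R α - a)) :
    ∃ (α : 𝕜) (E E' : R) (b : ℕ → R), E' * E = 1 ∧ ∀ u,
      E' * ∑ j ∈ Finset.range (n + 2), P j * (fun v => g * δ v)^[j] (E * u) =
        C • ((fun v => δ v + α • v)^[n + 1] u + ∑ j ∈ Finset.range n, b j * δ^[j] u) := by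
  obtain ⟨T, ⟨b, hb⟩, e⟩ := exists_sum_iterate_mul_deriv δ P g (n + 1) hC hlead
  obtain ⟨α, E, E', hEE, hE⟩ := hgauge (algebraMap 𝕜 R ((n + 1 : ℕ) : 𝕜)⁻¹ * b n)
  have hcancel : ((n + 1 : ℕ) : R) * algebraMap 𝕜 R ((n + 1 : ℕ) : 𝕜)⁻¹ = 1 := by
    rw [← map_natCast (algebraMap 𝕜 R) (n + 1), ← map_mul,
      mul_inv_cancel₀ (Nat.cast_ne_zero.2 n.succ_ne_zero), map_one]
  obtain ⟨S, ⟨b', hb'⟩, e'⟩ := exists_conj_iterate_add_sum hEE hE (a := algebraMap 𝕜 R α) (b := b)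
    (n := n) (by linear_combination -b n * hcancel)
  refine ⟨α, E, E', b', hEE, fun u => ?_⟩
  rw [e, mul_smul_comm, hb, e', hb']
  simp only [Algebra.smul_def]

end Order

section Coordinates

variable {R : Type*} [CommRing R] [Algebra ℂ R]

/-- The operator `(δ + α) ^ (k + 2) + ∑_{j ≤ k} b_j δ ^ j`: a power of `δ + α` perturbed by terms
whose order is smaller by at least two. -/
noncomputable def perturbedPower (δ : Derivation ℂ R R) (α : ℂ) (k : ℕ) (b : ℕ → R) :
    Module.End ℂ R :=
  ((δ : R →ₗ[ℂ] R) + α • LinearMap.id) ^ (k + 2) +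
    ∑ j ∈ Finset.range (k + 1), LinearMap.mulLeft ℂ (b j) ∘ₗ ((δ : R →ₗ[ℂ] R) ^ j : Module.End ℂ R)

theorem perturbedPower_apply (δ : Derivation ℂ R R) (α : ℂ) (k : ℕ) (b : ℕ → R) (u : R) :
    perturbedPower δ α k b u =
      (fun v => δ v + α • v)^[k + 2] u + ∑ j ∈ Finset.range (k + 1), b j * δ^[j] u := by
  simp only [perturbedPower, LinearMap.add_apply, LinearMap.sum_apply, LinearMap.comp_apply,
    LinearMap.mulLeft_apply, Module.End.pow_apply]
  rfl

variable {δ : Derivation ℂ R R} {c : R →ₗ[ℂ] ℤ → ℂ} {p : ℝ≥0∞}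

theorem coord_iterate_add (hδ : ∀ u n, c (δ u) n = n * c u n) (α : ℂ) (j : ℕ) (u : R) (n : ℤ) :
    c ((fun v => δ v + α • v)^[j] u) n = ((n : ℂ) + α) ^ j * c u n := by
  induction j with
  | zero => simp
  | succ j ih =>
    rw [Function.iterate_succ_apply', map_add, map_smul, Pi.add_apply, Pi.smul_apply, hδ, ih,
      smul_eq_mul]
    ring

theorem coord_iterate (hδ : ∀ u n, c (δ u) n = n * c u n) (j : ℕ) (u : R) (n : ℤ) :
    c (δ^[j] u) n = (n : ℂ) ^ j * c u n := by
  simpa using coord_iterate_add hδ 0 j u n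

theorem memLp_one_add_norm_pow_mul (hδ : ∀ u n, c (δ u) n = n * c u n)
    (hc : ∀ u, MemLp (c u) p Measure.count) (α : ℂ) (m : ℕ) (u : R) :
    MemLp (fun n : ℤ => (((1 + ‖(n : ℂ) + α‖) ^ m : ℝ) : ℂ) * c u n) p Measure.count := by
  induction m generalizing u with
  | zero => simpa using hc u
  | succ m ih =>
    refine ((ih u).norm.add (ih (δ u + α • u)).norm).of_le .of_discrete (.of_forall fun n => ?_)
    have hcoord : c (δ u + α • u) n = ((n : ℂ) + α) * c u n := by
      simpa using coord_iterate_add hδ α 1 u n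
    simp only [Pi.add_apply, hcoord, norm_mul, Complex.norm_real, norm_pow, ← mul_assoc]
    rw [Real.norm_of_nonneg (by positivity : 0 ≤ 1 + ‖(n : ℂ) + α‖),
      Real.norm_of_nonneg (by positivity)]
    exact le_of_eq (by ring)

theorem lpNorm_coord_iterate_le (hδ : ∀ u n, c (δ u) n = n * c u n)
    (hc : ∀ u, MemLp (c u) p Measure.count) (α : ℂ) {j k : ℕ} (hj : j ≤ k) (u : R) :
    lpNorm (c (δ^[j] u)) p Measure.count ≤ (1 + ‖α‖) ^ k *
      lpNorm (fun n : ℤ => (((1 + ‖(n : ℂ) + α‖) ^ k : ℝ) : ℂ) * c u n) p Measure.count := by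
  refine lpNorm_le_mul_lpNorm_of_ae_le_mul (by positivity) (memLp_one_add_norm_pow_mul hδ hc α k u)
    (.of_forall fun n => ?_)
  have hn : ‖(n : ℂ)‖ ≤ ‖(n : ℂ) + α‖ + ‖α‖ := by simpa using norm_sub_le ((n : ℂ) + α) α
  have hone : 1 ≤ (1 + ‖α‖) * (1 + ‖(n : ℂ) + α‖) :=
    one_le_mul_of_one_le_of_one_le (by simp) (by simp)
  rw [coord_iterate hδ, norm_mul, norm_mul, norm_pow, Complex.norm_real,
    Real.norm_of_nonneg (by positivity), ← mul_assoc, ← mul_pow]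
  gcongr
  calc ‖(n : ℂ)‖ ^ j ≤ ((1 + ‖α‖) * (1 + ‖(n : ℂ) + α‖)) ^ j := by
        gcongr
        nlinarith [norm_nonneg α, norm_nonneg ((n : ℂ) + α)]
    _ ≤ _ := pow_le_pow_right₀ hone hj

theorem exists_isPowerPerturbation (hp : 1 ≤ p) (hδ : ∀ u n, c (δ u) n = n * c u n)
    (hc : ∀ u, MemLp (c u) p Measure.count) (hinj : Function.Injective c)
    (hmul : ∀ b : R, ∃ B : ℝ, 0 ≤ B ∧
      ∀ u, lpNorm (c (b * u)) p Measure.count ≤ B * lpNorm (c u) p Measure.count)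
    (α : ℂ) (k : ℕ) (b : ℕ → R) :
    ∃ K : ℝ, IsPowerPerturbation (perturbedPower δ α k b) c α k K p := by
  choose B hB0 hB using hmul
  set K := ∑ j ∈ Finset.range (k + 1), B (b j) * (1 + ‖α‖) ^ k with hK
  have hK0 : 0 ≤ K := Finset.sum_nonneg fun j _ => mul_nonneg (hB0 _) (by positivity)
  have hbound (u : R) : (fun n : ℤ => (((K + 1) * (1 + ‖(n : ℂ) + α‖) ^ k : ℝ) : ℂ)) * c u =
      ((K + 1 : ℝ) : ℂ) • fun n : ℤ => (((1 + ‖(n : ℂ) + α‖) ^ k : ℝ) : ℂ) * c u n := by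
    ext n
    simp [mul_assoc]
  refine ⟨K + 1,
    { memLp := hc
      injective := hinj
      one_le := hp
      pos := add_pos_of_nonneg_of_pos hK0 one_pos
      memLp_mul := fun u => ?_
      memLp_bound := fun u => ?_
      lpNorm_le := fun u => ?_ }⟩
  · convert hc ((fun v => δ v + α • v)^[k + 2] u) using 1
    ext n
    rw [coord_iterate_add hδ, Pi.mul_apply]
  · rw [hbound]
    exact (memLp_one_add_norm_pow_mul hδ hc α k u).const_smul _
  · have hdiff : c (perturbedPower δ α k b u) - (fun n : ℤ => ((n : ℂ) + α) ^ (k + 2)) * c u =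
        ∑ j ∈ Finset.range (k + 1), c (b j * δ^[j] u) := by
      ext n
      rw [perturbedPower_apply, map_add, map_sum, Pi.sub_apply, Pi.add_apply,
        coord_iterate_add hδ, Pi.mul_apply, add_sub_cancel_left]
    rw [hdiff, hbound, lpNorm_const_smul, Complex.nnnorm_real, coe_nnnorm,
      Real.norm_of_nonneg (by positivity)]
    refine (lpNorm_sum_le (fun j _ => hc _) hp).trans ?_
    calc _ ≤ ∑ j ∈ Finset.range (k + 1), B (b j) * ((1 + ‖α‖) ^ k * _) :=
          Finset.sum_le_sum fun j hj => (hB _ _).trans <| mul_le_mul_of_nonneg_left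
            (lpNorm_coord_iterate_le hδ hc α (Finset.mem_range_succ_iff.1 hj) u) (hB0 _)
      _ = K * _ := by simp only [hK, ← mul_assoc, ← Finset.sum_mul]
      _ ≤ _ := mul_le_mul_of_nonneg_right (by linarith) lpNorm_nonneg

end Coordinates

section SquareSummable

variable {ι E : Type*} [Countable ι] [MeasurableSpace ι] [MeasurableSingletonClass ι]
  [NormedAddCommGroup E] {v : ι → E}

theorem memLp_two_count_iff :
    MemLp v 2 (Measure.count : Measure ι) ↔ Summable fun i => ‖v i‖ ^ 2 := by
  rw [memLp_two_iff_integrable_sq_norm .of_discrete, integrable_count_iff]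
  simp only [norm_pow, norm_norm]

theorem lpNorm_two_count_of_hasSum {s : ℝ} (h : HasSum (fun i => ‖v i‖ ^ 2) s) :
    lpNorm v 2 (Measure.count : Measure ι) = √s := by
  have hint : Integrable (fun i => ‖v i‖ ^ 2) (Measure.count : Measure ι) :=
    (memLp_two_iff_integrable_sq_norm .of_discrete).1 (memLp_two_count_iff.2 h.summable)
  have hsum : ∫ i, ‖v i‖ ^ 2 ∂Measure.count = s := by
    rw [integral_countable hint]
    simpa using h.tsum_eq
  rw [lpNorm_eq_integral_norm_rpow_toReal two_ne_zero ENNReal.ofNat_ne_top .of_discrete,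
    Real.sqrt_eq_rpow, ← hsum]
  simp

end SquareSummable

section Circle

open intervalIntegral
open scoped ContDiff

/-- The algebra of smooth `2π`-periodic functions on the line. -/
def SmoothPeriodic : Subalgebra ℂ (ℝ → ℂ) where
  carrier := {u | ContDiff ℝ ∞ u ∧ Function.Periodic u (2 * Real.pi)}
  mul_mem' := fun hu hv => ⟨hu.1.mul hv.1, hu.2.mul hv.2⟩
  add_mem' := fun hu hv => ⟨hu.1.add hv.1, hu.2.add hv.2⟩
  algebraMap_mem' := fun _ => ⟨contDiff_const, fun _ => rfl⟩

namespace SmoothPeriodic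

instance : CoeFun SmoothPeriodic fun _ => ℝ → ℂ := ⟨Subtype.val⟩

theorem contDiff_coe (u : SmoothPeriodic) : ContDiff ℝ ∞ u := u.2.1

theorem periodic_coe (u : SmoothPeriodic) : Function.Periodic u (2 * Real.pi) := u.2.2

theorem continuous_coe (u : SmoothPeriodic) : Continuous u := (contDiff_coe u).continuous

theorem differentiable_coe (u : SmoothPeriodic) : Differentiable ℝ u :=
  (contDiff_coe u).differentiable (by simp)

theorem deriv_mem (u : SmoothPeriodic) : deriv u ∈ SmoothPeriodic :=
  ⟨(contDiff_infty_iff_deriv.1 (contDiff_coe u)).2, fun θ => by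
    rw [← deriv_comp_add_const]
    congr 1
    exact funext (periodic_coe u)⟩

/-- The derivation `d/dθ` of the algebra of smooth periodic functions. -/
noncomputable def derivation : Derivation ℂ SmoothPeriodic SmoothPeriodic :=
  Derivation.mk'
    { toFun := fun u => ⟨deriv u, deriv_mem u⟩
      map_add' := fun u v => Subtype.ext <| funext fun θ =>
        deriv_add (differentiable_coe u θ) (differentiable_coe v θ)
      map_smul' := fun z u => Subtype.ext <| funext fun θ =>
        deriv_const_smul z (differentiable_coe u θ) }
    fun u v => Subtype.ext <| funext fun θ => by
      refine (deriv_mul (differentiable_coe u θ) (differentiable_coe v θ)).trans ?_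
      simp only [LinearMap.coe_mk, AddHom.coe_mk, Subalgebra.coe_add, Pi.add_apply, smul_eq_mul,
        Subalgebra.coe_mul, Pi.mul_apply]
      ring

theorem coe_derivation (u : SmoothPeriodic) : (derivation u : ℝ → ℂ) = deriv u := rfl

theorem hasDerivAt_coe (u : SmoothPeriodic) (θ : ℝ) : HasDerivAt u (derivation u θ) θ :=
  (differentiable_coe u θ).hasDerivAt

theorem exists_norm_le (u : SmoothPeriodic) :
    ∃ B : ℝ, 0 ≤ B ∧ ∀ θ ∈ Set.Icc 0 (2 * Real.pi), ‖u θ‖ ≤ B := by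
  obtain ⟨B, hB⟩ := isCompact_Icc.exists_bound_of_continuousOn
    ((continuous_coe u).continuousOn (s := Set.Icc 0 (2 * Real.pi)))
  exact ⟨max B 0, le_max_right _ _, fun θ hθ => (hB θ hθ).trans (le_max_left _ _)⟩

theorem ext_Icc {u v : SmoothPeriodic} (h : ∀ θ ∈ Set.Icc 0 (2 * Real.pi), u θ = v θ) : u = v := by
  ext θ
  obtain ⟨y, hy, hy'⟩ := (periodic_coe (u - v)).exists_mem_Ico₀ (by positivity) θ
  have hsub (t : ℝ) : (u - v : SmoothPeriodic) t = u t - v t := rfl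
  rw [hsub, hsub, h y (Set.Ico_subset_Icc_self hy), sub_self] at hy'
  exact sub_eq_zero.1 hy'

theorem exists_derivation_eq (f : SmoothPeriodic) (hf : ∫ θ in (0 : ℝ)..2 * Real.pi, f θ = 0) :
    ∃ u : SmoothPeriodic, derivation u = f := by
  have hfint (a b : ℝ) : IntervalIntegrable f volume a b :=
    (continuous_coe f).intervalIntegrable a b
  have hderiv (θ : ℝ) : HasDerivAt (fun x => ∫ t in (0 : ℝ)..x, f t) (f θ) θ :=
    integral_hasDerivAt_right (hfint _ _)
      ((continuous_coe f).stronglyMeasurableAtFilter _ _) (continuous_coe f).continuousAt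
  have hderiv' := funext fun θ => (hderiv θ).deriv
  refine ⟨⟨fun x => ∫ t in (0 : ℝ)..x, f t, contDiff_infty_iff_deriv.2
    ⟨fun θ => (hderiv θ).differentiableAt, by rw [hderiv']; exact contDiff_coe f⟩, fun θ => ?_⟩,
    Subtype.ext hderiv'⟩
  beta_reduce
  rw [← integral_add_adjacent_intervals (hfint 0 θ) (hfint θ _),
    (periodic_coe f).intervalIntegral_add_eq θ 0, zero_add, hf, add_zero]

/-- The exponential of a smooth periodic function. -/
noncomputable def exp (u : SmoothPeriodic) : SmoothPeriodic :=
  ⟨fun θ => Complex.exp (u θ), (contDiff_coe u).cexp, fun θ => by simp only [periodic_coe u θ]⟩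

theorem exp_neg_mul_exp (u : SmoothPeriodic) : exp (-u) * exp u = 1 := by
  ext θ
  simp [exp, ← Complex.exp_add]

theorem derivation_exp (u : SmoothPeriodic) : derivation (exp u) = exp u * derivation u :=
  Subtype.ext <| funext fun θ => (hasDerivAt_coe u θ).cexp.deriv

end SmoothPeriodic

/-- A smooth positive `2π`-periodic density on the line of mean one. -/
structure CircleDensity where
  h : ℝ → ℝ
  smooth : ContDiff ℝ ∞ h
  periodic : Function.Periodic h (2 * Real.pi)
  pos : ∀ θ, 0 < h θ
  integral : ∫ θ in (0 : ℝ)..2 * Real.pi, h θ = 2 * Real.pi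

namespace CircleDensity

open SmoothPeriodic

variable (d : CircleDensity)

theorem continuous : Continuous d.h := d.smooth.continuous

theorem ofReal_h_ne_zero (θ : ℝ) : (d.h θ : ℂ) ≠ 0 := Complex.ofReal_ne_zero.2 (d.pos θ).ne'

/-- The angular coordinate with the given density. -/
noncomputable def angle (θ : ℝ) : ℝ := ∫ t in (0 : ℝ)..θ, d.h t

theorem angle_zero : d.angle 0 = 0 := integral_same

theorem angle_two_pi : d.angle (2 * Real.pi) = 2 * Real.pi := d.integral

theorem hasDerivAt_angle (θ : ℝ) : HasDerivAt d.angle (d.h θ) θ :=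
  integral_hasDerivAt_right (d.continuous.intervalIntegrable _ _)
    (d.continuous.stronglyMeasurableAtFilter _ _) d.continuous.continuousAt

theorem continuous_angle : Continuous d.angle :=
  continuous_iff_continuousAt.2 fun θ => (d.hasDerivAt_angle θ).continuousAt

theorem strictMono_angle : StrictMono d.angle :=
  strictMono_of_deriv_pos fun θ => by
    rw [(d.hasDerivAt_angle θ).deriv]
    exact d.pos θ

theorem angle_add_two_pi (θ : ℝ) : d.angle (θ + 2 * Real.pi) = d.angle θ + 2 * Real.pi := by
  have h : d.angle (θ + 2 * Real.pi) = d.angle θ + ∫ t in θ..θ + 2 * Real.pi, d.h t :=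
    (integral_add_adjacent_intervals (d.continuous.intervalIntegrable _ _)
      (d.continuous.intervalIntegrable _ _)).symm
  rw [h, d.periodic.intervalIntegral_add_eq θ 0, zero_add, d.integral]

theorem angle_intCast_mul_two_pi (n : ℤ) :
    d.angle (n * (2 * Real.pi)) = n * (2 * Real.pi) := by
  have hp : Function.Periodic (fun θ => d.angle θ - θ) (2 * Real.pi) := fun θ => by
    simp only [d.angle_add_two_pi]
    ring
  have h := hp.int_mul_eq n
  simp only [d.angle_zero, sub_zero] at h
  exact sub_eq_zero.1 h

theorem surjective_angle : Function.Surjective d.angle := by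
  intro y
  refine mem_range_of_exists_le_of_exists_ge d.continuous_angle
    ⟨⌊y / (2 * Real.pi)⌋ * (2 * Real.pi), ?_⟩ ⟨⌈y / (2 * Real.pi)⌉ * (2 * Real.pi), ?_⟩
  · rw [angle_intCast_mul_two_pi, ← le_div_iff₀ Real.two_pi_pos]
    exact Int.floor_le _
  · rw [angle_intCast_mul_two_pi, ← div_le_iff₀ Real.two_pi_pos]
    exact Int.le_ceil _

/-- The change of variables from the angle to the angular coordinate of the density. -/
noncomputable def angleHomeomorph : ℝ ≃ₜ ℝ :=
  (d.strictMono_angle.orderIsoOfSurjective _ d.surjective_angle).toHomeomorph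

theorem angleHomeomorph_symm_angle (θ : ℝ) : d.angleHomeomorph.symm (d.angle θ) = θ :=
  d.angleHomeomorph.symm_apply_apply θ

theorem integral_smul_comp_angle {G : Type*} [NormedAddCommGroup G] [NormedSpace ℝ G] {f : ℝ → G}
    (hf : Continuous f) : ∫ θ in (0 : ℝ)..2 * Real.pi, d.h θ • f (d.angle θ) =
      ∫ y in (0 : ℝ)..2 * Real.pi, f y := by
  simpa only [d.angle_zero, d.angle_two_pi, Function.comp_apply] using integral_deriv_smul_comp
    (a := 0) (b := 2 * Real.pi) (fun θ _ => d.hasDerivAt_angle θ) d.continuous.continuousOn hf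

/-- The density as a smooth periodic function. -/
noncomputable def density : SmoothPeriodic :=
  ⟨fun θ => (d.h θ : ℂ), Complex.ofRealCLM.contDiff.comp d.smooth,
    fun θ => by simp only [d.periodic θ]⟩

theorem integral_density : ∫ θ in (0 : ℝ)..2 * Real.pi, d.density θ = 2 * Real.pi := by
  refine intervalIntegral.integral_ofReal.trans ?_
  rw [d.integral]
  push_cast
  rfl

/-- The inverse density as a smooth periodic function. -/
noncomputable def inv : SmoothPeriodic :=
  ⟨fun θ => (d.h θ : ℂ)⁻¹, (contDiff_coe d.density).inv d.ofReal_h_ne_zero,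
    fun θ => by simp only [d.periodic θ]⟩

theorem inv_mul_density : d.inv * d.density = 1 :=
  Subtype.ext <| funext fun θ => inv_mul_cancel₀ (d.ofReal_h_ne_zero θ)

/-- The derivation `-i d/dx` in the angular coordinate `x` of the density. -/
noncomputable def delta : Derivation ℂ SmoothPeriodic SmoothPeriodic :=
  (algebraMap ℂ SmoothPeriodic (-Complex.I) * d.inv) • derivation

theorem delta_eq (u : SmoothPeriodic) :
    d.delta u = algebraMap ℂ SmoothPeriodic (-Complex.I) * d.inv * derivation u := rfl

theorem delta_apply (u : SmoothPeriodic) (θ : ℝ) :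
    d.delta u θ = -Complex.I * (d.h θ : ℂ)⁻¹ * deriv u θ := rfl

/-- The exponential `exp (-i n x)` in the angular coordinate `x` of the density. -/
noncomputable def expo (n : ℤ) (θ : ℝ) : ℂ := Complex.exp (-(n * d.angle θ * Complex.I))

theorem hasDerivAt_expo (n : ℤ) (θ : ℝ) :
    HasDerivAt (d.expo n) (-(n * Complex.I) * (d.h θ * d.expo n θ)) θ := by
  have h : HasDerivAt (fun θ : ℝ => -(n * d.angle θ * Complex.I)) (-(n * d.h θ * Complex.I)) θ :=
    (((d.hasDerivAt_angle θ).ofReal_comp.const_mul (n : ℂ)).mul_const Complex.I).neg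
  refine h.cexp.congr_deriv ?_
  simp only [expo]
  ring

theorem continuous_expo (n : ℤ) : Continuous (d.expo n) :=
  continuous_iff_continuousAt.2 fun θ => (d.hasDerivAt_expo n θ).continuousAt

theorem expo_two_pi (n : ℤ) : d.expo n (2 * Real.pi) = d.expo n 0 := by
  simp only [expo, angle_two_pi, angle_zero, Complex.ofReal_zero, mul_zero, zero_mul, neg_zero,
    Complex.exp_zero]
  rw [Complex.exp_eq_one_iff]
  exact ⟨-n, by push_cast; ring⟩

theorem continuous_h_mul_expo (n : ℤ) : Continuous fun θ => d.h θ * d.expo n θ :=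
  (continuous_coe d.density).mul (d.continuous_expo n)

theorem continuous_integrand (n : ℤ) (u : SmoothPeriodic) :
    Continuous fun θ => u θ * (d.h θ * d.expo n θ) :=
  (continuous_coe u).mul (d.continuous_h_mul_expo n)

/-- The Fourier coefficients in the angular coordinate of the density. -/
noncomputable def coeff : SmoothPeriodic →ₗ[ℂ] ℤ → ℂ where
  toFun u n := (2 * Real.pi : ℂ)⁻¹ *
    ∫ θ in (0 : ℝ)..2 * Real.pi, u θ * (d.h θ * d.expo n θ)
  map_add' u v := by
    ext n
    simp only [Subalgebra.coe_add, Pi.add_apply, add_mul]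
    rw [intervalIntegral.integral_add ((d.continuous_integrand n u).intervalIntegrable _ _)
      ((d.continuous_integrand n v).intervalIntegrable _ _), mul_add]
  map_smul' z u := by
    ext n
    simp only [Subalgebra.coe_smul, Pi.smul_apply, smul_eq_mul, mul_assoc, RingHom.id_apply]
    rw [intervalIntegral.integral_const_mul, mul_left_comm]

theorem coeff_apply (u : SmoothPeriodic) (n : ℤ) : d.coeff u n =
    (2 * Real.pi : ℂ)⁻¹ * ∫ θ in (0 : ℝ)..2 * Real.pi, u θ * (d.h θ * d.expo n θ) := rfl

theorem coeff_delta (u : SmoothPeriodic) (n : ℤ) : d.coeff (d.delta u) n = n * d.coeff u n := by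
  have hparts : ∫ θ in (0 : ℝ)..2 * Real.pi, derivation u θ * d.expo n θ =
      n * Complex.I * ∫ θ in (0 : ℝ)..2 * Real.pi, u θ * (d.h θ * d.expo n θ) := by
    have := integral_mul_deriv_eq_deriv_mul (a := 0) (b := 2 * Real.pi)
      (fun θ _ => hasDerivAt_coe u θ) (fun θ _ => d.hasDerivAt_expo n θ)
      ((continuous_coe _).intervalIntegrable _ _)
      (((d.continuous_h_mul_expo n).const_mul _).intervalIntegrable _ _)
    simp only [mul_left_comm (u _) (-_)] at this
    rw [intervalIntegral.integral_const_mul, expo_two_pi, (periodic_coe u).eq, sub_self,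
      zero_sub, neg_mul, neg_inj] at this
    exact this.symm
  have hdelta : ∫ θ in (0 : ℝ)..2 * Real.pi, d.delta u θ * (d.h θ * d.expo n θ) =
      -Complex.I * ∫ θ in (0 : ℝ)..2 * Real.pi, derivation u θ * d.expo n θ := by
    rw [← intervalIntegral.integral_const_mul]
    refine integral_congr fun θ _ => ?_
    have := d.ofReal_h_ne_zero θ
    simp only [delta_apply, coe_derivation]
    field_simp
  rw [coeff_apply, coeff_apply, hdelta, hparts]
  linear_combination (-(2 * Real.pi : ℂ)⁻¹ * n *
    ∫ θ in (0 : ℝ)..2 * Real.pi, u θ * (d.h θ * d.expo n θ)) * Complex.I_sq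

theorem fourierCoeffOn_comp_angleHomeomorph_symm (u : SmoothPeriodic) (n : ℤ) :
    fourierCoeffOn Real.two_pi_pos (fun y => u (d.angleHomeomorph.symm y)) n = d.coeff u n := by
  have hcont : Continuous fun y : ℝ =>
      Complex.exp (-(n * y * Complex.I)) * u (d.angleHomeomorph.symm y) :=
    (by fun_prop : Continuous fun y : ℝ => Complex.exp (-(n * y * Complex.I))).mul
      ((continuous_coe u).comp d.angleHomeomorph.symm.continuous)
  have hfourier (y : ℝ) : (fourier (-n) (y : AddCircle (2 * Real.pi - 0)) : ℂ) =
      Complex.exp (-(n * y * Complex.I)) := by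
    rw [fourier_coe_apply]
    congr 1
    have : (Real.pi : ℂ) ≠ 0 := Complex.ofReal_ne_zero.2 Real.pi_ne_zero
    push_cast
    rw [sub_zero]
    field_simp
  simp only [fourierCoeffOn_eq_integral, hfourier, smul_eq_mul]
  rw [← d.integral_smul_comp_angle hcont, coeff_apply, Complex.real_smul]
  simp only [angleHomeomorph_symm_angle, Complex.real_smul, expo]
  congr 1
  · push_cast
    simp
  · exact integral_congr fun θ _ => by ring

theorem hasSum_sq_coeff (u : SmoothPeriodic) : HasSum (fun n => ‖d.coeff u n‖ ^ 2)
    ((2 * Real.pi)⁻¹ * ∫ θ in (0 : ℝ)..2 * Real.pi, d.h θ * ‖u θ‖ ^ 2) := by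
  have hcont : Continuous fun y => u (d.angleHomeomorph.symm y) :=
    (continuous_coe u).comp d.angleHomeomorph.symm.continuous
  obtain ⟨B, hB⟩ := isCompact_Icc.exists_bound_of_continuousOn
    (hcont.continuousOn (s := Set.Icc 0 (2 * Real.pi)))
  have hL2 : MemLp (fun y => u (d.angleHomeomorph.symm y)) 2
      (volume.restrict (Set.Ioc 0 (2 * Real.pi))) :=
    MemLp.of_bound hcont.aestronglyMeasurable B <| (ae_restrict_mem measurableSet_Ioc).mono
      fun y hy => hB y (Set.Ioc_subset_Icc_self hy)
  have key := hasSum_sq_fourierCoeffOn Real.two_pi_pos hL2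
  simp only [fourierCoeffOn_comp_angleHomeomorph_symm] at key
  rw [← d.integral_smul_comp_angle (f := fun y => ‖u (d.angleHomeomorph.symm y)‖ ^ 2)
    (hcont.norm.pow 2)] at key
  simpa only [sub_zero, smul_eq_mul, angleHomeomorph_symm_angle] using key

theorem memLp_coeff (u : SmoothPeriodic) : MemLp (d.coeff u) 2 Measure.count :=
  memLp_two_count_iff.2 (d.hasSum_sq_coeff u).summable

theorem injective_coeff : Function.Injective d.coeff := by
  rw [injective_iff_map_eq_zero]
  intro u hu
  have hsum := d.hasSum_sq_coeff u
  simp only [hu, Pi.zero_apply, norm_zero, ne_eq, OfNat.ofNat_ne_zero, not_false_eq_true,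
    zero_pow] at hsum
  have hzero : ∫ θ in (0 : ℝ)..2 * Real.pi, d.h θ * ‖u θ‖ ^ 2 = 0 := by
    simpa [Real.pi_ne_zero] using hsum.unique hasSum_zero
  refine SmoothPeriodic.ext_Icc fun θ hθ => ?_
  by_contra hne
  refine absurd hzero (integral_pos Real.two_pi_pos ?_ (fun t _ => ?_) ⟨θ, hθ, ?_⟩).ne'
  · exact (d.continuous.mul ((continuous_coe u).norm.pow 2)).continuousOn
  · exact mul_nonneg (d.pos t).le (by positivity)
  · exact mul_pos (d.pos θ) (pow_pos (norm_pos_iff.2 hne) 2)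

theorem exists_lpNorm_coeff_mul_le (b : SmoothPeriodic) : ∃ B : ℝ, 0 ≤ B ∧ ∀ u,
    lpNorm (d.coeff (b * u)) 2 Measure.count ≤ B * lpNorm (d.coeff u) 2 Measure.count := by
  obtain ⟨B, hB0, hB⟩ := SmoothPeriodic.exists_norm_le b
  refine ⟨B, hB0, fun u => ?_⟩
  have hcont (v : SmoothPeriodic) : Continuous fun θ => d.h θ * ‖v θ‖ ^ 2 :=
    d.continuous.mul ((continuous_coe v).norm.pow 2)
  rw [lpNorm_two_count_of_hasSum (d.hasSum_sq_coeff _),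
    lpNorm_two_count_of_hasSum (d.hasSum_sq_coeff _), ← Real.sqrt_sq hB0,
    ← Real.sqrt_mul (sq_nonneg B), mul_left_comm (B ^ 2),
    ← intervalIntegral.integral_const_mul (B ^ 2)]
  refine Real.sqrt_le_sqrt (mul_le_mul_of_nonneg_left ?_ (inv_nonneg.2 Real.two_pi_pos.le))
  refine integral_mono_on Real.two_pi_pos.le ((hcont _).intervalIntegrable _ _)
    (((hcont u).const_mul _).intervalIntegrable _ _) fun θ hθ => ?_
  rw [Subalgebra.coe_mul, Pi.mul_apply, norm_mul, mul_pow, mul_left_comm]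
  have := (d.pos θ).le
  gcongr
  exact hB θ hθ

/- The factor `exp ψ` solves the equation if `δ ψ = α - a`; the constant `α` is the mean of `a`, so
that the primitive `ψ` is periodic. -/
theorem exists_gauge (a : SmoothPeriodic) : ∃ (α : ℂ) (E E' : SmoothPeriodic), E' * E = 1 ∧
    d.delta E = E * (algebraMap ℂ SmoothPeriodic α - a) := by
  set α : ℂ := (2 * Real.pi : ℂ)⁻¹ * ∫ θ in (0 : ℝ)..2 * Real.pi, (d.density * a) θ with hα
  set b := algebraMap ℂ SmoothPeriodic α - a
  have hmean : ∫ θ in (0 : ℝ)..2 * Real.pi,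
      (algebraMap ℂ SmoothPeriodic Complex.I * (d.density * b)) θ = 0 := by
    have hsplit (θ : ℝ) : (algebraMap ℂ SmoothPeriodic Complex.I * (d.density * b)) θ =
        Complex.I * (α * d.density θ - (d.density * a) θ) := by
      change Complex.I * (d.density θ * (α - a θ)) =
        Complex.I * (α * d.density θ - d.density θ * a θ)
      ring
    simp only [hsplit]
    rw [intervalIntegral.integral_const_mul, intervalIntegral.integral_sub
      (((continuous_coe _).const_mul _).intervalIntegrable _ _)
      ((continuous_coe _).intervalIntegrable _ _), intervalIntegral.integral_const_mul,
      integral_density, hα]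
    have : (Real.pi : ℂ) ≠ 0 := Complex.ofReal_ne_zero.2 Real.pi_ne_zero
    field_simp
    ring
  obtain ⟨ψ, hψ⟩ := SmoothPeriodic.exists_derivation_eq _ hmean
  refine ⟨α, SmoothPeriodic.exp ψ, _, SmoothPeriodic.exp_neg_mul_exp ψ, ?_⟩
  have hI : algebraMap ℂ SmoothPeriodic (-Complex.I) * algebraMap ℂ SmoothPeriodic Complex.I =
      1 := by
    rw [← map_mul, neg_mul, Complex.I_mul_I, neg_neg, map_one]
  rw [delta_eq, SmoothPeriodic.derivation_exp, hψ]
  linear_combination (SmoothPeriodic.exp ψ * b * d.inv * d.density) * hI +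
    (SmoothPeriodic.exp ψ * b) * d.inv_mul_density

end CircleDensity

end Circle

section SeriesValue

variable {𝕜 : Type*} [NormedField 𝕜] {f g : PowerSeries 𝕜} {r s : ℝ} {z : 𝕜}

/-- Absolute convergence of a power series on the circle of radius `r`. -/
def SummableAt (f : PowerSeries 𝕜) (r : ℝ) : Prop :=
  Summable fun n => ‖PowerSeries.coeff n f‖ * r ^ n

/-- The sum of a power series at a point, with the junk value `0` where it does not converge. -/
noncomputable def seriesValue (f : PowerSeries 𝕜) (z : 𝕜) : 𝕜 :=
  ∑' n, PowerSeries.coeff n f * z ^ n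

theorem SummableAt.mono (hs : SummableAt f s) (hr : 0 ≤ r) (h : r ≤ s) : SummableAt f r :=
  Summable.of_nonneg_of_le (fun _ => by positivity) (fun _ => by gcongr) hs

theorem SummableAt.summable_norm (h : SummableAt f ‖z‖) :
    Summable fun n => ‖PowerSeries.coeff n f * z ^ n‖ := by
  simpa only [SummableAt, norm_mul, norm_pow] using h

theorem SummableAt.summable [CompleteSpace 𝕜] (h : SummableAt f ‖z‖) :
    Summable fun n => PowerSeries.coeff n f * z ^ n :=
  h.summable_norm.of_norm

theorem SummableAt.add (hr : 0 ≤ r) (hf : SummableAt f r) (hg : SummableAt g r) :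
    SummableAt (f + g) r := by
  refine Summable.of_nonneg_of_le (fun _ => by positivity) (fun n => ?_) (Summable.add hf hg)
  rw [map_add, ← add_mul]
  gcongr
  exact norm_add_le _ _

theorem SummableAt.const_smul (hf : SummableAt f r) (a : 𝕜) : SummableAt (a • f) r :=
  (Summable.mul_left ‖a‖ hf).congr fun n => by
    rw [PowerSeries.coeff_smul, smul_eq_mul, norm_mul, mul_assoc]

theorem summableAt_zero (r : ℝ) : SummableAt (0 : PowerSeries 𝕜) r := by
  simp [SummableAt, summable_zero]

theorem coeff_mul_mul_pow (f g : PowerSeries 𝕜) (z : 𝕜) (n : ℕ) :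
    PowerSeries.coeff n (f * g) * z ^ n = ∑ p ∈ Finset.HasAntidiagonal.antidiagonal n,
      (PowerSeries.coeff p.1 f * z ^ p.1) * (PowerSeries.coeff p.2 g * z ^ p.2) := by
  rw [PowerSeries.coeff_mul, Finset.sum_mul]
  refine Finset.sum_congr rfl fun p hp => ?_
  rw [← Finset.HasAntidiagonal.mem_antidiagonal.1 hp, pow_add]
  ring

theorem SummableAt.mul (hf : SummableAt f ‖z‖) (hg : SummableAt g ‖z‖) :
    SummableAt (f * g) ‖z‖ := by
  have := summable_norm_sum_mul_antidiagonal_of_summable_norm hf.summable_norm hg.summable_norm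
  simpa only [SummableAt, ← coeff_mul_mul_pow, norm_mul, norm_pow] using this

theorem seriesValue_zero_right (f : PowerSeries 𝕜) : seriesValue f 0 = PowerSeries.coeff 0 f := by
  rw [seriesValue, tsum_eq_single 0 fun n hn => by simp [hn], pow_zero, mul_one]

theorem seriesValue_smul (a : 𝕜) (f : PowerSeries 𝕜) (z : 𝕜) :
    seriesValue (a • f) z = a * seriesValue f z := by
  simp only [seriesValue, PowerSeries.coeff_smul, smul_eq_mul, mul_assoc, tsum_mul_left]

variable [CompleteSpace 𝕜]

theorem seriesValue_mul (hf : SummableAt f ‖z‖) (hg : SummableAt g ‖z‖) :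
    seriesValue (f * g) z = seriesValue f z * seriesValue g z := by
  simp only [seriesValue, coeff_mul_mul_pow]
  exact (tsum_mul_tsum_eq_tsum_sum_antidiagonal_of_summable_norm
    hf.summable_norm hg.summable_norm).symm

theorem seriesValue_add (hf : SummableAt f ‖z‖) (hg : SummableAt g ‖z‖) :
    seriesValue (f + g) z = seriesValue f z + seriesValue g z := by
  simp only [seriesValue, map_add, add_mul, hf.summable.tsum_add hg.summable]

theorem seriesValue_sum {ι : Type*} (s : Finset ι) {F : ι → PowerSeries 𝕜}
    (h : ∀ i ∈ s, SummableAt (F i) ‖z‖) :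
    seriesValue (∑ i ∈ s, F i) z = ∑ i ∈ s, seriesValue (F i) z := by
  simp only [seriesValue, map_sum, Finset.sum_mul]
  exact Summable.tsum_finsetSum fun i hi => (h i hi).summable

theorem seriesValue_sum_mul {ι : Type*} (s : Finset ι) {F G : ι → PowerSeries 𝕜}
    (hF : ∀ i ∈ s, SummableAt (F i) ‖z‖) (hG : ∀ i ∈ s, SummableAt (G i) ‖z‖) :
    seriesValue (∑ i ∈ s, F i * G i) z = ∑ i ∈ s, seriesValue (F i) z * seriesValue (G i) z := by
  rw [seriesValue_sum s fun i hi => (hF i hi).mul (hG i hi)]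
  exact Finset.sum_congr rfl fun i hi => seriesValue_mul (hF i hi) (hG i hi)

omit [CompleteSpace 𝕜] in
theorem SummableAt.exists_norm_seriesValue_le (hr : 0 ≤ r) (hf : SummableAt f r) :
    ∃ B, 0 ≤ B ∧ ∀ z, ‖z‖ ≤ r → ‖seriesValue f z‖ ≤ B := by
  refine ⟨∑' n, ‖PowerSeries.coeff n f‖ * r ^ n, tsum_nonneg fun _ => by positivity,
    fun z hz => ?_⟩
  have h := (hf.mono (norm_nonneg z) hz).summable_norm
  refine (norm_tsum_le_tsum_norm h).trans (h.tsum_le_tsum (fun n => ?_) hf)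
  rw [norm_mul, norm_pow]
  gcongr

theorem continuousOn_seriesValue (hf : SummableAt f r) :
    ContinuousOn (seriesValue f) (Metric.closedBall 0 r) := by
  refine continuousOn_tsum (fun n => by fun_prop) hf fun n z hz => ?_
  have := mem_closedBall_zero_iff.1 hz
  rw [norm_mul, norm_pow]
  gcongr

end SeriesValue

local notation "𝔡" => DFunLike.coe (PowerSeries.derivative _)

section Derivative

variable {𝕜 : Type*} [RCLike 𝕜] {f : PowerSeries 𝕜} {r : ℝ} {z : 𝕜}

theorem norm_coeff_derivative (f : PowerSeries 𝕜) (n : ℕ) :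
    ‖PowerSeries.coeff n (𝔡 f)‖ = ‖PowerSeries.coeff (n + 1) f‖ * (n + 1) := by
  rw [PowerSeries.coeff_derivative, norm_mul]
  exact_mod_cast congrArg _ (RCLike.norm_natCast (K := 𝕜) (n + 1))

theorem seriesValue_derivative
    (h : Summable fun n : ℕ => PowerSeries.coeff n f * ((n : 𝕜) * z ^ (n - 1))) :
    seriesValue (𝔡 f) z = ∑' n : ℕ, PowerSeries.coeff n f * ((n : 𝕜) * z ^ (n - 1)) := by
  rw [h.tsum_eq_zero_add]
  simp only [seriesValue, PowerSeries.coeff_derivative, Nat.cast_zero, zero_mul, mul_zero,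
    zero_add, Nat.add_sub_cancel, Nat.cast_add_one, mul_assoc]

theorem SummableAt.of_derivative (h : SummableAt (𝔡 f) r) :
    Summable fun n : ℕ => ‖PowerSeries.coeff n f‖ * (n * r ^ (n - 1)) := by
  rw [← summable_nat_add_iff 1]
  refine Summable.congr h fun n => ?_
  rw [norm_coeff_derivative, Nat.add_sub_cancel, Nat.cast_add_one, mul_assoc]

theorem hasDerivAt_seriesValue (h : SummableAt (𝔡 f) r) (hz : ‖z‖ < r) :
    HasDerivAt (seriesValue f) (seriesValue (𝔡 f) z) z := by
  have hr : 0 < r := (norm_nonneg z).trans_lt hz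
  have hbound (n : ℕ) (y : 𝕜) (hy : y ∈ Metric.ball (0 : 𝕜) r) :
      ‖PowerSeries.coeff n f * ((n : 𝕜) * y ^ (n - 1))‖ ≤
        ‖PowerSeries.coeff n f‖ * (n * r ^ (n - 1)) := by
    rw [norm_mul, norm_mul, norm_pow, RCLike.norm_natCast]
    have := (mem_ball_zero_iff.1 hy).le
    gcongr
  have hz' : z ∈ Metric.ball (0 : 𝕜) r := mem_ball_zero_iff.2 hz
  have hterm (n : ℕ) (y : 𝕜) (_ : y ∈ Metric.ball (0 : 𝕜) r) :
      HasDerivAt (PowerSeries.coeff n f * · ^ n)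
        (PowerSeries.coeff n f * ((n : 𝕜) * y ^ (n - 1))) y :=
    (hasDerivAt_pow n y).const_mul _
  have hconn : IsPreconnected (Metric.ball (0 : 𝕜) r) := (convex_ball 0 r).isPreconnected
  have hzero : Summable fun n => PowerSeries.coeff n f * (0 : 𝕜) ^ n :=
    summable_of_ne_finset_zero (s := {0}) fun n hn => by
      rw [zero_pow (by simpa using hn), mul_zero]
  have hsummable : Summable fun n : ℕ => PowerSeries.coeff n f * ((n : 𝕜) * z ^ (n - 1)) :=
    Summable.of_norm_bounded h.of_derivative fun n => hbound n z hz'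
  rw [seriesValue_derivative hsummable]
  exact hasDerivAt_tsum_of_isPreconnected h.of_derivative Metric.isOpen_ball
    hconn hterm hbound (Metric.mem_ball_self hr) hzero hz'

/-- At most polynomial growth of the coefficients of a power series. -/
def PolynomialGrowth (f : PowerSeries 𝕜) : Prop :=
  ∃ (B : ℝ) (k : ℕ), ∀ n, ‖PowerSeries.coeff n f‖ ≤ B * ((n : ℝ) + 1) ^ k

theorem SummableAt.polynomialGrowth (h : SummableAt f 1) : PolynomialGrowth f := by
  refine ⟨∑' n, ‖PowerSeries.coeff n f‖ * 1 ^ n, 0, fun n => ?_⟩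
  simpa only [one_pow, mul_one, pow_zero] using h.le_tsum n fun _ _ => by positivity

namespace PolynomialGrowth

theorem derivative (h : PolynomialGrowth f) : PolynomialGrowth (𝔡 f) := by
  obtain ⟨B, k, h⟩ := h
  have hB : 0 ≤ B := by simpa using (norm_nonneg _).trans (h 0)
  refine ⟨B * 2 ^ k, k + 1, fun n => ?_⟩
  rw [norm_coeff_derivative, pow_succ, ← mul_assoc, mul_assoc B, ← mul_pow]
  refine mul_le_mul_of_nonneg_right ((h (n + 1)).trans ?_) (by positivity)
  gcongr
  push_cast
  linarith [Nat.cast_nonneg (α := ℝ) n]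

theorem iterate_derivative (h : PolynomialGrowth f) (k : ℕ) : PolynomialGrowth (𝔡^[k] f) := by
  induction k with
  | zero => exact h
  | succ k ih =>
    rw [Function.iterate_succ_apply']
    exact ih.derivative

theorem summableAt (h : PolynomialGrowth f) (hr0 : 0 ≤ r) (hr1 : r < 1) : SummableAt f r := by
  obtain ⟨B, k, h⟩ := h
  obtain ⟨s, hs, hs1⟩ := exists_between (max_lt hr1 one_half_lt_one)
  have hs0 : 0 < s := one_half_pos.trans_le ((le_max_right _ _).trans hs.le)
  have hsum : Summable fun n : ℕ => ((n : ℝ) + 1) ^ k * s ^ (n + 1) := by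
    have := (summable_nat_add_iff 1).2 (summable_pow_mul_geometric_of_norm_lt_one k
      (r := s) (by rwa [Real.norm_of_nonneg hs0.le]))
    simpa only [Nat.cast_add_one] using this
  refine SummableAt.mono ?_ hr0 ((le_max_left _ _).trans hs.le)
  refine Summable.of_nonneg_of_le (fun _ => by positivity) (fun n => ?_) (hsum.mul_left (B / s))
  calc ‖PowerSeries.coeff n f‖ * s ^ n ≤ B * ((n : ℝ) + 1) ^ k * s ^ n := by gcongr; exact h n
    _ = B / s * (((n : ℝ) + 1) ^ k * s ^ (n + 1)) := by field_simp; ring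

theorem hasDerivAt (h : PolynomialGrowth f) (hz : ‖z‖ < 1) :
    HasDerivAt (seriesValue f) (seriesValue (𝔡 f) z) z := by
  obtain ⟨r, hr, hr1⟩ := exists_between hz
  exact hasDerivAt_seriesValue (h.derivative.summableAt ((norm_nonneg z).trans hr.le) hr1) hr

theorem hasDerivAt_iterate (h : PolynomialGrowth f) (n : ℕ) (hz : ‖z‖ < 1) :
    HasDerivAt (seriesValue (𝔡^[n] f)) (seriesValue (𝔡^[n + 1] f) z) z := by
  rw [Function.iterate_succ_apply']
  exact (h.iterate_derivative n).hasDerivAt hz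

theorem iteratedDeriv_eq (h : PolynomialGrowth f) (n : ℕ) (hz : ‖z‖ < 1) :
    iteratedDeriv n (seriesValue f) z = seriesValue (𝔡^[n] f) z := by
  induction n generalizing z with
  | zero => rw [iteratedDeriv_zero, Function.iterate_zero_apply]
  | succ n ih =>
    have hloc : iteratedDeriv n (seriesValue f) =ᶠ[𝓝 z] seriesValue (𝔡^[n] f) := by
      filter_upwards [Metric.isOpen_ball.mem_nhds (mem_ball_zero_iff.2 hz)] with y hy
      exact ih (mem_ball_zero_iff.1 hy)
    rw [iteratedDeriv_succ, hloc.deriv_eq, (h.hasDerivAt_iterate n hz).deriv]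

theorem norm_coeff_mul_pow_le {f : PowerSeries ℂ} (h : PolynomialGrowth f) {M : ℝ}
    (hr0 : 0 < r) (hr1 : r < 1) (hM : ∀ z : ℂ, ‖z‖ = r → ‖seriesValue f z‖ ≤ M) (n : ℕ) :
    ‖PowerSeries.coeff n f‖ * r ^ n ≤ M := by
  have hd : DiffContOnCl ℂ (seriesValue f) (Metric.ball 0 r) := by
    refine DifferentiableOn.diffContOnCl fun z hz => ?_
    rw [closure_ball _ hr0.ne'] at hz
    exact (h.hasDerivAt ((mem_closedBall_zero_iff.1 hz).trans_lt
      hr1)).differentiableAt.differentiableWithinAt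
  have hcauchy := Complex.norm_iteratedDeriv_le_of_forall_mem_sphere_norm_le n hr0 hd
    fun z hz => hM z (mem_sphere_zero_iff_norm.1 hz)
  rw [h.iteratedDeriv_eq n (by simp), seriesValue_zero_right,
    PowerSeries.coeff_zero_eq_constantCoeff_apply,
    PowerSeries.constantCoeff_iterate_derivative, norm_mul, Complex.norm_natCast,
    mul_div_assoc] at hcauchy
  rw [← le_div_iff₀ (by positivity)]
  exact le_of_mul_le_mul_left hcauchy (by positivity)

theorem norm_coeff_le {f : PowerSeries ℂ} (h : PolynomialGrowth f) {M : ℝ}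
    (hM : ∀ z : ℂ, ‖z‖ < 1 → ‖seriesValue f z‖ ≤ M) (n : ℕ) : ‖PowerSeries.coeff n f‖ ≤ M := by
  have hlim : Tendsto (fun r : ℝ => ‖PowerSeries.coeff n f‖ * r ^ n) (𝓝[<] 1)
      (𝓝 ‖PowerSeries.coeff n f‖) := by
    have : Continuous fun r : ℝ => ‖PowerSeries.coeff n f‖ * r ^ n := by fun_prop
    simpa only [one_pow, mul_one] using (this.tendsto 1).mono_left nhdsWithin_le_nhds
  refine le_of_tendsto hlim ?_
  filter_upwards [Ioo_mem_nhdsLT (zero_lt_one (α := ℝ))] with r hr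
  exact h.norm_coeff_mul_pow_le hr.1 hr.2 (fun z hz => hM z (hz.trans_lt hr.2)) n

end PolynomialGrowth

end Derivative

section SmoothSeries

theorem SummableAt.of_norm_coeff_derivative_derivative_le {𝕜 : Type*} [RCLike 𝕜]
    {f : PowerSeries 𝕜} {M : ℝ} (h : ∀ n, ‖PowerSeries.coeff n (𝔡 (𝔡 f))‖ ≤ M) :
    SummableAt f 1 := by
  rw [SummableAt, ← summable_nat_add_iff 2]
  have hs : Summable fun n : ℕ => M * (1 / ((n + 1 : ℕ) : ℝ) ^ 2) :=
    ((summable_nat_add_iff 1).2 (Real.summable_one_div_nat_pow.2 one_lt_two)).mul_left M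
  refine Summable.of_nonneg_of_le (fun _ => by positivity) (fun n => ?_) hs
  rw [one_pow, mul_one, mul_one_div, le_div_iff₀ (by positivity)]
  refine le_trans ?_ (h n)
  rw [norm_coeff_derivative, norm_coeff_derivative, mul_assoc]
  refine mul_le_mul_of_nonneg_left ?_ (norm_nonneg _)
  push_cast
  nlinarith [Nat.cast_nonneg (α := ℝ) n]

/-- The power series all of whose derivatives converge absolutely on the closed unit disc. -/
def smoothSeries : Submodule ℂ (PowerSeries ℂ) where
  carrier := {f | ∀ k, SummableAt (𝔡^[k] f) 1}
  zero_mem' k := by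
    rw [iterate_map_zero]
    exact summableAt_zero 1
  add_mem' {f g} hf hg k := by
    rw [iterate_map_add]
    exact (hf k).add zero_le_one (hg k)
  smul_mem' a f hf k := by
    have hcomm : Function.Commute (𝔡 : PowerSeries ℂ → PowerSeries ℂ) (a • ·) :=
      Derivation.map_smul _ a
    rw [hcomm.iterate_left k f]
    exact (hf k).const_smul a

theorem derivative_mem_smoothSeries {f : PowerSeries ℂ} (hf : f ∈ smoothSeries) :
    𝔡 f ∈ smoothSeries := fun k => by
  rw [← Function.iterate_succ_apply]
  exact hf (k + 1)

theorem iterate_derivative_mem_smoothSeries {f : PowerSeries ℂ} (hf : f ∈ smoothSeries) (k : ℕ) :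
    𝔡^[k] f ∈ smoothSeries := fun j => by
  rw [← Function.iterate_add_apply]
  exact hf (j + k)

theorem summableAt_of_mem_smoothSeries {f : PowerSeries ℂ} (hf : f ∈ smoothSeries) {r : ℝ}
    (hr0 : 0 ≤ r) (hr1 : r ≤ 1) : SummableAt f r :=
  (hf 0).mono hr0 hr1

theorem mem_smoothSeries_of_bounded {f : PowerSeries ℂ} (hf : PolynomialGrowth f)
    (h : ∀ k, ∃ M : ℝ, ∀ z : ℂ, ‖z‖ < 1 → ‖seriesValue (𝔡^[k] f) z‖ ≤ M) : f ∈ smoothSeries := by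
  intro k
  obtain ⟨M, hM⟩ := h (k + 2)
  refine SummableAt.of_norm_coeff_derivative_derivative_le (M := M) fun n => ?_
  rw [← Function.iterate_succ_apply' 𝔡, ← Function.iterate_succ_apply' 𝔡]
  exact (hf.iterate_derivative (k + 2)).norm_coeff_le hM n

end SmoothSeries

section BoundaryRegularity

theorem exists_annulus {E F : Type*} [NormedAddCommGroup E] [ProperSpace E]
    [NormedAddCommGroup F] {Q : E → F} (hQ : ContinuousOn Q (Metric.closedBall 0 1))
    (hne : ∀ z, ‖z‖ = 1 → Q z ≠ 0) :
    ∃ r c : ℝ, 0 < r ∧ r < 1 ∧ 0 < c ∧ ∀ z, r ≤ ‖z‖ → ‖z‖ ≤ 1 → c ≤ ‖Q z‖ := by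
  obtain ⟨c, hc0, hc⟩ := (isCompact_sphere (0 : E) 1).exists_forall_le' (a := 0)
    (hQ.norm.mono Metric.sphere_subset_closedBall)
    fun z hz => norm_pos_iff.2 (hne z (mem_sphere_zero_iff_norm.1 hz))
  have hcompact : IsCompact (Metric.closedBall (0 : E) 1 ∩ (‖Q ·‖) ⁻¹' Set.Iic (c / 2)) :=
    (isCompact_closedBall 0 1).of_isClosed_subset
      (hQ.norm.preimage_isClosed_of_isClosed Metric.isClosed_closedBall isClosed_Iic)
      Set.inter_subset_left
  obtain ⟨ε, hε0, hε⟩ := hcompact.exists_forall_le' (f := fun z => 1 - ‖z‖) (a := 0)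
    (by fun_prop) fun z hz => by
      refine sub_pos.2 ((mem_closedBall_zero_iff.1 hz.1).lt_of_ne fun h1 => ?_)
      have hle : ‖Q z‖ ≤ c / 2 := hz.2
      linarith [hc z (mem_sphere_zero_iff_norm.2 h1)]
  obtain ⟨r, hr, hr1⟩ := exists_between (max_lt (sub_lt_self 1 hε0) one_pos)
  refine ⟨r, c / 2, (le_max_right _ _).trans_lt hr, hr1, half_pos hc0, fun z hz hz1 => ?_⟩
  by_contra! hlt
  linarith [hε z ⟨mem_closedBall_zero_iff.2 hz1, hlt.le⟩, (le_max_left (1 - ε) 0).trans_lt hr]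

theorem norm_le_gronwallBound_of_chain {E : Type*} [NormedAddCommGroup E] [NormedSpace ℝ E]
    {N : ℕ} {F : ℕ → ℝ → E} {r s δ a b : ℝ} (hδ : 0 ≤ δ) (ha : 0 ≤ a) (hb : 0 ≤ b) (hrs : r ≤ s)
    (hF : ∀ j < N, ∀ t ∈ Set.Icc r s, HasDerivAt (F j) (F (j + 1) t) t)
    (hinit : ∀ j < N, ‖F j r‖ ≤ δ)
    (htop : ∀ t ∈ Set.Icc r s, ∀ B, (∀ j < N, ‖F j t‖ ≤ B) → ‖F N t‖ ≤ a + b * B) {j : ℕ}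
    (hj : j < N) : ‖F j s‖ ≤ gronwallBound δ (1 + b) a (s - r) := by
  have hderiv (t : ℝ) (ht : t ∈ Set.Icc r s) :
      HasDerivAt (fun t (i : Fin N) => F i t) (fun i : Fin N => F (i + 1) t) t :=
    hasDerivAt_pi.2 fun i => hF i i.2 t ht
  have hslope (t : ℝ) (ht : t ∈ Set.Icc r s) :
      ‖fun i : Fin N => F (i + 1) t‖ ≤ (1 + b) * ‖fun i : Fin N => F i t‖ + a := by
    have hle (i : ℕ) (hi : i < N) : ‖F i t‖ ≤ ‖fun i : Fin N => F i t‖ :=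
      norm_le_pi_norm (fun i : Fin N => F i t) ⟨i, hi⟩
    have hpos : 0 ≤ b * ‖fun i : Fin N => F i t‖ := by positivity
    refine (pi_norm_le_iff_of_nonneg (by positivity)).2 fun i => ?_
    rcases (Nat.succ_le_of_lt i.2).lt_or_eq with hi | hi
    · linarith [hle _ hi]
    · rw [Nat.succ_eq_add_one] at hi
      rw [hi]
      linarith [htop t ht _ hle, norm_nonneg fun i : Fin N => F i t]
  have hgronwall := norm_le_gronwallBound_of_norm_deriv_right_le
    (fun t ht => (hderiv t ht).continuousAt.continuousWithinAt)
    (fun t ht => (hderiv t (Set.Ico_subset_Icc_self ht)).hasDerivWithinAt)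
    ((pi_norm_le_iff_of_nonneg hδ).2 fun i : Fin N => hinit i i.2)
    (fun t ht => hslope t (Set.Ico_subset_Icc_self ht)) s ⟨hrs, le_rfl⟩
  exact (norm_le_pi_norm (fun i : Fin N => F i s) ⟨j, hj⟩).trans hgronwall

theorem norm_le_gronwallBound_of_radial_chain {E : Type*} [NormedAddCommGroup E] [NormedSpace ℂ E]
    {N : ℕ} {F : ℕ → ℂ → E} {r δ a b : ℝ} (hr : 0 < r) (hδ : 0 ≤ δ) (ha : 0 ≤ a) (hb : 0 ≤ b)
    (hF : ∀ j < N, ∀ z, ‖z‖ < 1 → HasDerivAt (F j) (F (j + 1) z) z)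
    (hinit : ∀ j < N, ∀ z, ‖z‖ = r → ‖F j z‖ ≤ δ)
    (htop : ∀ z, r ≤ ‖z‖ → ‖z‖ < 1 → ∀ B, (∀ j < N, ‖F j z‖ ≤ B) → ‖F N z‖ ≤ a + b * B)
    {j : ℕ} (hj : j < N) {z : ℂ} (hrz : r ≤ ‖z‖) (hz : ‖z‖ < 1) :
    ‖F j z‖ ≤ gronwallBound δ (1 + b) a 1 := by
  obtain ⟨ζ, hζ, hzζ⟩ : ∃ ζ : ℂ, ‖ζ‖ = 1 ∧ (‖z‖ : ℂ) * ζ = z := by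
    have hz0 : ‖z‖ ≠ 0 := (hr.trans_le hrz).ne'
    refine ⟨z / ‖z‖, ?_, mul_div_cancel₀ _ (by exact_mod_cast hz0)⟩
    rw [norm_div, Complex.norm_real, norm_norm, div_self hz0]
  have hnorm {t : ℝ} (ht : r ≤ t) : ‖(t : ℂ) * ζ‖ = t := by
    rw [norm_mul, hζ, mul_one, Complex.norm_real, Real.norm_of_nonneg (hr.le.trans ht)]
  have hG (j : ℕ) (t : ℝ) : ‖ζ ^ j • F j (t * ζ)‖ = ‖F j (t * ζ)‖ := by
    rw [norm_smul, norm_pow, hζ, one_pow, one_mul]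
  have hchain : ‖ζ ^ j • F j (‖z‖ * ζ)‖ ≤ gronwallBound δ (1 + b) a (‖z‖ - r) :=
    norm_le_gronwallBound_of_chain (F := fun j (t : ℝ) => ζ ^ j • F j (t * ζ))
    (N := N) (r := r) (s := ‖z‖) hδ ha hb hrz
    (fun j hj t ht => by
      have hray : HasDerivAt (fun t : ℝ => (t : ℂ) * ζ) ζ t := by
        simpa using (hasDerivAt_id t).ofReal_comp.mul_const ζ
      have hFt := hF j hj (t * ζ) (by rw [hnorm ht.1]; exact ht.2.trans_lt hz)
      exact ((hFt.scomp t hray).const_smul (ζ ^ j)).congr_deriv (by rw [pow_succ, mul_smul]))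
    (fun j hj => by
      rw [hG]
      exact hinit j hj _ (hnorm le_rfl))
    (fun t ht B hB => by
      simp only [hG] at hB ⊢
      exact htop _ (ht.1.trans (hnorm ht.1).ge) ((hnorm ht.1).trans_lt (ht.2.trans_lt hz)) B hB)
    hj
  rw [hG, hzζ] at hchain
  exact hchain.trans (gronwallBound_mono hδ ha (by positivity) (by linarith))

theorem exists_norm_seriesValue_le_affine {𝕜 : Type*} [NormedField 𝕜] [ProperSpace 𝕜] {N : ℕ}
    {q F : ℕ → PowerSeries 𝕜} (hq : ∀ k ≤ N, SummableAt (q k) 1)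
    (hlead : ∀ z, ‖z‖ = 1 → seriesValue (q N) z ≠ 0)
    (hF : ∀ k ≤ N, ∀ z : 𝕜, ‖z‖ < 1 → SummableAt (F k) ‖z‖)
    (hsum : SummableAt (∑ k ∈ Finset.range (N + 1), q k * F k) 1) :
    ∃ r a b : ℝ, 0 < r ∧ r < 1 ∧ 0 ≤ a ∧ 0 ≤ b ∧ ∀ z, r ≤ ‖z‖ → ‖z‖ < 1 → ∀ B,
      (∀ k < N, ‖seriesValue (F k) z‖ ≤ B) → ‖seriesValue (F N) z‖ ≤ a + b * B := by
  obtain ⟨r, c, hr0, hr1, hc, hcz⟩ := exists_annulus (continuousOn_seriesValue (hq N le_rfl)) hlead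
  obtain ⟨G, hG0, hG⟩ := hsum.exists_norm_seriesValue_le zero_le_one
  have hcoeff (k : ℕ) : ∃ B, 0 ≤ B ∧ (k ≤ N → ∀ z, ‖z‖ ≤ 1 → ‖seriesValue (q k) z‖ ≤ B) := by
    by_cases hk : k ≤ N
    · obtain ⟨B, hB0, hB⟩ := (hq k hk).exists_norm_seriesValue_le zero_le_one
      exact ⟨B, hB0, fun _ => hB⟩
    · exact ⟨0, le_rfl, fun h => absurd h hk⟩
  choose κ hκ0 hκ using hcoeff
  refine ⟨r, G / c, (∑ k ∈ Finset.range N, κ k) / c, hr0, hr1, by positivity,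
    div_nonneg (Finset.sum_nonneg fun k _ => hκ0 k) hc.le, fun z hz hz1 B hB => ?_⟩
  have hle {k : ℕ} (hk : k ∈ Finset.range (N + 1)) : k ≤ N :=
    Nat.lt_succ_iff.1 (Finset.mem_range.1 hk)
  have hvalue := (seriesValue_sum_mul (Finset.range (N + 1))
    (fun k hk => (hq k (hle hk)).mono (norm_nonneg z) hz1.le)
    fun k hk => hF k (hle hk) z hz1).trans (Finset.sum_range_succ _ N)
  have hlower : ‖∑ k ∈ Finset.range N, seriesValue (q k) z * seriesValue (F k) z‖ ≤
      (∑ k ∈ Finset.range N, κ k) * B := by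
    rw [Finset.sum_mul]
    refine norm_sum_le_of_le _ fun k hk => ?_
    have hk := Finset.mem_range.1 hk
    rw [norm_mul]
    exact mul_le_mul (hκ k hk.le z hz1.le) (hB k hk) (norm_nonneg _) (hκ0 k)
  rw [div_mul_eq_mul_div, ← add_div, le_div_iff₀' hc]
  calc c * ‖seriesValue (F N) z‖ ≤ ‖seriesValue (q N) z * seriesValue (F N) z‖ := by
        rw [norm_mul]
        gcongr
        exact hcz z hz hz1.le
    _ ≤ G + (∑ k ∈ Finset.range N, κ k) * B := by
        rw [eq_sub_of_add_eq' hvalue.symm]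
        exact (norm_sub_le _ _).trans (add_le_add (hG z hz1.le) hlower)

theorem exists_bound_of_ode {N : ℕ} {q : ℕ → PowerSeries ℂ} (hq : ∀ k ≤ N, SummableAt (q k) 1)
    (hlead : ∀ z : ℂ, ‖z‖ = 1 → seriesValue (q N) z ≠ 0) {f : PowerSeries ℂ}
    (hf : PolynomialGrowth f)
    (hsum : SummableAt (∑ k ∈ Finset.range (N + 1), q k * 𝔡^[k] f) 1) {k : ℕ} (hk : k < N) :
    ∃ M : ℝ, ∀ z : ℂ, ‖z‖ < 1 → ‖seriesValue (𝔡^[k] f) z‖ ≤ M := by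
  obtain ⟨r, a, b, hr0, hr1, ha, hb, htop⟩ := exists_norm_seriesValue_le_affine hq hlead
    (fun k _ z hz => (hf.iterate_derivative k).summableAt (norm_nonneg z) hz) hsum
  choose β hβ0 hβ using fun k =>
    ((hf.iterate_derivative k).summableAt hr0.le hr1).exists_norm_seriesValue_le hr0.le
  have hinner (j : ℕ) (hj : j < N) (z : ℂ) (hz : ‖z‖ ≤ r) :
      ‖seriesValue (𝔡^[j] f) z‖ ≤ ∑ k ∈ Finset.range N, β k :=
    (hβ j z hz).trans (Finset.single_le_sum (fun k _ => hβ0 k) (Finset.mem_range.2 hj))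
  refine ⟨max (∑ k ∈ Finset.range N, β k) (gronwallBound (∑ k ∈ Finset.range N, β k) (1 + b) a 1),
    fun z hz => ?_⟩
  rcases le_total ‖z‖ r with hzr | hzr
  · exact (hinner k hk z hzr).trans (le_max_left _ _)
  · refine le_max_of_le_right (norm_le_gronwallBound_of_radial_chain
      (F := fun j => seriesValue (𝔡^[j] f)) hr0 (Finset.sum_nonneg fun k _ => hβ0 k) ha hb
      (fun j _ z hz => hf.hasDerivAt_iterate j hz) (fun j hj z hz => hinner j hj z hz.le) htop hk
      hzr hz)

/-- The coefficients of the differential operator obtained by applying `D` after the operator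
with coefficients `q`. -/
def derivedCoeff {R₀ R : Type*} [CommSemiring R₀] [CommSemiring R] [Algebra R₀ R]
    (D : Derivation R₀ R R) (q : ℕ → R) : ℕ → R
  | 0 => D (q 0)
  | k + 1 => D (q (k + 1)) + q k

theorem derivation_sum_mul_iterate {R₀ R : Type*} [CommSemiring R₀] [CommSemiring R] [Algebra R₀ R]
    (D : Derivation R₀ R R) (q : ℕ → R) (f : R) (n : ℕ) :
    D (∑ k ∈ Finset.range n, q k * D^[k] f) + D (q n) * D^[n] f =
      ∑ k ∈ Finset.range (n + 1), derivedCoeff D q k * D^[k] f := by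
  induction n with
  | zero =>
    simp only [Finset.sum_range_zero, map_zero, zero_add, Finset.sum_range_one, derivedCoeff]
  | succ n ih =>
    rw [Finset.sum_range_succ _ (n + 1), ← ih, Finset.sum_range_succ, map_add,
      Derivation.leibniz, ← Function.iterate_succ_apply' (⇑D), derivedCoeff]
    simp only [smul_eq_mul]
    ring

theorem exists_prolongation {N : ℕ} {q : ℕ → PowerSeries ℂ} (hq : ∀ k, q k ∈ smoothSeries)
    (hqN : ∀ k, N < k → q k = 0) {f : PowerSeries ℂ}
    (hsum : ∑ k ∈ Finset.range (N + 1), q k * 𝔡^[k] f ∈ smoothSeries) (j : ℕ) :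
    ∃ q' : ℕ → PowerSeries ℂ, (∀ k, q' k ∈ smoothSeries) ∧ (∀ k, N + j < k → q' k = 0) ∧
      q' (N + j) = q N ∧ ∑ k ∈ Finset.range (N + j + 1), q' k * 𝔡^[k] f ∈ smoothSeries := by
  induction j with
  | zero => exact ⟨q, hq, hqN, rfl, hsum⟩
  | succ j ih =>
    obtain ⟨q', hq', hzero, hlead, hsum'⟩ := ih
    refine ⟨derivedCoeff (PowerSeries.derivative ℂ) q', ?_, ?_, ?_, ?_⟩
    · rintro (_ | k)
      · exact derivative_mem_smoothSeries (hq' 0)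
      · exact add_mem (derivative_mem_smoothSeries (hq' (k + 1))) (hq' k)
    · rintro (_ | k) hk
      · exact absurd hk (Nat.not_lt_zero _)
      · rw [derivedCoeff, hzero (k + 1) (by lia), hzero k (by lia), map_zero, add_zero]
    · rw [← add_assoc, derivedCoeff, hzero (N + j + 1) (by lia), map_zero, zero_add, hlead]
    · rw [← add_assoc, ← derivation_sum_mul_iterate, hzero (N + j + 1) (by lia), map_zero,
        zero_mul, add_zero]
      exact derivative_mem_smoothSeries hsum'

theorem mem_smoothSeries_of_ode {N : ℕ} {q : ℕ → PowerSeries ℂ}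
    (hq : ∀ k ≤ N, q k ∈ smoothSeries) (hlead : ∀ z : ℂ, ‖z‖ = 1 → seriesValue (q N) z ≠ 0)
    {f : PowerSeries ℂ} (hf : PolynomialGrowth f)
    (hsum : ∑ k ∈ Finset.range (N + 1), q k * 𝔡^[k] f ∈ smoothSeries) : f ∈ smoothSeries := by
  refine mem_smoothSeries_of_bounded hf fun k => ?_
  obtain ⟨q', hq', -, hlead', hsum'⟩ := exists_prolongation (N := N) (f := f)
    (q := fun k => if k ≤ N then q k else 0)
    (fun k => by
      split_ifs with hk
      exacts [hq k hk, zero_mem _])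
    (fun k hk => if_neg hk.not_ge)
    (by
      convert hsum using 1
      refine Finset.sum_congr rfl fun k hk => ?_
      rw [if_pos (Nat.lt_succ_iff.1 (Finset.mem_range.1 hk))])
    (k + 1)
  rw [if_pos le_rfl] at hlead'
  exact exists_bound_of_ode (fun k _ => hq' k 0) (by rwa [hlead']) hf (hsum' 0) (by lia)

end BoundaryRegularity

section WeightedHardy

theorem betaSq_pos {σ : ℝ} (hσ : 0 < σ) (n : ℕ) : 0 < betaSq σ n := by
  induction n with
  | zero => exact one_pos
  | succ n ih =>
    rw [betaSq]
    positivity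

theorem add_mul_pow_le_add_one_mul_pow {σ x : ℝ} {k : ℕ} (hx : 0 < x) (hk : σ ≤ k) :
    (x + σ) * x ^ k ≤ x * (x + 1) ^ k := by
  have hbernoulli : 1 + k * (1 / x) ≤ (1 + 1 / x) ^ k :=
    one_add_mul_le_pow (by linarith [one_div_pos.2 hx]) k
  calc (x + σ) * x ^ k ≤ (x + k) * x ^ k := by gcongr
    _ = x * (1 + k * (1 / x)) * x ^ k := by field_simp
    _ ≤ x * (1 + 1 / x) ^ k * x ^ k := by gcongr
    _ = x * (x + 1) ^ k := by rw [mul_assoc, ← mul_pow, add_mul, one_div_mul_cancel hx.ne', one_mul]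

theorem one_le_betaSq_mul_pow {σ : ℝ} (hσ : 0 < σ) {k : ℕ} (hk : σ ≤ k) (n : ℕ) :
    1 ≤ betaSq σ n * ((n : ℝ) + 1) ^ k := by
  induction n with
  | zero => simp [betaSq]
  | succ n ih =>
    refine ih.trans ?_
    rw [betaSq, mul_assoc]
    refine mul_le_mul_of_nonneg_left ?_ (betaSq_pos hσ n).le
    rw [div_mul_eq_mul_div, le_div_iff₀ (by positivity), Nat.cast_add_one]
    calc ((n : ℝ) + 1) ^ k * (n + σ) ≤ (n + 1 + σ) * ((n : ℝ) + 1) ^ k := by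
          rw [mul_comm]
          gcongr
          linarith
      _ ≤ (n + 1) * ((n : ℝ) + 1 + 1) ^ k := add_mul_pow_le_add_one_mul_pow (by positivity) hk

theorem polynomialGrowth_of_mem_weightedHardy {σ : ℝ} (hσ : 0 < σ) {f : PowerSeries ℂ}
    (hf : f ∈ weightedHardy σ) : PolynomialGrowth f := by
  obtain ⟨k, hk⟩ := exists_nat_ge σ
  have hsum : Summable fun n => ‖PowerSeries.coeff n f‖ ^ 2 * |betaSq σ n| := hf
  set S := ∑' n, ‖PowerSeries.coeff n f‖ ^ 2 * |betaSq σ n|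
  have hS : 0 ≤ S := tsum_nonneg fun _ => by positivity
  refine ⟨√S, k, fun n => ?_⟩
  have hle : ‖PowerSeries.coeff n f‖ ^ 2 * betaSq σ n ≤ S := by
    rw [← abs_of_pos (betaSq_pos hσ n)]
    exact hsum.le_tsum n fun _ _ => by positivity
  have hpow : 1 ≤ ((n : ℝ) + 1) ^ k := one_le_pow₀ (by linarith [Nat.cast_nonneg (α := ℝ) n])
  refine le_of_sq_le_sq ?_ (by positivity)
  rw [mul_pow, Real.sq_sqrt hS]
  calc ‖PowerSeries.coeff n f‖ ^ 2
      ≤ ‖PowerSeries.coeff n f‖ ^ 2 * (betaSq σ n * ((n : ℝ) + 1) ^ k) :=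
        le_mul_of_one_le_right (by positivity) (one_le_betaSq_mul_pow hσ hk n)
    _ = ‖PowerSeries.coeff n f‖ ^ 2 * betaSq σ n * ((n : ℝ) + 1) ^ k := by ring
    _ ≤ S * (((n : ℝ) + 1) ^ k) ^ 2 := by
        gcongr
        exact le_self_pow₀ hpow two_ne_zero

end WeightedHardy

section TaylorSeries

variable {p : ℂ → ℂ} {z : ℂ}

theorem exists_differentiableOn_ball (hp : AnalyticOnNhd ℂ p (Metric.closedBall 0 1)) :
    ∃ R : ℝ, 1 < R ∧ DifferentiableOn ℂ p (Metric.ball 0 R) := by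
  obtain ⟨δ, hδ, hsub⟩ := (isCompact_closedBall (0 : ℂ) 1).exists_thickening_subset_open
    (isOpen_analyticAt ℂ p) hp
  rw [thickening_closedBall hδ zero_le_one] at hsub
  exact ⟨δ + 1, by linarith, fun z hz => (hsub hz).differentiableAt.differentiableWithinAt⟩

theorem hasSum_taylorSeries {R : ℝ} (hp : DifferentiableOn ℂ p (Metric.ball 0 R)) (hz : ‖z‖ < R) :
    HasSum (fun n => PowerSeries.coeff n (taylorSeries p) * z ^ n) (p z) := by
  refine (Complex.hasSum_taylorSeries_on_ball hp (mem_ball_zero_iff.2 hz)).congr_fun fun n => ?_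
  simp only [taylorSeries, PowerSeries.coeff_mk, sub_zero, smul_eq_mul]
  ring

theorem seriesValue_taylorSeries (hp : AnalyticOnNhd ℂ p (Metric.closedBall 0 1)) (hz : ‖z‖ ≤ 1) :
    seriesValue (taylorSeries p) z = p z := by
  obtain ⟨R, hR, hd⟩ := exists_differentiableOn_ball hp
  exact (hasSum_taylorSeries hd (hz.trans_lt hR)).tsum_eq

theorem summableAt_taylorSeries (hp : AnalyticOnNhd ℂ p (Metric.closedBall 0 1)) :
    SummableAt (taylorSeries p) 1 := by
  obtain ⟨R, hR, hd⟩ := exists_differentiableOn_ball hp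
  have hnorm := (hasSum_taylorSeries hd (z := 1) (by simpa using hR)).summable.norm
  simpa [SummableAt] using hnorm

theorem taylorSeries_mem_smoothSeries (hp : AnalyticOnNhd ℂ p (Metric.closedBall 0 1)) :
    taylorSeries p ∈ smoothSeries := by
  have hgrowth := (summableAt_taylorSeries hp).polynomialGrowth
  refine mem_smoothSeries_of_bounded hgrowth fun k => ?_
  have hpk : AnalyticOnNhd ℂ (iteratedDeriv k p) (Metric.closedBall 0 1) := by
    rw [iteratedDeriv_eq_iterate]
    exact hp.iterated_deriv k
  obtain ⟨M, hM⟩ := (isCompact_closedBall (0 : ℂ) 1).exists_bound_of_continuousOn hpk.continuousOn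
  refine ⟨M, fun z hz => ?_⟩
  have hloc : seriesValue (taylorSeries p) =ᶠ[𝓝 z] p := by
    filter_upwards [Metric.isOpen_ball.mem_nhds (mem_ball_zero_iff.2 hz)] with y hy
    exact seriesValue_taylorSeries hp (mem_ball_zero_iff.1 hy).le
  rw [← hgrowth.iteratedDeriv_eq k hz, hloc.iteratedDeriv_eq]
  exact hM z (mem_closedBall_zero_iff.2 hz.le)

theorem diffExpr_apply (N : ℕ) (p : ℕ → ℂ → ℂ) (f : PowerSeries ℂ) :
    diffExpr N p f = ∑ k ∈ Finset.range (N + 1), taylorSeries (p k) * 𝔡^[k] f := by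
  simp only [diffExpr, LinearMap.sum_apply, LinearMap.comp_apply, LinearMap.mulLeft_apply,
    Module.End.pow_apply]
  rfl

theorem one_mem_smoothSeries : (1 : PowerSeries ℂ) ∈ smoothSeries := by
  rintro (_ | k)
  · refine summable_of_ne_finset_zero (s := {0}) fun n hn => ?_
    rw [Function.iterate_zero_apply, PowerSeries.coeff_one, if_neg (by simpa using hn), norm_zero,
      zero_mul]
  · rw [Function.iterate_succ_apply, PowerSeries.derivative_one, iterate_map_zero]
    exact summableAt_zero 1

theorem mem_smoothSeries_of_diffExpr_sub {N : ℕ} (hN : N ≠ 0) {p : ℕ → ℂ → ℂ}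
    (hreg : IsDRegular N p) {f : PowerSeries ℂ} (hf : PolynomialGrowth f) {lam : ℂ}
    (h : diffExpr N p f - lam • f ∈ smoothSeries) : f ∈ smoothSeries := by
  refine mem_smoothSeries_of_ode (N := N)
    (q := fun k => taylorSeries (p k) - if k = 0 then lam • 1 else 0) (fun k hk => ?_)
    (fun z hz => ?_) hf ?_
  · refine sub_mem (taylorSeries_mem_smoothSeries (hreg.1 k hk)) ?_
    split_ifs
    exacts [Submodule.smul_mem _ _ one_mem_smoothSeries, zero_mem _]
  · simp only [if_neg hN, sub_zero]
    rw [seriesValue_taylorSeries (hreg.1 N le_rfl) hz.le]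
    exact hreg.2 z hz
  · convert h using 1
    rw [diffExpr_apply]
    simp only [sub_mul, Finset.sum_sub_distrib, ite_mul, zero_mul]
    congr 1
    simp

end TaylorSeries

section BoundaryValue

open scoped ContDiff

theorem norm_circleMap_zero_one (θ : ℝ) : ‖circleMap 0 1 θ‖ = 1 := by
  rw [norm_circleMap_zero, abs_one]

theorem summableAt_norm_circleMap {f : PowerSeries ℂ} (hf : f ∈ smoothSeries) (θ : ℝ) :
    SummableAt f ‖circleMap 0 1 θ‖ :=
  summableAt_of_mem_smoothSeries hf (norm_nonneg _) (norm_circleMap_zero_one θ).le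

theorem hasDerivAt_seriesValue_circleMap {f : PowerSeries ℂ} (hf : f ∈ smoothSeries) (θ : ℝ) :
    HasDerivAt (fun t => seriesValue f (circleMap 0 1 t))
      (circleMap 0 1 θ * Complex.I * seriesValue (𝔡 f) (circleMap 0 1 θ)) θ := by
  have hmajorant := SummableAt.of_derivative (hf 1)
  have hbound (n : ℕ) (t : ℝ) : ‖PowerSeries.coeff n f *
      ((n : ℂ) * circleMap 0 1 t ^ (n - 1) * (circleMap 0 1 t * Complex.I))‖ ≤
        ‖PowerSeries.coeff n f‖ * (n * 1 ^ (n - 1)) := by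
    simp
  have hterm (n : ℕ) (t : ℝ) := ((hasDerivAt_pow n (circleMap 0 1 t)).comp t
    (hasDerivAt_circleMap 0 1 t)).const_mul (PowerSeries.coeff n f)
  have hderiv := hasDerivAt_tsum hmajorant hterm hbound (summableAt_norm_circleMap hf 0).summable θ
  have hsummable : Summable fun n : ℕ => PowerSeries.coeff n f *
      ((n : ℂ) * circleMap 0 1 θ ^ (n - 1)) :=
    Summable.of_norm_bounded hmajorant fun n => by simp
  rw [seriesValue_derivative hsummable, ← tsum_mul_left]
  exact hderiv.congr_deriv (tsum_congr fun n => by ring)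

theorem contDiff_seriesValue_circleMap {f : PowerSeries ℂ} (hf : f ∈ smoothSeries) :
    ContDiff ℝ ∞ fun θ => seriesValue f (circleMap 0 1 θ) := by
  refine contDiff_infty.2 fun n => ?_
  induction n generalizing f with
  | zero =>
    exact contDiff_zero.2 (continuous_iff_continuousAt.2 fun θ =>
      (hasDerivAt_seriesValue_circleMap hf θ).continuousAt)
  | succ n ih =>
    rw [Nat.cast_add_one, contDiff_succ_iff_deriv]
    refine ⟨fun θ => (hasDerivAt_seriesValue_circleMap hf θ).differentiableAt,
      fun h => absurd h (WithTop.coe_ne_top (a := (n : ℕ∞))), ?_⟩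
    rw [funext fun θ => (hasDerivAt_seriesValue_circleMap hf θ).deriv]
    exact ((contDiff_circleMap 0 1).mul contDiff_const).mul (ih (derivative_mem_smoothSeries hf))

/-- The boundary values of a smooth power series, as a function of the argument. -/
noncomputable def boundaryValue : smoothSeries →ₗ[ℂ] SmoothPeriodic where
  toFun f := ⟨fun θ => seriesValue f (circleMap 0 1 θ), contDiff_seriesValue_circleMap f.2,
    fun θ => by simp only [periodic_circleMap 0 1 θ]⟩
  map_add' f g := Subtype.ext <| funext fun θ =>
    seriesValue_add (summableAt_norm_circleMap f.2 θ) (summableAt_norm_circleMap g.2 θ)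
  map_smul' a f := Subtype.ext <| funext fun _ => seriesValue_smul a f _

theorem boundaryValue_apply (f : smoothSeries) (θ : ℝ) :
    boundaryValue f θ = seriesValue f (circleMap 0 1 θ) := rfl

theorem injective_boundaryValue : Function.Injective boundaryValue := by
  refine (injective_iff_map_eq_zero _).2 fun f hf => ?_
  have hgrowth : PolynomialGrowth (f : PowerSeries ℂ) := (f.2 0).polynomialGrowth
  have hcircle (z : ℂ) (hz : z ∈ frontier (Metric.ball (0 : ℂ) 1)) :
      ‖seriesValue (f : PowerSeries ℂ) z‖ ≤ 0 := by
    rw [frontier_ball _ one_ne_zero, ← abs_one, ← range_circleMap] at hz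
    obtain ⟨θ, rfl⟩ := hz
    rw [← boundaryValue_apply, hf]
    exact norm_zero.le
  have hdiff : DiffContOnCl ℂ (seriesValue (f : PowerSeries ℂ)) (Metric.ball 0 1) := by
    refine ⟨fun z hz => (hgrowth.hasDerivAt
      (mem_ball_zero_iff.1 hz)).differentiableAt.differentiableWithinAt, ?_⟩
    rw [closure_ball _ one_ne_zero]
    exact continuousOn_seriesValue (f.2 0)
  have hdisc (z : ℂ) (hz : ‖z‖ < 1) : ‖seriesValue (f : PowerSeries ℂ) z‖ ≤ 0 :=
    Complex.norm_le_of_forall_mem_frontier_norm_le Metric.isBounded_ball hdiff hcircle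
      (subset_closure (mem_ball_zero_iff.2 hz))
  ext n
  exact norm_le_zero_iff.1 (hgrowth.norm_coeff_le hdisc n)

end BoundaryValue

section RSymmetric

theorem sub_mul_sub_one_div_conj {a z : ℂ} (ha : a ≠ 0) (hz : ‖z‖ = 1) :
    (z - a) * (z - 1 / (starRingEnd ℂ) a) =
      -1 / (starRingEnd ℂ) a * z * ((‖z - a‖ ^ 2 : ℝ) : ℂ) := by
  have hconj : (starRingEnd ℂ) a ≠ 0 := (_root_.map_ne_zero _).2 ha
  have hzz : z * (starRingEnd ℂ) z = 1 := by
    rw [Complex.mul_conj, Complex.normSq_eq_norm_sq, hz, one_pow, Complex.ofReal_one]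
  rw [← Complex.normSq_eq_norm_sq, ← Complex.mul_conj, map_sub]
  field_simp
  linear_combination (z - a) * hzz

theorem multiset_prod_sub_mul_prod_sub_one_div_conj {s : Multiset ℂ} (hs : ∀ a ∈ s, a ≠ 0) {z : ℂ}
    (hz : ‖z‖ = 1) :
    (s.map fun a => z - a).prod * (s.map fun a => z - 1 / (starRingEnd ℂ) a).prod =
      (s.map fun a => -1 / (starRingEnd ℂ) a).prod * z ^ s.card *
        ((s.map fun a => ‖z - a‖ ^ 2).prod : ℝ) := by
  rw [← Multiset.prod_map_mul,
    Multiset.map_congr rfl fun a ha => sub_mul_sub_one_div_conj (hs a ha) hz,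
    Multiset.prod_map_mul, Multiset.prod_map_mul, Multiset.map_const', Multiset.prod_replicate,
    ← Complex.ofRealHom_eq_coe, map_multiset_prod, Multiset.map_map]
  rfl

theorem IsRSymmetric.exists_eval_eq {N : ℕ} {P : ℂ[X]} (hP : IsRSymmetric N P) :
    ∃ C : ℂ, C ≠ 0 ∧ ∀ z : ℂ, ‖z‖ = 1 → ∃ w : ℝ, 0 < w ∧ P.eval z = C * z ^ N * w := by
  obtain ⟨hP0, -, s, hcard, hs, hroots⟩ := hP
  refine ⟨P.leadingCoeff * (s.map fun a => -1 / (starRingEnd ℂ) a).prod,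
    mul_ne_zero (leadingCoeff_ne_zero.2 hP0) (Multiset.prod_ne_zero fun h => ?_), fun z hz =>
    ⟨(s.map fun a => ‖z - a‖ ^ 2).prod, ?_, ?_⟩⟩
  · obtain ⟨a, ha, h0⟩ := Multiset.mem_map.1 h
    simp [(hs a ha).1] at h0
  · refine Multiset.prod_pos fun x hx => ?_
    obtain ⟨a, ha, rfl⟩ := Multiset.mem_map.1 hx
    have hza : z ≠ a := fun h => (hs a ha).2.ne (h ▸ hz)
    exact pow_pos (norm_pos_iff.2 (sub_ne_zero.2 hza)) 2
  · have hpow : z ^ N = z ^ s.card * z ^ (N - s.card) := by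
      rw [← pow_add, Nat.add_sub_cancel' hcard]
    rw [(IsAlgClosed.splits P).eval_eq_prod_roots, hroots]
    simp only [Multiset.map_add, Multiset.prod_add, Multiset.map_replicate, sub_zero,
      Multiset.prod_replicate, Multiset.map_map, Function.comp_def]
    rw [hpow]
    linear_combination P.leadingCoeff * z ^ (N - s.card) *
      multiset_prod_sub_mul_prod_sub_one_div_conj (fun a ha => (hs a ha).1) hz

end RSymmetric

section Density

open scoped ContDiff

/-- The function `exp (-iθ)`, that is `1 / z` on the unit circle. -/
noncomputable def SmoothPeriodic.circleInv : SmoothPeriodic :=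
  ⟨fun θ => (circleMap 0 1 θ)⁻¹,
    (contDiff_circleMap 0 1).inv fun _ => circleMap_ne_center one_ne_zero,
    fun θ => by simp only [periodic_circleMap 0 1 θ]⟩

namespace CircleDensity

theorem exists_h_eq_const_mul {v : ℝ → ℝ} (hv : ContDiff ℝ ∞ v)
    (hper : Function.Periodic v (2 * Real.pi)) (hpos : ∀ θ, 0 < v θ) :
    ∃ (d : CircleDensity) (κ : ℝ), 0 < κ ∧ ∀ θ, d.h θ = κ * v θ := by
  have hint : 0 < ∫ θ in (0 : ℝ)..2 * Real.pi, v θ :=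
    intervalIntegral.intervalIntegral_pos_of_pos (hv.continuous.intervalIntegrable _ _) hpos
      Real.two_pi_pos
  have hκ := div_pos Real.two_pi_pos hint
  exact ⟨{ h := fun θ => 2 * Real.pi / (∫ θ in (0 : ℝ)..2 * Real.pi, v θ) * v θ
           smooth := contDiff_const.mul hv
           periodic := fun θ => by simp only [hper θ]
           pos := fun θ => mul_pos hκ (hpos θ)
           integral := by rw [intervalIntegral.integral_const_mul, div_mul_cancel₀ _ hint.ne'] },
    _, hκ, fun θ => rfl⟩

theorem exists_mul_h_pow_eq_const {w : ℝ → ℝ} (hw : ContDiff ℝ ∞ w)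
    (hper : Function.Periodic w (2 * Real.pi)) (hpos : ∀ θ, 0 < w θ) {n : ℕ} (hn : n ≠ 0) :
    ∃ (d : CircleDensity) (κ : ℝ), 0 < κ ∧ ∀ θ, w θ * d.h θ ^ n = κ := by
  obtain ⟨d, κ, hκ, hd⟩ := exists_h_eq_const_mul (v := fun θ => (w θ)⁻¹ ^ (n : ℝ)⁻¹)
    ((hw.inv fun θ => (hpos θ).ne').rpow_const_of_ne fun θ => (inv_pos.2 (hpos θ)).ne')
    (fun θ => by simp only [hper θ]) fun θ => Real.rpow_pos_of_pos (inv_pos.2 (hpos θ)) _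
  refine ⟨d, κ ^ n, pow_pos hκ n, fun θ => ?_⟩
  rw [hd, mul_pow, Real.rpow_inv_natCast_pow (inv_pos.2 (hpos θ)).le hn, mul_left_comm,
    mul_inv_cancel₀ (hpos θ).ne', mul_one]

variable (d : CircleDensity)

/-- The function `g` for which `d/dz = g · δ` on the unit circle, where `δ` is the derivation of the
density. -/
noncomputable def factor : SmoothPeriodic := SmoothPeriodic.circleInv * d.density

theorem factor_apply (θ : ℝ) : d.factor θ = (circleMap 0 1 θ)⁻¹ * d.h θ := rfl

theorem exists_mul_factor_pow_eq_algebraMap {n : ℕ} (hn : n ≠ 0) {C : ℂ} (hC : C ≠ 0)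
    {u : SmoothPeriodic} (hu : ∀ θ, ∃ w : ℝ, 0 < w ∧ u θ = C * circleMap 0 1 θ ^ n * w) :
    ∃ (d : CircleDensity) (C₁ : ℂ), C₁ ≠ 0 ∧ u * d.factor ^ n = algebraMap ℂ SmoothPeriodic C₁ := by
  choose w hpos hu using hu
  set v : SmoothPeriodic := algebraMap ℂ SmoothPeriodic C⁻¹ * (SmoothPeriodic.circleInv ^ n * u)
  have hz (θ : ℝ) : circleMap 0 1 θ ^ n ≠ 0 := pow_ne_zero n (circleMap_ne_center one_ne_zero)
  have hv (θ : ℝ) : v θ = w θ := by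
    change C⁻¹ * ((circleMap 0 1 θ)⁻¹ ^ n * u θ) = w θ
    have := hz θ
    rw [hu, inv_pow]
    field_simp
  have hre : w = fun θ => (v θ).re := funext fun θ => by rw [hv, Complex.ofReal_re]
  obtain ⟨d, κ, hκ, hd⟩ := exists_mul_h_pow_eq_const (w := w)
    (hre ▸ Complex.reCLM.contDiff.comp (SmoothPeriodic.contDiff_coe v))
    (hre ▸ (SmoothPeriodic.periodic_coe v).comp Complex.re) hpos hn
  refine ⟨d, C * κ, mul_ne_zero hC (Complex.ofReal_ne_zero.2 hκ.ne'), ?_⟩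
  ext θ
  change u θ * ((circleMap 0 1 θ)⁻¹ * d.h θ) ^ n = C * κ
  have := hz θ
  rw [hu, mul_pow, inv_pow, ← hd θ]
  push_cast
  field_simp

theorem boundaryValue_derivative {f : PowerSeries ℂ} (hf : f ∈ smoothSeries) :
    boundaryValue ⟨𝔡 f, derivative_mem_smoothSeries hf⟩ =
      d.factor * d.delta (boundaryValue ⟨f, hf⟩) := by
  ext θ
  have hderiv : deriv (boundaryValue ⟨f, hf⟩) θ =
      circleMap 0 1 θ * Complex.I * seriesValue (𝔡 f) (circleMap 0 1 θ) :=
    (hasDerivAt_seriesValue_circleMap hf θ).deriv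
  have hz : circleMap 0 1 θ ≠ 0 := circleMap_ne_center one_ne_zero
  have hh := d.ofReal_h_ne_zero θ
  rw [boundaryValue_apply, Subalgebra.coe_mul, Pi.mul_apply, d.delta_apply, hderiv, factor_apply]
  field_simp
  rw [Complex.I_sq]
  ring

theorem boundaryValue_iterate_derivative {f : PowerSeries ℂ} (hf : f ∈ smoothSeries) (k : ℕ) :
    boundaryValue ⟨𝔡^[k] f, iterate_derivative_mem_smoothSeries hf k⟩ =
      (fun v => d.factor * d.delta v)^[k] (boundaryValue ⟨f, hf⟩) := by
  induction k with
  | zero => rfl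
  | succ k ih =>
    rw [Function.iterate_succ_apply' (fun v => d.factor * d.delta v), ← ih,
      ← d.boundaryValue_derivative]
    congr 2
    exact Function.iterate_succ_apply' _ _ _

theorem boundaryValue_diffExpr {N : ℕ} {p : ℕ → ℂ → ℂ}
    (hp : ∀ k ≤ N, AnalyticOnNhd ℂ (p k) (Metric.closedBall 0 1)) {P : ℕ → SmoothPeriodic}
    (hP : ∀ k ≤ N, ∀ θ, P k θ = p k (circleMap 0 1 θ))
    {f : PowerSeries ℂ} (hf : f ∈ smoothSeries) (hLf : diffExpr N p f ∈ smoothSeries) :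
    boundaryValue ⟨diffExpr N p f, hLf⟩ = ∑ k ∈ Finset.range (N + 1),
      P k * (fun v => d.factor * d.delta v)^[k] (boundaryValue ⟨f, hf⟩) := by
  ext θ
  simp only [boundaryValue_apply, diffExpr_apply]
  rw [seriesValue_sum_mul, AddSubmonoidClass.coe_finsetSum, Finset.sum_apply]
  · refine Finset.sum_congr rfl fun k hk => ?_
    have hkN : k ≤ N := Finset.mem_range_succ_iff.1 hk
    rw [seriesValue_taylorSeries (hp k hkN) (norm_circleMap_zero_one θ).le, ← hP k hkN,
      ← d.boundaryValue_iterate_derivative]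
    rfl
  · exact fun k hk => summableAt_norm_circleMap
      (taylorSeries_mem_smoothSeries (hp k (Finset.mem_range_succ_iff.1 hk))) θ
  · exact fun k _ => summableAt_norm_circleMap (iterate_derivative_mem_smoothSeries hf k) θ

end CircleDensity

end Density

section Intertwining

universe u

variable {E V : Type u} [AddCommGroup E] [Module ℂ E] [AddCommGroup V] [Module ℂ V]

theorem genEigenspace_smul {C : ℂ} (hC : C ≠ 0) (A : Module.End ℂ V) (lam : ℂ) (k : ℕ∞) :
    (C • A).genEigenspace lam k = A.genEigenspace (lam / C) k := by
  have hsmul : C • A - lam • 1 = C • (A - (lam / C) • 1) := by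
    rw [smul_sub, smul_smul, mul_div_cancel₀ _ hC]
  ext x
  simp only [Module.End.mem_genEigenspace, hsmul, _root_.smul_pow,
    LinearMap.ker_smul _ _ (pow_ne_zero _ hC)]

theorem monotone_nullPow (T : E →ₗ.[ℂ] E) (lam : ℂ) : Monotone (nullPow T lam) := by
  refine monotone_nat_of_le_succ fun j => ?_
  induction j with
  | zero => exact bot_le
  | succ j ih =>
    rintro _ ⟨g, hg, rfl⟩
    exact ⟨g, ih hg, rfl⟩

/-- The linear map `Ψ`, defined on a subspace `S`, intertwines the partially defined operator `T`
with `A`, and `S` contains all solutions of `T g - λ g ∈ S`; hence it contains all root vectors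
of `T`, and `Ψ` maps them to root vectors of `A`. -/
structure Intertwines (T : E →ₗ.[ℂ] E) {S : Submodule ℂ E} (Ψ : S →ₗ[ℂ] V) (A : Module.End ℂ V) :
    Prop where
  mem_of_sub_mem : ∀ (g : T.domain) (lam : ℂ), T g - lam • (g : E) ∈ S → (g : E) ∈ S
  map_apply : ∀ (g : T.domain) (hg : (g : E) ∈ S) (hT : T g ∈ S), Ψ ⟨T g, hT⟩ = A (Ψ ⟨g, hg⟩)

namespace Intertwines

variable {T : E →ₗ.[ℂ] E} {S : Submodule ℂ E} {Ψ : S →ₗ[ℂ] V} {A : Module.End ℂ V} {lam : ℂ}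

theorem map_sub_smul (h : Intertwines T Ψ A) (g : T.domain) (hg : T g - lam • (g : E) ∈ S) :
    Ψ ⟨T g - lam • (g : E), hg⟩ = (A - lam • 1) (Ψ ⟨g, h.mem_of_sub_mem g lam hg⟩) := by
  have hgS := h.mem_of_sub_mem g lam hg
  have hT : T g ∈ S := (S.sub_mem_iff_left (S.smul_mem lam hgS)).1 hg
  change Ψ (⟨T g, hT⟩ - lam • ⟨g, hgS⟩) = _
  rw [map_sub, map_smul, h.map_apply g hgS hT]
  rfl

theorem mem_genEigenspace_of_mem_nullPow (h : Intertwines T Ψ A) (j : ℕ) {f : E}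
    (hf : f ∈ nullPow T lam j) : ∃ hS : f ∈ S, Ψ ⟨f, hS⟩ ∈ A.genEigenspace lam j := by
  induction j generalizing f with
  | zero =>
    obtain rfl : f = 0 := hf
    exact ⟨zero_mem S, (map_zero Ψ).symm ▸ zero_mem _⟩
  | succ j ih =>
    obtain ⟨g, hg, rfl⟩ := hf
    obtain ⟨hS, hj⟩ : ∃ hS : T g - lam • (g : E) ∈ S,
        Ψ ⟨T g - lam • (g : E), hS⟩ ∈ A.genEigenspace lam j := ih hg
    refine ⟨h.mem_of_sub_mem g lam hS, ?_⟩
    rw [h.map_sub_smul g hS, Module.End.mem_genEigenspace_nat, LinearMap.mem_ker] at hj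
    rw [Module.End.mem_genEigenspace_nat, LinearMap.mem_ker, pow_succ, Module.End.mul_apply]
    exact hj

theorem hasEigenvalue (h : Intertwines T Ψ A) (hΨ : Function.Injective Ψ)
    (hlam : IsEigenvalue T lam) : A.HasEigenvalue lam := by
  obtain ⟨g, hg0, hg⟩ := hlam
  have hnull : (g : E) ∈ nullPow T lam 1 := ⟨g, sub_eq_zero.2 hg, rfl⟩
  obtain ⟨hS, h1⟩ := h.mem_genEigenspace_of_mem_nullPow 1 hnull
  refine Module.End.hasEigenvalue_of_hasEigenvector (x := Ψ ⟨g, hS⟩) ⟨h1, fun h0 => hg0 ?_⟩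
  exact congrArg Subtype.val ((map_eq_zero_iff Ψ hΨ).1 h0)

theorem algMultiplicity_le (h : Intertwines T Ψ A) (hΨ : Function.Injective Ψ) :
    algMultiplicity T lam ≤ Module.rank ℂ (A.maxGenEigenspace lam) := by
  have hmem (f : E) (hf : f ∈ ⨆ j, nullPow T lam j) :
      ∃ hS : f ∈ S, Ψ ⟨f, hS⟩ ∈ A.maxGenEigenspace lam := by
    obtain ⟨j, hj⟩ :=
      (Submodule.mem_iSup_of_directed _ (monotone_nullPow T lam).directed_le).1 hf
    obtain ⟨hS, hΨf⟩ := h.mem_genEigenspace_of_mem_nullPow j hj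
    exact ⟨hS, (A.genEigenspace lam).mono le_top hΨf⟩
  have hle : ⨆ j, nullPow T lam j ≤ S := fun f hf => (hmem f hf).1
  exact LinearMap.rank_le_of_injective
    ((Ψ ∘ₗ Submodule.inclusion hle).codRestrict (A.maxGenEigenspace lam) fun f => (hmem f f.2).2)
    fun _ _ hfg => Submodule.inclusion_injective hle (hΨ (congrArg Subtype.val hfg))

end Intertwines

end Intertwining

section Eigenvalues

/-- The boundary values of the smooth elements of the weighted Hardy space, multiplied by `e`. -/
noncomputable def gaugedBoundaryValue (σ : ℝ) (e : SmoothPeriodic) :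
    smoothSeries.comap (weightedHardy σ).subtype →ₗ[ℂ] SmoothPeriodic :=
  LinearMap.mulLeft ℂ e ∘ₗ boundaryValue ∘ₗ (weightedHardy σ).subtype.restrict fun _ hf => hf

theorem injective_gaugedBoundaryValue (σ : ℝ) {E E' : SmoothPeriodic} (hE : E' * E = 1) :
    Function.Injective (gaugedBoundaryValue σ E') := by
  have hmul : Function.LeftInverse (fun u => E * u) (fun u => E' * u) := fun u => by
    change E * (E' * u) = u
    rw [← mul_assoc, mul_comm E, hE, one_mul]
  refine hmul.injective.comp (injective_boundaryValue.comp fun f g hfg => ?_)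
  have hseries := congrArg Subtype.val hfg
  exact Subtype.ext (Subtype.ext hseries)

theorem exists_intertwines_maximalOperator {σ : ℝ} (hσ : 0 < σ) {k : ℕ} {p : ℕ → ℂ → ℂ}
    (hp : ∀ j ≤ k + 2, AnalyticOnNhd ℂ (p j) (Metric.closedBall 0 1)) {C : ℂ} (hC : C ≠ 0)
    (hlead : ∀ z, ‖z‖ = 1 → ∃ w : ℝ, 0 < w ∧ p (k + 2) z = C * z ^ (k + 2) * w) :
    ∃ (C₁ α : ℂ) (A : Module.End ℂ SmoothPeriodic) (c : SmoothPeriodic →ₗ[ℂ] ℤ → ℂ) (K : ℝ)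
      (e : SmoothPeriodic), C₁ ≠ 0 ∧ IsPowerPerturbation A c α k K 2 ∧
        Function.Injective (gaugedBoundaryValue σ e) ∧
        Intertwines (maximalOperator σ (k + 2) p) (gaugedBoundaryValue σ e) (C₁ • A) := by
  have hreg : IsDRegular (k + 2) p := ⟨hp, fun z hz => by
    obtain ⟨w, hw, hpw⟩ := hlead z hz
    have hz0 : z ≠ 0 := norm_ne_zero_iff.1 (hz ▸ one_ne_zero)
    rw [hpw]
    exact mul_ne_zero (mul_ne_zero hC (pow_ne_zero _ hz0)) (Complex.ofReal_ne_zero.2 hw.ne')⟩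
  have hcircle (j : ℕ) : ∃ u : SmoothPeriodic, j ≤ k + 2 → ∀ θ, u θ = p j (circleMap 0 1 θ) := by
    by_cases hj : j ≤ k + 2
    · exact ⟨boundaryValue ⟨_, taylorSeries_mem_smoothSeries (hp j hj)⟩, fun _ θ =>
        seriesValue_taylorSeries (hp j hj) (norm_circleMap_zero_one θ).le⟩
    · exact ⟨0, fun h => absurd h hj⟩
  choose P hP using hcircle
  obtain ⟨d, C₁, hC₁, hd⟩ := CircleDensity.exists_mul_factor_pow_eq_algebraMap
    (u := P (k + 2)) (k + 1).succ_ne_zero hC fun θ => by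
      rw [hP _ le_rfl]
      exact hlead _ (norm_circleMap_zero_one θ)
  obtain ⟨α, E, E', b, hE, hform⟩ := exists_normal_form d.delta P d.factor (k + 1) hC₁ hd
    d.exists_gauge
  obtain ⟨K, hK⟩ := exists_isPowerPerturbation one_le_two d.coeff_delta d.memLp_coeff
    d.injective_coeff d.exists_lpNorm_coeff_mul_le α k b
  refine ⟨C₁, α, _, _, K, E', hC₁, hK, injective_gaugedBoundaryValue σ hE, fun g lam hg => ?_,
    fun g hg hT => ?_⟩
  · exact mem_smoothSeries_of_diffExpr_sub (k + 1).succ_ne_zero hreg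
      (polynomialGrowth_of_mem_weightedHardy hσ g.1.2) hg
  · have hf' : (g : weightedHardy σ).1 ∈ smoothSeries := hg
    have hLf : diffExpr (k + 2) p (g : weightedHardy σ).1 ∈ smoothSeries := hT
    change E' * boundaryValue ⟨_, hLf⟩ =
      C₁ • perturbedPower d.delta α k b (E' * boundaryValue ⟨_, hf'⟩)
    rw [d.boundaryValue_diffExpr hp hP hf' hLf, perturbedPower_apply, ← hform, ← mul_assoc E,
      mul_comm E, hE, one_mul]

theorem isBigO_abs_intCast_pow {f : ℤ → ℂ} {α : ℂ} {k : ℕ} {K : ℝ}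
    (h : ∀ᶠ n in cofinite, ‖f n‖ ≤ K * (1 + ‖(n : ℂ) + α‖) ^ k) :
    f =O[cofinite] fun n => |(n : ℝ)| ^ k := by
  have hbase : (fun n : ℤ => 1 + ‖(n : ℂ) + α‖) =O[cofinite] fun n => |(n : ℝ)| := by
    refine .of_bound (2 + ‖α‖) ?_
    filter_upwards [(Set.finite_singleton (0 : ℤ)).compl_mem_cofinite] with n hn
    have hn1 : (1 : ℝ) ≤ |(n : ℝ)| := by exact_mod_cast Int.one_le_abs hn
    have htri := norm_add_le (n : ℂ) α
    rw [Complex.norm_intCast] at htri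
    rw [Real.norm_of_nonneg (by positivity), Real.norm_of_nonneg (abs_nonneg _)]
    nlinarith [norm_nonneg α]
  refine .trans (.of_bound K ?_) (hbase.pow k)
  filter_upwards [h] with n hn
  rwa [Real.norm_of_nonneg (by positivity)]

theorem isBigO_abs_intCast_rpow {s t : ℝ} (h : s ≤ t) :
    (fun n : ℤ => |(n : ℝ)| ^ s) =O[cofinite] fun n => |(n : ℝ)| ^ t := by
  refine .of_bound 1 ?_
  filter_upwards [(Set.finite_singleton (0 : ℤ)).compl_mem_cofinite] with n hn
  have hn1 : (1 : ℝ) ≤ |(n : ℝ)| := by exact_mod_cast Int.one_le_abs hn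
  rw [one_mul, Real.norm_of_nonneg (by positivity), Real.norm_of_nonneg (by positivity)]
  exact Real.rpow_le_rpow_of_exponent_le hn1 h

theorem mainTheorem4_general {σ : ℝ} (hσ : 0 < σ) {N : ℕ} (hN : 2 ≤ N) {p : ℕ → ℂ → ℂ}
    (hp : ∀ k ≤ N, AnalyticOnNhd ℂ (p k) (Metric.closedBall 0 1)) {C : ℂ} (hC : C ≠ 0)
    (hlead : ∀ z, ‖z‖ = 1 → ∃ w : ℝ, 0 < w ∧ p N z = C * z ^ N * w) :
    (∃ (C₁ C₂ : ℂ) (μ : ℤ → ℂ), C₁ ≠ 0 ∧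
      (∀ lam, IsEigenvalue (maximalOperator σ N p) lam → ∃ n, lam = μ n) ∧
      (fun n => μ n / C₁ - ((n : ℂ) + C₂) ^ N) =O[cofinite] fun n => |(n : ℝ)| ^ ((N : ℝ) - 2)) ∧
    ∃ R : ℝ, ∀ lam, IsEigenvalue (maximalOperator σ N p) lam → R < ‖lam‖ →
      algMultiplicity (maximalOperator σ N p) lam ≤ 2 := by
  obtain ⟨k, rfl⟩ := Nat.exists_eq_add_of_le' hN
  obtain ⟨C₁, α, A, c, K, e, hC₁, hA, hinj, hΨ⟩ := exists_intertwines_maximalOperator hσ hp hC hlead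
  have heig {lam : ℂ} (h : IsEigenvalue (maximalOperator σ (k + 2) p) lam) :
      A.HasEigenvalue (lam / C₁) := by
    have := hΨ.hasEigenvalue hinj h
    rwa [Module.End.HasEigenvalue, Module.End.HasUnifEigenvalue, genEigenspace_smul hC₁] at this
  obtain ⟨μ, hμ, hbound⟩ := hA.exists_enumeration
  obtain ⟨R, hR⟩ := hA.exists_rank_maxGenEigenspace_le_two
  refine ⟨⟨C₁, α, fun n => C₁ * μ n, hC₁, fun lam hlam => ?_, ?_⟩, R * ‖C₁‖, fun lam hlam hlt => ?_⟩
  · obtain ⟨n, hn⟩ := hμ _ (heig hlam)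
    exact ⟨n, by simp only [← hn, mul_div_cancel₀ _ hC₁]⟩
  · simp only [mul_div_cancel_left₀ _ hC₁, Nat.cast_add, Nat.cast_ofNat, add_sub_cancel_right,
      Real.rpow_natCast]
    refine isBigO_abs_intCast_pow (α := α) (K := 4 * K) ?_
    simpa only [mul_assoc] using hbound
  · refine (hΨ.algMultiplicity_le hinj).trans ?_
    rw [Module.End.maxGenEigenspace, genEigenspace_smul hC₁]
    exact hR _ (heig hlam) (by rwa [norm_div, lt_div_iff₀ (norm_pos_iff.2 hC₁)])

end Eigenvalues

theorem mainTheorem4 (σ : ℝ) (hσ : 0 < σ) (N : ℕ) (hN : 2 ≤ N) (p : ℕ → ℂ → ℂ)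
    (hreg : IsDRegular N p)
    (P : ℂ[X]) (hP : IsRSymmetric N P) (hpP : ∀ z ∈ Metric.closedBall (0 : ℂ) 1, p N z = P.eval z) :
    (∃ (C₁ : ℂ) (τ : ℝ) (C₂ : ℂ), C₁ ≠ 0 ∧ 0 < τ ∧
      ∀ ε : ℝ, 0 < ε → ε < 1 →
        ∃ μ : ℤ → ℂ,
          (∀ lam : ℂ, IsEigenvalue (maximalOperator σ N p) lam → ∃ n : ℤ, lam = μ n) ∧
          (fun n : ℤ => μ n / C₁ - ((n : ℂ) / (τ : ℂ) + C₂) ^ N) =O[Filter.cofinite]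
            (fun n : ℤ => |(n : ℝ)| ^ ((N : ℝ) - 2 + ε))) ∧
    ∃ R : ℝ, ∀ lam : ℂ, IsEigenvalue (maximalOperator σ N p) lam → R < ‖lam‖ →
      algMultiplicity (maximalOperator σ N p) lam ≤ 2 := by
  obtain ⟨C, hC, hlead⟩ := hP.exists_eval_eq
  obtain ⟨⟨C₁, C₂, μ, hC₁, hμ, hO⟩, hR⟩ := mainTheorem4_general hσ hN hreg.1 hC fun z hz => by
    rw [hpP z (mem_closedBall_zero_iff.2 hz.le)]
    exact hlead z hz
  refine ⟨⟨C₁, 1, C₂, hC₁, one_pos, fun ε hε _ => ⟨μ, hμ, ?_⟩⟩, hR⟩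
  simpa only [Complex.ofReal_one, div_one] using
    hO.trans (isBigO_abs_intCast_rpow (le_add_of_nonneg_right hε.le))
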